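/- **Setting.** Let $A=(A_{ij})_{1\le i<j\le n}$ be the adjacency matrix of an undirected network on $[n]=\{1,\dots,n\}$ (with $A_{ji}=A_{ij}$), let $m=m(n)$ be integers with $1\le m(n)\le n$, and let $\mathcal M\subset[n]$ be uniformly distributed on the subsets of size $m$, independently of $A$. Put $$\hat p^{\mathcal M}=\frac{1}{m\binom{n-1}{2}}\sum_{i\in\mathcal M}\ \sum_{j<k;\ j,k\ne i}\frac{A_{ij}+A_{ik}+A_{jk}}{3},\qquad \hat F_3^{\mathcal M}=\frac{1}{m\binom{n-1}{2}}\sum_{i\in\mathcal M}\ \sum_{j<k;\ j,k\ne i}A_{ij}A_{ik}A_{jk},$$ $$\hat F_2^{\mathcal M}=\frac{1}{m\binom{n-1}{2}}\sum_{i\in\mathcal M}\ \sum_{j<k;\ j,k\ne i}\bigl[A_{ij}A_{ik}(1-A_{jk})+A_{ij}A_{jk}(1-A_{ik})+A_{ik}A_{jk}(1-A_{ij})\bigr],$$ $T_2=3\hat p^2(1-\hat p)-\hat F_2^{\mathcal M}$ and $T_3=\hat p^3-\hat F_3^{\mathcal M}$ with $\hat p=\hat p^{\mathcal M}$, $$f(n,m)=\frac{m^2(n-1)^2(n-2)^2}{36\binom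 m3+16\binom m2(n-m)+4m\binom{n-m}2},$$ $$(T^{\mathcal M})^2=f(n,m)\left(\frac{T_2^2}{3\hat p^2(1-\hat p)^2(1-3\hat p)^2+9\hat p^3(1-\hat p)^3}+\frac{T_3^2}{\hat p^3(1-\hat p)^3+3\hat p^4(1-\hat p)^2}\right)$$ (with $0/0=0$, which concerns only empty and complete networks), and consider the test $\phi^{\mathcal M}=\mathbb I\{(T^{\mathcal M})^2>C_n\}$, where $C_n\to\infty$. All parameters below may depend on $n$ unless stated otherwise. For classes $\mathcal P_n$ of distributions of $A$ we say that *the power tends to one over $\mathcal P_n$* if $\inf_{\mathbb P_1\in\mathcal P_n}\mathbb P_1\phi^{\mathcal M}\to1$ whenever $C_n\to\infty$ slowly enough, that is, if there is a sequence $D_n\to\infty$ such that this holds for every $C_n\to\infty$ with $C_n\le D_n$ for all large $n$ (an infimum over an empty class is read as $1$). Probabilities are with respect to both $A$ and $\mathcal M$. **Theorem.** *Type-I error.* If the $A_{ij}$ are i.i.d. Bernoulli$(p)$ (Erdős–Rényi), where $p\to0$ and $p^3mn^2\to\infty$, then $\mathbb P\phi^{\mathcal M}\to0$ for every $C_n\to\infty$.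 *Power.* In each of the following situations the power tends to one. 1. Over $\mathcal S(\pi,a,b)$, with $\pi\in(0,1/2)$ not depending on $n$ and $a,b\in[0,1]$: the $A_{ij}$ are independent, $A_{ij}\sim$ Bernoulli$(a)$ if $z(i)=z(j)$ and Bernoulli$(b)$ otherwise, for some $z\in\{1,2\}^n$ with $n\pi\le|\{i:z(i)=1\}|\le n(1-\pi)$. Assume $n(a+b)\to\infty$ and that either $a+b=O(n^{-2/3})$ and $\frac{(mn^2)^{1/3}(a-b)^2}{a+b}\to\infty$, or $a+b=\Omega(n^{-2/3})$ and $\frac{m(a-b)^6}{(a+b)^6}\to\infty$. 2. Over $\mathcal S(k,a,b)$, with $k\ge2$ and $a,b\in[0,1]$: the $A_{ij}$ are independent, $A_{ij}\sim$ Bernoulli$(a)$ if $z(i)=z(j)$ and Bernoulli$(b)$ otherwise, for some $z\in[k]^n$ with $\frac nk-1\le|\{i:z(i)=j\}|\le\frac nk+1$ for all $j\in[k]$. Assume $n(a+b)\to\infty$ and that either $a+b=O(n^{-2/3})$ and $\frac{(mn^2)^{1/3}(a-b)^2}{k^{4/3}(a+b)}\to\infty$, or $a+b=\Omega(n^{-2/3})$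 and $\frac{m(a-b)^6}{k^4(a+b)^6}\to\infty$. 3. Over the configuration models $\mathcal C(\rho,\delta)$, with $\delta\ge0$: the $A_{ij}$ are independent, $A_{ij}\sim$ Bernoulli$(\theta_i\theta_j)$, for some $\theta\in\mathbb R^n$ such that $\theta_i\theta_j\in[0,1]$ for $i<j$, $\|\theta\|_\infty^2\le\rho$ and $\bigl(\frac1n\sum_i\theta_i^2\bigr)^3-\bigl(\frac1n\sum_i\theta_i\bigr)^6\ge\delta$. Assume $n\rho\to\infty$ and $\dfrac{\delta^2}{\frac{\rho^3}{mn^2}+\frac{\rho^6}{m}}\to\infty$. 4. Over the low-rank latent variable models $\mathcal F(\rho,\delta)$, with $\delta\ge0$: for some $r$ and some measurable $g_1,\dots,g_r:[0,1]\to\mathbb R$ such that $f(x,y)=\sum_{l=1}^rg_l(x_l)g_l(y_l)$ takes values in $[0,1]$, $\sum_l\|g_l\|_\infty^2\le\rho$ and $\operatorname{Tr}\bigl[(\mathbb Eg(\xi)g(\xi)^T)^3\bigr]-\|\mathbb Eg(\xi)\|^6\ge\delta$, where $g(\xi)=(g_1(\xi_1),\dots,g_r(\xi_r))^T$ with $\xi$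 uniform on $[0,1]^r$: the vectors $\xi_1,\dots,\xi_n$ are i.i.d. uniform on $[0,1]^r$ and, given these, the $A_{ij}$ are independent with $A_{ij}\sim$ Bernoulli$(f(\xi_i,\xi_j))$. Assume $n\rho\to\infty$ and $\dfrac{\delta^2}{\frac{\rho^3}{mn^2}+\frac{\rho^6}{m}}\to\infty$. -/

import Mathlib

open Filter Topology MeasureTheory

noncomputable section

namespace NodeSampling

/-! ### Random graphs -/

/-- The unordered pairs of distinct nodes of `[n]`, written as `(i, j)` with `i < j`. -/
abbrev Pairs (n : ℕ) : Type := {e : Fin n × Fin n // e.1 < e.2}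

/-- An undirected network on `n` nodes: the family `(A_{ij})_{i < j}` of edge indicators. -/
abbrev Graph (n : ℕ) : Type := Pairs n → Bool

/-- The symmetric `0/1` adjacency matrix of a network (zero on the diagonal). -/
def adj {n : ℕ} (A : Graph n) (i j : Fin n) : ℝ :=
  if h : i < j then (if A ⟨(i, j), h⟩ then 1 else 0)
  else if h : j < i then (if A ⟨(j, i), h⟩ then 1 else 0)
  else 0

/-- The Bernoulli distribution with success probability `p`, for `p ∈ [0, 1]`. -/
def bernoulliLaw (p : ℝ) : Measure Bool :=
  ENNReal.ofReal p • Measure.dirac true + ENNReal.ofReal (1 - p) • Measure.dirac false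

/-- The law of a network with independent edges `A_{ij} ∼ Bernoulli(P_{ij})`, `i < j`.
Only the entries of `P` above the diagonal matter. -/
def graphLaw {n : ℕ} (P : Fin n → Fin n → ℝ) : Measure (Graph n) :=
  Measure.pi fun e : Pairs n => bernoulliLaw (P e.1.1 e.1.2)

/-- The Erdős–Rényi model with edge probability `p`. -/
def erdosRenyi (n : ℕ) (p : ℝ) : Measure (Graph n) :=
  graphLaw fun _ _ => p

/-! ### The test statistic computed from a sample `M` of nodes -/

/-- The average of `h i j k` over `i ∈ M` and over all pairs `j < k` with `j, k ≠ i`; there are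
`|M| * (n - 1).choose 2` terms. -/
def nodeAverage {n : ℕ} (M : Finset (Fin n)) (h : Fin n → Fin n → Fin n → ℝ) : ℝ :=
  (∑ i ∈ M, ∑ q ∈ Finset.univ.filter
      (fun q : Fin n × Fin n => q.1 < q.2 ∧ q.1 ≠ i ∧ q.2 ≠ i), h i q.1 q.2) /
    ((M.card : ℝ) * ((n - 1).choose 2 : ℝ))

/-- The sampled edge frequency. -/
def pHat {n : ℕ} (M : Finset (Fin n)) (A : Graph n) : ℝ :=
  nodeAverage M fun i j k => (adj A i j + adj A i k + adj A j k) / 3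

/-- The sampled triangle frequency. -/
def F3Hat {n : ℕ} (M : Finset (Fin n)) (A : Graph n) : ℝ :=
  nodeAverage M fun i j k => adj A i j * adj A i k * adj A j k

/-- The sampled V-shape frequency. -/
def F2Hat {n : ℕ} (M : Finset (Fin n)) (A : Graph n) : ℝ :=
  nodeAverage M fun i j k =>
    adj A i j * adj A i k * (1 - adj A j k) + adj A i j * adj A j k * (1 - adj A i k)
      + adj A i k * adj A j k * (1 - adj A i j)

/-- `T₂ = 3 p̂² (1 - p̂) - F̂₂`. -/
def T2 {n : ℕ} (M : Finset (Fin n)) (A : Graph n) : ℝ :=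
  3 * pHat M A ^ 2 * (1 - pHat M A) - F2Hat M A

/-- `T₃ = p̂³ - F̂₃`. -/
def T3 {n : ℕ} (M : Finset (Fin n)) (A : Graph n) : ℝ :=
  pHat M A ^ 3 - F3Hat M A

/-- The normalizing factor `f(n, m)` (for `m ≤ n`). -/
def normFactor (n m : ℕ) : ℝ :=
  ((m : ℝ) ^ 2 * ((n : ℝ) - 1) ^ 2 * ((n : ℝ) - 2) ^ 2) /
    (36 * (m.choose 3 : ℝ) + 16 * (m.choose 2 : ℝ) * ((n : ℝ) - m)
      + 4 * (m : ℝ) * ((n - m).choose 2 : ℝ))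

/-- The chi-squared statistic `(T^M)²`. For `n ≥ 3` and `M` nonempty, both denominators are positive
unless the network is empty or complete; in that case `T₂ = T₃ = 0` and the value is `0`. -/
def chiSq {n : ℕ} (M : Finset (Fin n)) (A : Graph n) : ℝ :=
  normFactor n M.card *
    (T2 M A ^ 2 /
        (3 * pHat M A ^ 2 * (1 - pHat M A) ^ 2 * (1 - 3 * pHat M A) ^ 2
          + 9 * pHat M A ^ 3 * (1 - pHat M A) ^ 3)
      + T3 M A ^ 2 /
        (pHat M A ^ 3 * (1 - pHat M A) ^ 3 + 3 * pHat M A ^ 4 * (1 - pHat M A) ^ 2))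

/-- The probability that the test `𝟙{(T^M)² > c}` rejects, when the network has law `μ` and `M` is,
independently of the network, uniformly distributed on the `m`-element subsets of `[n]`. -/
def rejectProb {n : ℕ} (m : ℕ) (c : ℝ) (μ : Measure (Graph n)) : ℝ :=
  (∑ M ∈ Finset.powersetCard m (Finset.univ : Finset (Fin n)), μ.real {A | c < chiSq M A}) /
    (n.choose m : ℝ)

/-- Along the classes `H n` of alternatives, the infimum over `H n` of the power of the test with
sample size `m n` and threshold `C n` tends to one (the infimum over an empty class being one). -/
def PowerTendsToOne (m : ℕ → ℕ) (C : ℕ → ℝ) (H : (n : ℕ) → Set (Measure (Graph n))) : Prop :=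
  ∀ ε : ℝ, 0 < ε → ∀ᶠ n in atTop, ∀ μ ∈ H n, 1 - ε ≤ rejectProb (m n) (C n) μ

/-- The power tends to one for all thresholds that diverge to infinity slowly enough. -/
def ConsistentForSlowThresholds (m : ℕ → ℕ) (H : (n : ℕ) → Set (Measure (Graph n))) : Prop :=
  ∃ D : ℕ → ℝ, Tendsto D atTop atTop ∧
    ∀ C : ℕ → ℝ, Tendsto C atTop atTop → (∀ᶠ n in atTop, C n ≤ D n) → PowerTendsToOne m C H

/-! ### Alternatives -/

/-- Connection probabilities of a stochastic block model with community labels `z`. -/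
def sbmProb {n k : ℕ} (a b : ℝ) (z : Fin n → Fin k) (i j : Fin n) : ℝ :=
  if z i = z j then a else b

/-- The size of the community with label `j`. -/
def communitySize {n k : ℕ} (z : Fin n → Fin k) (j : Fin k) : ℕ :=
  (Finset.univ.filter fun i => z i = j).card

/-- The two-community stochastic block models `S(π, a, b)` on `n` nodes. -/
def sbmTwo (n : ℕ) (π a b : ℝ) : Set (Measure (Graph n)) :=
  {μ | ∃ z : Fin n → Fin 2,
    (n : ℝ) * π ≤ communitySize z 0 ∧ (communitySize z 0 : ℝ) ≤ n * (1 - π) ∧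
    μ = graphLaw (sbmProb a b z)}

/-- The balanced `k`-community stochastic block models `S(k, a, b)` on `n` nodes. -/
def sbmBalanced (n k : ℕ) (a b : ℝ) : Set (Measure (Graph n)) :=
  {μ | ∃ z : Fin n → Fin k,
    (∀ j, (n : ℝ) / k - 1 ≤ communitySize z j ∧ (communitySize z j : ℝ) ≤ (n : ℝ) / k + 1) ∧
    μ = graphLaw (sbmProb a b z)}

/-- `V(θ) = (n⁻¹ ∑ θᵢ²)³ - (n⁻¹ ∑ θᵢ)⁶`. -/
def configV {n : ℕ} (θ : Fin n → ℝ) : ℝ :=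
  ((∑ i, θ i ^ 2) / n) ^ 3 - ((∑ i, θ i) / n) ^ 6

/-- The configuration models `C(ρ, δ)` on `n` nodes, with `p_{ij} = θᵢ θⱼ`. The norm on
`Fin n → ℝ` is the sup norm. -/
def configModels (n : ℕ) (ρ δ : ℝ) : Set (Measure (Graph n)) :=
  {μ | ∃ θ : Fin n → ℝ,
    (∀ i j, i < j → θ i * θ j ∈ Set.Icc (0 : ℝ) 1) ∧ ‖θ‖ ^ 2 ≤ ρ ∧ δ ≤ configV θ ∧
    μ = graphLaw fun i j => θ i * θ j}

/-- The rank-`r` graphon `f(x, y) = ∑ₗ gₗ(xₗ) gₗ(yₗ)`. -/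
def latentGraphon {r : ℕ} (g : Fin r → unitInterval → ℝ) (x y : Fin r → unitInterval) : ℝ :=
  ∑ l, g l (x l) * g l (y l)

/-- The second moment matrix `E g(ξ) g(ξ)ᵀ`, with `ξ` uniform on `[0, 1]^r`. -/
def latentSecondMoment {r : ℕ} (g : Fin r → unitInterval → ℝ) : Matrix (Fin r) (Fin r) ℝ :=
  Matrix.of fun s t => ∫ x : Fin r → unitInterval, g s (x s) * g t (x t)

/-- `V(g) = Tr[(E g(ξ) g(ξ)ᵀ)³] - ‖E g(ξ)‖⁶`, where `‖·‖` is the Euclidean norm. -/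
def latentV {r : ℕ} (g : Fin r → unitInterval → ℝ) : ℝ :=
  (latentSecondMoment g ^ 3).trace - (∑ l, (∫ x : Fin r → unitInterval, g l (x l)) ^ 2) ^ 3

/-- The law of the network on `n` nodes: the `ξ_{il}` are i.i.d. uniform on `[0, 1]` and, given
`ξ`, the edges are independent with `A_{ij} ∼ Bernoulli(f(ξᵢ, ξⱼ))`. -/
def latentLaw (n : ℕ) {r : ℕ} (g : Fin r → unitInterval → ℝ) : Measure (Graph n) :=
  (volume : Measure (Fin n → Fin r → unitInterval)).bind
    fun ξ => graphLaw fun i j => latentGraphon g (ξ i) (ξ j)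

/-- The low-rank latent variable models `F(ρ, δ)` on `n` nodes, of any rank `r`. The supremum
norms are taken in `[0, ∞]`. -/
def latentModels (n : ℕ) (ρ δ : ℝ) : Set (Measure (Graph n)) :=
  {μ | ∃ (r : ℕ) (g : Fin r → unitInterval → ℝ),
    (∀ l, Measurable (g l)) ∧ (∀ x y, latentGraphon g x y ∈ Set.Icc (0 : ℝ) 1) ∧
    ∑ l, (⨆ t, ‖g l t‖ₑ) ^ 2 ≤ ENNReal.ofReal ρ ∧ δ ≤ latentV g ∧
    μ = latentLaw n g}

end NodeSampling

end

open NodeSampling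

/-! Write q, W, F for the sampled frequencies of edges, of pairs of adjacent edges (divided by
three) and of triangles. All are averages over the Z = m(n-1)(n-2) ordered triples of distinct nodes
whose first node is sampled. T₂ and T₃ are invertible linear combinations of W - q² and F - q³
(`T2_eq`), and the normalizing factor lies between Z/6 and Z/2 (`normFactor_bounds`). An edge
indicator is its probability plus centered noise, so each frequency is a mean of products of
probabilities plus averages of products of one, two or three noises. Products over distinct edge
sets are uncorrelated (`integral_prod_edgeNoise`), and second moments reduce to counting triples
that share an edge set (`card_filter_roleEdges_le`).

Type-I error. Under Erdős–Rényi the one-edge noise enters W and F only through q - p, with the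
coefficients 2p and 3p² of the linearized q² and q³. It therefore cancels in W - q² and F - q³ up to
terms containing (q - p)². The squares of what remains have order p²/Z and p³/Z, which the
denominators match. Markov's inequality then bounds the statistic in probability, for every fixed
sample (`chiSq_le_of_nullDeviation_lt`).

Power. Acceptance at level c forces (F - q³)² = O(c q³/Z) and (W - q²)² = O(c q²/Z)
(`sq_le_of_chiSq_le`). With edge probabilities at most ρ, the mean squared deviations of q, W, F
from population values p, w, f have orders ρ²/m, ρ⁴/m and ρ³/(mn²) + ρ⁶/m
(`sampleMean_integral_deviation_le`); the assumption nρ ≥ 1 absorbs all smaller noise terms. Hence,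
outside an event of small probability, acceptance bounds the square of the contrast f - p³ - 3s(w -
p²), for any |s| ≤ ρ, by a multiple of the noise level (`le_rejectProb_graphLaw`).

The models differ only in the lower bound on the contrast. In configuration models s = 0 gives
exactly V(θ). In block models f - p³ alone contains a term in b(a-b)² that can cancel the cubic one
when a < b; the choice s = b removes it and leaves (a-b)³ times a quantity bounded below
(`contrast_sbmProb`). In latent models, given the latent variables, the contrast with s = 0 is a
function of empirical moments of the features and concentrates around V(g), at a rate free of the
rank (`integral_latentError_le`). All bounds are explicit in c, so the square root of the
signal-to-noise ratio serves as the threshold ceiling D_n. -/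

namespace NodeSampling

/-! ### Averages over ordered triples -/

/-- The ordered triples of distinct nodes whose first node belongs to `M`. -/
def triples {n : ℕ} (M : Finset (Fin n)) : Finset (Σ _ : Fin n, Fin n × Fin n) :=
  M.sigma fun i => (Finset.univ.erase i).offDiag

lemma mem_triples {n : ℕ} {M : Finset (Fin n)} {t : Σ _ : Fin n, Fin n × Fin n} :
    t ∈ triples M ↔ t.1 ∈ M ∧ t.1 ≠ t.2.1 ∧ t.1 ≠ t.2.2 ∧ t.2.1 ≠ t.2.2 := by
  simp only [triples, Finset.mem_sigma, Finset.mem_offDiag, Finset.mem_erase, Finset.mem_univ,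
    and_true]
  tauto

lemma card_offDiag_erase {n : ℕ} (hn : 2 ≤ n) (i : Fin n) :
    ((((Finset.univ : Finset (Fin n)).erase i).offDiag.card : ℕ) : ℝ) =
      ((n : ℝ) - 1) * ((n : ℝ) - 2) := by
  have hc : ((Finset.univ : Finset (Fin n)).erase i).card = n - 1 := by simp
  rw [Finset.offDiag_card, hc]
  obtain ⟨k, rfl⟩ := Nat.exists_eq_add_of_le hn
  have e : 2 + k - 1 = k + 1 := by omega
  have e2 : (k + 1) * (k + 1) - (k + 1) = (k + 1) * k := by
    rw [Nat.mul_succ]; omega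
  rw [e, e2]
  push_cast
  ring

lemma card_triples {n : ℕ} (hn : 2 ≤ n) (M : Finset (Fin n)) :
    ((triples M).card : ℝ) = (M.card : ℝ) * ((n : ℝ) - 1) * ((n : ℝ) - 2) := by
  rw [triples, Finset.card_sigma]
  push_cast
  rw [Finset.sum_congr rfl fun i _ => card_offDiag_erase hn i, Finset.sum_const, nsmul_eq_mul]
  ring

/-- The average of `h` over the triples in `triples M`. -/
noncomputable def tripleMean {n : ℕ} (M : Finset (Fin n)) (h : Fin n → Fin n → Fin n → ℝ) : ℝ :=
  (∑ t ∈ triples M, h t.1 t.2.1 t.2.2) / ((triples M).card : ℝ)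

lemma sum_offDiag_erase_eq {n : ℕ} (i : Fin n) (g : Fin n → Fin n → ℝ)
    (hg : ∀ j k, g j k = g k j) :
    ∑ q ∈ ((Finset.univ : Finset (Fin n)).erase i).offDiag, g q.1 q.2 =
      2 * ∑ q ∈ Finset.univ.filter
        (fun q : Fin n × Fin n => q.1 < q.2 ∧ q.1 ≠ i ∧ q.2 ≠ i), g q.1 q.2 := by
  have h1 : ((Finset.univ : Finset (Fin n)).erase i).offDiag =
      Finset.univ.filter (fun q : Fin n × Fin n => q.1 < q.2 ∧ q.1 ≠ i ∧ q.2 ≠ i) ∪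
      Finset.univ.filter (fun q : Fin n × Fin n => q.2 < q.1 ∧ q.1 ≠ i ∧ q.2 ≠ i) := by
    ext ⟨j, k⟩
    simp only [Finset.mem_offDiag, Finset.mem_erase, Finset.mem_univ, and_true, Finset.mem_union,
      Finset.mem_filter, true_and]
    constructor
    · rintro ⟨a, b, c⟩
      rcases lt_or_gt_of_ne c with h | h
      · exact Or.inl ⟨h, a, b⟩
      · exact Or.inr ⟨h, a, b⟩
    · rintro (⟨h, a, b⟩ | ⟨h, a, b⟩)
      · exact ⟨a, b, h.ne⟩
      · exact ⟨a, b, h.ne'⟩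
  rw [h1, Finset.sum_union, two_mul]
  · congr 1
    refine Finset.sum_bij' (fun q _ => q.swap) (fun q _ => q.swap) ?_ ?_ ?_ ?_ ?_
    · rintro ⟨j, k⟩; simp; tauto
    · rintro ⟨j, k⟩; simp; tauto
    · simp
    · simp
    · rintro ⟨j, k⟩ _; exact hg _ _
  · rw [Finset.disjoint_left]
    rintro ⟨j, k⟩
    simp only [Finset.mem_filter, Finset.mem_univ, true_and]
    rintro ⟨h, -⟩ ⟨h', -⟩
    exact lt_asymm h h'

/-- Symmetry in the last two arguments makes each pair j < k count twice among ordered pairs, in the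
numerator and in the denominator alike. Ordered triples give all statistics one common index set. -/
lemma nodeAverage_eq_tripleMean {n : ℕ} (hn : 2 ≤ n) (M : Finset (Fin n))
    (h : Fin n → Fin n → Fin n → ℝ) (hh : ∀ i j k, h i j k = h i k j) :
    nodeAverage M h = tripleMean M h := by
  unfold nodeAverage tripleMean
  rw [card_triples hn, triples, Finset.sum_sigma]
  simp only
  rw [Finset.sum_congr rfl fun i _ => sum_offDiag_erase_eq i (h i) (hh i), ← Finset.mul_sum]
  have hc : (((n - 1).choose 2 : ℕ) : ℝ) = ((n : ℝ) - 1) * ((n : ℝ) - 2) / 2 := by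
    rw [Nat.cast_choose_two, Nat.cast_sub (by omega)]
    push_cast
    ring
  rw [hc]
  rw [show (M.card : ℝ) * ((n : ℝ) - 1) * ((n : ℝ) - 2) =
    2 * ((M.card : ℝ) * (((n : ℝ) - 1) * ((n : ℝ) - 2) / 2)) by ring]
  rw [mul_div_mul_left _ _ (two_ne_zero)]

lemma tripleMean_mono {n : ℕ} {M : Finset (Fin n)} {g h : Fin n → Fin n → Fin n → ℝ}
    (hgh : ∀ i j k, g i j k ≤ h i j k) : tripleMean M g ≤ tripleMean M h := by
  unfold tripleMean
  gcongr
  exact hgh _ _ _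

lemma tripleMean_add {n : ℕ} (M : Finset (Fin n)) (g h : Fin n → Fin n → Fin n → ℝ) :
    tripleMean M (fun i j k => g i j k + h i j k) = tripleMean M g + tripleMean M h := by
  unfold tripleMean
  rw [Finset.sum_add_distrib, add_div]

lemma tripleMean_mul {n : ℕ} (M : Finset (Fin n)) (a : ℝ) (h : Fin n → Fin n → Fin n → ℝ) :
    tripleMean M (fun i j k => a * h i j k) = a * tripleMean M h := by
  unfold tripleMean
  rw [← Finset.mul_sum, mul_div_assoc]

lemma card_triples_pos {n : ℕ} (hn : 3 ≤ n) {M : Finset (Fin n)} (hM : M.Nonempty) :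
    (0 : ℝ) < (triples M).card := by
  rw [card_triples (by omega)]
  have h1 : (0 : ℝ) < M.card := by exact_mod_cast hM.card_pos
  have h2 : (3 : ℝ) ≤ n := by exact_mod_cast hn
  have h3 : (0 : ℝ) < (n : ℝ) - 1 := by linarith
  have h4 : (0 : ℝ) < (n : ℝ) - 2 := by linarith
  positivity

lemma tripleMean_const {n : ℕ} (hn : 3 ≤ n) {M : Finset (Fin n)} (hM : M.Nonempty) (a : ℝ) :
    tripleMean M (fun _ _ _ => a) = a := by
  unfold tripleMean
  rw [Finset.sum_const, nsmul_eq_mul, mul_div_cancel_left₀ _ (card_triples_pos hn hM).ne']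

/-! ### The sampled frequencies -/

lemma adj_symm {n : ℕ} (A : Graph n) (i j : Fin n) : adj A i j = adj A j i := by
  unfold adj
  rcases lt_trichotomy i j with h | h | h
  · simp [h, h.not_gt]
  · subst h; rfl
  · simp [h, h.not_gt]

lemma adj_eq_zero_or_one {n : ℕ} (A : Graph n) (i j : Fin n) : adj A i j = 0 ∨ adj A i j = 1 := by
  unfold adj
  split_ifs <;> simp

lemma adj_mem {n : ℕ} (A : Graph n) (i j : Fin n) : 0 ≤ adj A i j ∧ adj A i j ≤ 1 := by
  rcases adj_eq_zero_or_one A i j with h | h <;> rw [h] <;> norm_num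

/-- One third of the sampled frequency of pairs of adjacent edges. -/
noncomputable def wedgeHat {n : ℕ} (M : Finset (Fin n)) (A : Graph n) : ℝ :=
  tripleMean M fun i j k =>
    (adj A i j * adj A i k + adj A i j * adj A j k + adj A i k * adj A j k) / 3

lemma pHat_eq {n : ℕ} (hn : 2 ≤ n) (M : Finset (Fin n)) (A : Graph n) :
    pHat M A = tripleMean M fun i j k => (adj A i j + adj A i k + adj A j k) / 3 := by
  refine nodeAverage_eq_tripleMean hn M _ fun i j k => ?_
  rw [adj_symm A j k]
  ring

lemma F3Hat_eq {n : ℕ} (hn : 2 ≤ n) (M : Finset (Fin n)) (A : Graph n) :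
    F3Hat M A = tripleMean M fun i j k => adj A i j * adj A i k * adj A j k := by
  refine nodeAverage_eq_tripleMean hn M _ fun i j k => ?_
  rw [adj_symm A j k]
  ring

/-- Removing the condition that the third edge is absent turns V-shapes into wedges, and every
triangle contains three wedges. -/
lemma F2Hat_eq {n : ℕ} (hn : 2 ≤ n) (M : Finset (Fin n)) (A : Graph n) :
    F2Hat M A = 3 * wedgeHat M A - 3 * F3Hat M A := by
  rw [F3Hat_eq hn, wedgeHat, sub_eq_add_neg, ← neg_mul, ← tripleMean_mul, ← tripleMean_mul,
    ← tripleMean_add]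
  rw [F2Hat, nodeAverage_eq_tripleMean hn]
  · congr 1
    funext i j k
    ring
  · intro i j k
    rw [adj_symm A j k]
    ring

lemma pHat_nonneg {n : ℕ} (hn : 2 ≤ n) (M : Finset (Fin n)) (A : Graph n) : 0 ≤ pHat M A := by
  rw [pHat_eq hn, tripleMean]
  refine div_nonneg (Finset.sum_nonneg fun t _ => ?_) (by positivity)
  have h1 := (adj_mem A t.1 t.2.1).1
  have h2 := (adj_mem A t.1 t.2.2).1
  have h3 := (adj_mem A t.2.1 t.2.2).1
  positivity

lemma F3Hat_nonneg {n : ℕ} (hn : 2 ≤ n) (M : Finset (Fin n)) (A : Graph n) : 0 ≤ F3Hat M A := by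
  rw [F3Hat_eq hn, tripleMean]
  refine div_nonneg (Finset.sum_nonneg fun t _ => ?_) (by positivity)
  have h1 := (adj_mem A t.1 t.2.1).1
  have h2 := (adj_mem A t.1 t.2.2).1
  have h3 := (adj_mem A t.2.1 t.2.2).1
  positivity

lemma wedgeHat_nonneg {n : ℕ} (M : Finset (Fin n)) (A : Graph n) : 0 ≤ wedgeHat M A := by
  rw [wedgeHat, tripleMean]
  refine div_nonneg (Finset.sum_nonneg fun t _ => ?_) (by positivity)
  have h1 := (adj_mem A t.1 t.2.1).1
  have h2 := (adj_mem A t.1 t.2.2).1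
  have h3 := (adj_mem A t.2.1 t.2.2).1
  positivity

/-- Together with nonnegativity, this bound and the analogous ones below pin the triangle and wedge
frequencies when `pHat` is 0 or 1, where the denominators of `chiSq` vanish. All of them hold triple
by triple, by inspecting the eight edge patterns. -/
lemma F3Hat_le_pHat {n : ℕ} (hn : 2 ≤ n) (M : Finset (Fin n)) (A : Graph n) :
    F3Hat M A ≤ pHat M A := by
  rw [F3Hat_eq hn, pHat_eq hn]
  refine tripleMean_mono fun i j k => ?_
  rcases adj_eq_zero_or_one A i j with h1 | h1 <;> rcases adj_eq_zero_or_one A i k with h2 | h2 <;>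
    rcases adj_eq_zero_or_one A j k with h3 | h3 <;> rw [h1, h2, h3] <;> norm_num

lemma wedgeHat_le_pHat {n : ℕ} (hn : 2 ≤ n) (M : Finset (Fin n)) (A : Graph n) :
    wedgeHat M A ≤ pHat M A := by
  rw [wedgeHat, pHat_eq hn]
  refine tripleMean_mono fun i j k => ?_
  rcases adj_eq_zero_or_one A i j with h1 | h1 <;> rcases adj_eq_zero_or_one A i k with h2 | h2 <;>
    rcases adj_eq_zero_or_one A j k with h3 | h3 <;> rw [h1, h2, h3] <;> norm_num

lemma pHat_le_one {n : ℕ} (hn : 3 ≤ n) {M : Finset (Fin n)} (hM : M.Nonempty) (A : Graph n) :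
    pHat M A ≤ 1 := by
  rw [pHat_eq (by omega), ← tripleMean_const hn hM 1]
  refine tripleMean_mono fun i j k => ?_
  linarith [(adj_mem A i j).2, (adj_mem A i k).2, (adj_mem A j k).2]

lemma le_F3Hat {n : ℕ} (hn : 3 ≤ n) {M : Finset (Fin n)} (hM : M.Nonempty) (A : Graph n) :
    3 * pHat M A - 2 ≤ F3Hat M A := by
  rw [pHat_eq (by omega), F3Hat_eq (by omega), ← tripleMean_mul, sub_eq_add_neg,
    ← tripleMean_const hn hM (-2), ← tripleMean_add]
  refine tripleMean_mono fun i j k => ?_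
  rcases adj_eq_zero_or_one A i j with h1 | h1 <;> rcases adj_eq_zero_or_one A i k with h2 | h2 <;>
    rcases adj_eq_zero_or_one A j k with h3 | h3 <;> rw [h1, h2, h3] <;> norm_num

lemma le_wedgeHat {n : ℕ} (hn : 3 ≤ n) {M : Finset (Fin n)} (hM : M.Nonempty) (A : Graph n) :
    2 * pHat M A - 1 ≤ wedgeHat M A := by
  rw [pHat_eq (by omega), wedgeHat, ← tripleMean_mul, sub_eq_add_neg,
    ← tripleMean_const hn hM (-1), ← tripleMean_add]
  refine tripleMean_mono fun i j k => ?_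
  rcases adj_eq_zero_or_one A i j with h1 | h1 <;> rcases adj_eq_zero_or_one A i k with h2 | h2 <;>
    rcases adj_eq_zero_or_one A j k with h3 | h3 <;> rw [h1, h2, h3] <;> norm_num

/-- Since T₃ is minus the second deviation, smallness of T₂ and T₃ is equivalent to smallness of the
two deviations on the right. -/
lemma T2_eq {n : ℕ} (hn : 2 ≤ n) (M : Finset (Fin n)) (A : Graph n) :
    T2 M A = -3 * (wedgeHat M A - pHat M A ^ 2) + 3 * (F3Hat M A - pHat M A ^ 3) := by
  rw [T2, F2Hat_eq hn]
  ring

/-! ### The normalizing factor -/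

lemma cast_choose_three (m : ℕ) :
    (m.choose 3 : ℝ) = (m : ℝ) * ((m : ℝ) - 1) * ((m : ℝ) - 2) / 6 := by
  induction m with
  | zero => simp
  | succ k ih =>
    rw [Nat.choose_succ_succ' k 2]
    push_cast
    rw [ih, Nat.cast_choose_two]
    ring

/-- With m = 1 + a and n = m + b, the denominator is 2m(3a(a-1) + 4ab + b(b-1)), while (n-1)(n-2) =
a(a-1) + 2ab + b(b-1). Termwise the ratio of the two brackets lies between 1 and 3. -/
lemma normFactor_bounds {n m : ℕ} (hn : 3 ≤ n) (hm : 1 ≤ m) (hmn : m ≤ n) :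
    (m : ℝ) * ((n : ℝ) - 1) * ((n : ℝ) - 2) / 6 ≤ normFactor n m ∧
      normFactor n m ≤ (m : ℝ) * ((n : ℝ) - 1) * ((n : ℝ) - 2) / 2 := by
  obtain ⟨a, rfl⟩ := Nat.exists_eq_add_of_le hm
  obtain ⟨b, rfl⟩ := Nat.exists_eq_add_of_le hmn
  have hq : ((1 + a : ℕ) : ℝ) = 1 + a := by push_cast; ring
  have hD : 36 * ((1 + a).choose 3 : ℝ) + 16 * ((1 + a).choose 2 : ℝ) *
      (((1 + a + b : ℕ) : ℝ) - ((1 + a : ℕ) : ℝ)) +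
      4 * ((1 + a : ℕ) : ℝ) * (((1 + a + b) - (1 + a)).choose 2 : ℝ) =
      2 * (1 + a) * (3 * (a * ((a : ℝ) - 1)) + 4 * a * b + b * ((b : ℝ) - 1)) := by
    rw [cast_choose_three, Nat.cast_choose_two, Nat.add_sub_cancel_left, Nat.cast_choose_two]
    push_cast
    ring
  unfold normFactor
  rw [hD]
  push_cast
  have ha0 : (0 : ℝ) ≤ a := by positivity
  have hb0 : (0 : ℝ) ≤ b := by positivity
  have hab : (2 : ℝ) ≤ a + b := by
    have : 2 ≤ a + b := by omega
    exact_mod_cast this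
  have ha1 : 0 ≤ (a : ℝ) * ((a : ℝ) - 1) := by
    rcases Nat.eq_zero_or_pos a with h | h
    · simp [h]
    · have : (1 : ℝ) ≤ a := by exact_mod_cast h
      exact mul_nonneg ha0 (by linarith)
  have hb1 : 0 ≤ (b : ℝ) * ((b : ℝ) - 1) := by
    rcases Nat.eq_zero_or_pos b with h | h
    · simp [h]
    · have : (1 : ℝ) ≤ b := by exact_mod_cast h
      exact mul_nonneg hb0 (by linarith)
  set S := (a : ℝ) * ((a : ℝ) - 1) with hS
  set U := (b : ℝ) * ((b : ℝ) - 1) with hU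
  have habm : 0 ≤ (a : ℝ) * b := mul_nonneg ha0 hb0
  have hY : ((1 : ℝ) + a + b - 1) * (1 + a + b - 2) = S + 2 * (a * b) + U := by
    rw [hS, hU]; ring
  have hYpos : 0 < S + 2 * (a * b) + U := by
    rw [← hY]
    exact mul_pos (by linarith) (by linarith)
  have hX : 3 * S + 4 * a * b + U = 3 * S + 4 * (a * b) + U := by ring
  rw [hX]
  have hXpos : 0 < 3 * S + 4 * (a * b) + U := by linarith
  have hp : (0 : ℝ) < 1 + a := by linarith
  rw [show ((1 : ℝ) + a) ^ 2 * (1 + a + b - 1) ^ 2 * (1 + a + b - 2) ^ 2 =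
    (1 + a) ^ 2 * ((1 + a + b - 1) * (1 + a + b - 2)) ^ 2 by ring]
  rw [mul_assoc (1 + (a : ℝ)) (1 + a + b - 1), hY]
  set Y := S + 2 * (a * b) + U with hYd
  constructor
  · rw [le_div_iff₀ (by positivity)]
    have : 3 * S + 4 * (a * b) + U ≤ 3 * Y := by rw [hYd]; linarith
    have h3 : (1 + (a : ℝ)) ^ 2 * Y * (3 * S + 4 * (a * b) + U) ≤ (1 + (a : ℝ)) ^ 2 * Y * (3 * Y) :=
      mul_le_mul_of_nonneg_left this (by positivity)
    nlinarith [h3]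
  · rw [div_le_iff₀ (by positivity)]
    have : Y ≤ 3 * S + 4 * (a * b) + U := by rw [hYd]; linarith
    have h3 : (1 + (a : ℝ)) ^ 2 * Y * Y ≤ (1 + (a : ℝ)) ^ 2 * Y * (3 * S + 4 * (a * b) + U) :=
      mul_le_mul_of_nonneg_left this (by positivity)
    nlinarith [h3]

lemma card_triples_div_six_le_normFactor {n : ℕ} (hn : 3 ≤ n) {M : Finset (Fin n)}
    (hM : M.Nonempty) : ((triples M).card : ℝ) / 6 ≤ normFactor n M.card := by
  rw [card_triples (by omega)]
  exact (normFactor_bounds hn hM.card_pos (by simpa using M.card_le_univ)).1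

lemma normFactor_le_card_triples_div_two {n : ℕ} (hn : 3 ≤ n) {M : Finset (Fin n)}
    (hM : M.Nonempty) : normFactor n M.card ≤ ((triples M).card : ℝ) / 2 := by
  rw [card_triples (by omega)]
  exact (normFactor_bounds hn hM.card_pos (by simpa using M.card_le_univ)).2

/-! ### Consequences of acceptance -/

lemma mul_le_of_mul_div_le {f f' x d d' c : ℝ} (hff : f' ≤ f) (hx : 0 ≤ x)
    (hd : 0 < d) (hdd : d ≤ d') (hc : 0 ≤ c) (h : f * (x / d) ≤ c) : f' * x ≤ c * d' := by
  have h1 : f' * (x / d) ≤ c := le_trans (mul_le_mul_of_nonneg_right hff (by positivity)) h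
  rw [← mul_div_assoc, div_le_iff₀ hd] at h1
  exact h1.trans (mul_le_mul_of_nonneg_left hdd hc)

/-- Both summands of the statistic are nonnegative, so each is at most c separately. The
denominators are at most 21p̂² and 4p̂³, and the linear relation `T2_eq` is solved for the wedge
deviation. -/
lemma sq_le_of_chiSq_le {n : ℕ} (hn : 3 ≤ n) {M : Finset (Fin n)} (hM : M.Nonempty) {A : Graph n}
    {c : ℝ} (hc : 0 ≤ c) (h : chiSq M A ≤ c) :
    ((triples M).card : ℝ) * (F3Hat M A - pHat M A ^ 3) ^ 2 ≤ 24 * c * pHat M A ^ 3 ∧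
      ((triples M).card : ℝ) * (wedgeHat M A - pHat M A ^ 2) ^ 2 ≤ 76 * c * pHat M A ^ 2 := by
  have h2n : 2 ≤ n := by omega
  have hp0 := pHat_nonneg h2n M A
  have hp1 := pHat_le_one hn hM A
  have hF0 := F3Hat_nonneg h2n M A
  have hFp := F3Hat_le_pHat h2n M A
  have hF1 := le_F3Hat hn hM A
  have hW0 := wedgeHat_nonneg M A
  have hWp := wedgeHat_le_pHat h2n M A
  have hW1 := le_wedgeHat hn hM A
  have hT2 := T2_eq h2n M A
  have hT3 : T3 M A = -(F3Hat M A - pHat M A ^ 3) := by rw [T3]; ring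
  have hZ := card_triples_pos hn hM
  have hf := card_triples_div_six_le_normFactor hn hM
  unfold chiSq at h
  rw [hT2, hT3] at h
  set p := pHat M A
  set F := F3Hat M A
  set W := wedgeHat M A
  set Z := ((triples M).card : ℝ)
  set f := normFactor n M.card
  have hf0 : 0 < f := by linarith
  -- For p̂ = 0 and p̂ = 1 the quotients are 0 by convention and acceptance carries no information,
  -- but both deviations vanish anyway.
  rcases hp0.eq_or_lt with hp | hp
  · rw [← hp] at hFp hWp ⊢
    rw [le_antisymm hFp hF0, le_antisymm hWp hW0]
    norm_num
  rcases hp1.eq_or_lt with hq | hq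
  · rw [hq] at hFp hWp hF1 hW1 ⊢
    rw [show F = 1 by linarith, show W = 1 by linarith]
    norm_num
    exact hc
  have hq' : 0 < 1 - p := by linarith
  have hd3 : 0 < p ^ 3 * (1 - p) ^ 3 + 3 * p ^ 4 * (1 - p) ^ 2 := by positivity
  have hd2 : 0 < 3 * p ^ 2 * (1 - p) ^ 2 * (1 - 3 * p) ^ 2 + 9 * p ^ 3 * (1 - p) ^ 3 := by
    positivity
  have hq1 : (1 - p) ^ 2 ≤ 1 := pow_le_one₀ hq'.le (by linarith)
  have hq3 : (1 - p) ^ 3 ≤ 1 := pow_le_one₀ hq'.le (by linarith)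
  have hp3 : p ^ 3 ≤ p ^ 2 := pow_le_pow_of_le_one hp0 hp1 (by norm_num)
  have hp4 : p ^ 4 ≤ p ^ 3 := pow_le_pow_of_le_one hp0 hp1 (by norm_num)
  have hd3' : p ^ 3 * (1 - p) ^ 3 + 3 * p ^ 4 * (1 - p) ^ 2 ≤ 4 * p ^ 3 := by
    have e1 : p ^ 3 * (1 - p) ^ 3 ≤ p ^ 3 * 1 := mul_le_mul_of_nonneg_left hq3 (by positivity)
    have e2 : 3 * p ^ 4 * (1 - p) ^ 2 ≤ 3 * p ^ 4 * 1 :=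
      mul_le_mul_of_nonneg_left hq1 (by positivity)
    linarith
  have hd2' : 3 * p ^ 2 * (1 - p) ^ 2 * (1 - 3 * p) ^ 2 + 9 * p ^ 3 * (1 - p) ^ 3 ≤
      21 * p ^ 2 := by
    have e0 : (1 - 3 * p) ^ 2 ≤ 4 := by nlinarith
    have e1 : 9 * p ^ 3 * (1 - p) ^ 3 ≤ 9 * p ^ 3 * 1 :=
      mul_le_mul_of_nonneg_left hq3 (by positivity)
    have e2 : 3 * p ^ 2 * ((1 - p) ^ 2 * (1 - 3 * p) ^ 2) ≤ 3 * p ^ 2 * (1 * 4) :=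
      mul_le_mul_of_nonneg_left (mul_le_mul hq1 e0 (by positivity) (by norm_num)) (by positivity)
    nlinarith
  rw [mul_add] at h
  have ha := le_of_add_le_of_nonneg_left h (mul_nonneg hf0.le (div_nonneg (sq_nonneg _) hd3.le))
  have hb := le_of_add_le_of_nonneg_right h (mul_nonneg hf0.le (div_nonneg (sq_nonneg _) hd2.le))
  have ha' := mul_le_of_mul_div_le hf (sq_nonneg _) hd2 hd2' hc ha
  have hb' := mul_le_of_mul_div_le hf (sq_nonneg _) hd3 hd3' hc hb
  have hu : Z * (F - p ^ 3) ^ 2 ≤ 24 * c * p ^ 3 := by linarith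
  refine ⟨hu, ?_⟩
  have hcp : c * p ^ 3 ≤ c * p ^ 2 := mul_le_mul_of_nonneg_left hp3 hc
  -- The wedge deviation equals the triangle deviation minus T₂/3. Since T₂² costs 6 · 21 = 126, the
  -- final constant is 126 · 2/9 + 2 · 24 = 76.
  have hv : (W - p ^ 2) ^ 2 ≤
      2 / 9 * (-3 * (W - p ^ 2) + 3 * (F - p ^ 3)) ^ 2 + 2 * (F - p ^ 3) ^ 2 := by
    nlinarith [sq_nonneg (-(W - p ^ 2) + 2 * (F - p ^ 3))]
  have hv' := mul_le_mul_of_nonneg_left hv hZ.le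
  linarith

/-! ### Moments of independent centered edges -/

lemma isProbabilityMeasure_bernoulliLaw {p : ℝ} (hp : p ∈ Set.Icc (0 : ℝ) 1) :
    IsProbabilityMeasure (bernoulliLaw p) := by
  constructor
  simp only [bernoulliLaw, Measure.coe_add, Measure.coe_smul, Pi.add_apply, Pi.smul_apply,
    measure_univ, smul_eq_mul, mul_one]
  rw [← ENNReal.ofReal_add hp.1 (by linarith [hp.2])]
  simp

lemma integral_bernoulliLaw {p : ℝ} (hp : p ∈ Set.Icc (0 : ℝ) 1) (f : Bool → ℝ) :
    ∫ x, f x ∂bernoulliLaw p = p * f true + (1 - p) * f false := by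
  have h1 := (Measure.dirac true : Measure Bool).smul_finite (ENNReal.ofReal_ne_top (r := p))
  have h2 := (Measure.dirac false : Measure Bool).smul_finite (ENNReal.ofReal_ne_top (r := 1 - p))
  rw [bernoulliLaw, integral_add_measure Integrable.of_finite Integrable.of_finite,
    integral_smul_measure, integral_smul_measure, integral_dirac, integral_dirac,
    ENNReal.toReal_ofReal hp.1, ENNReal.toReal_ofReal (by linarith [hp.2])]
  simp

/-- The edge probabilities above the diagonal lie in `[0, 1]`. -/
def IsEdgeProb {n : ℕ} (P : Fin n → Fin n → ℝ) : Prop :=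
  ∀ i j, i < j → P i j ∈ Set.Icc (0 : ℝ) 1

lemma IsEdgeProb.isProbabilityMeasure {n : ℕ} {P : Fin n → Fin n → ℝ} (hP : IsEdgeProb P) :
    IsProbabilityMeasure (graphLaw P) := by
  unfold graphLaw
  have : ∀ e : Pairs n, IsProbabilityMeasure (bernoulliLaw (P e.1.1 e.1.2)) := fun e =>
    isProbabilityMeasure_bernoulliLaw (hP _ _ e.2)
  infer_instance

/-- The centered indicator of the edge `e`. -/
noncomputable def edgeNoise {n : ℕ} (P : Fin n → Fin n → ℝ) (A : Graph n) (e : Pairs n) : ℝ :=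
  (if A e then 1 else 0) - P e.1.1 e.1.2

/-- By independence the integral factorizes over edges. An edge in exactly one of the two sets
contributes a mean-zero factor, an edge in both contributes its variance. -/
lemma integral_prod_edgeNoise {n : ℕ} {P : Fin n → Fin n → ℝ} (hP : IsEdgeProb P)
    (S S' : Finset (Pairs n)) :
    ∫ A, (∏ e ∈ S, edgeNoise P A e) * (∏ e ∈ S', edgeNoise P A e) ∂graphLaw P =
      if S = S' then ∏ e ∈ S, P e.1.1 e.1.2 * (1 - P e.1.1 e.1.2) else 0 := by
  have hpr : ∀ e : Pairs n, IsProbabilityMeasure (bernoulliLaw (P e.1.1 e.1.2)) := fun e =>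
    isProbabilityMeasure_bernoulliLaw (hP _ _ e.2)
  have h1 : ∀ A : Graph n, (∏ e ∈ S, edgeNoise P A e) * (∏ e ∈ S', edgeNoise P A e) =
      ∏ e : Pairs n, ((if e ∈ S then (if A e then 1 else 0) - P e.1.1 e.1.2 else 1) *
        (if e ∈ S' then (if A e then 1 else 0) - P e.1.1 e.1.2 else 1)) := by
    intro A
    rw [Finset.prod_mul_distrib, Finset.prod_ite_mem, Finset.prod_ite_mem, Finset.univ_inter,
      Finset.univ_inter]
    rfl
  simp_rw [h1]
  unfold graphLaw
  rw [integral_fintype_prod_eq_prod (μ := fun e : Pairs n => bernoulliLaw (P e.1.1 e.1.2))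
    (fun (e : Pairs n) (x : Bool) =>
      ((if e ∈ S then (if x then 1 else 0) - P e.1.1 e.1.2 else 1) *
        (if e ∈ S' then (if x then 1 else 0) - P e.1.1 e.1.2 else 1) : ℝ))]
  rw [Finset.prod_congr rfl fun e _ => integral_bernoulliLaw (hP _ _ e.2) _]
  simp only [if_true, Bool.false_eq_true, if_false]
  by_cases h : S = S'
  · rw [if_pos h]
    subst h
    rw [← Finset.univ_inter S, ← Finset.prod_ite_mem]
    refine Finset.prod_congr rfl fun e _ => ?_
    by_cases he : e ∈ S
    · simp [he]; ring
    · simp [he]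
  · rw [if_neg h]
    have : ∃ e, ¬ (e ∈ S ↔ e ∈ S') := by
      by_contra hcon
      push Not at hcon
      exact h (Finset.ext hcon)
    obtain ⟨e, he⟩ := this
    refine Finset.prod_eq_zero (Finset.mem_univ e) ?_
    by_cases h1 : e ∈ S <;> by_cases h2 : e ∈ S' <;> simp [h1, h2] at he ⊢ <;> ring

/-- In the expanded square only pairs of indices with equal edge sets survive. Each index has at
most `L` such partners, and a product of `d` variances is at most ρ^d. -/
lemma integral_sq_sum_edgeNoise_le {n : ℕ} {P : Fin n → Fin n → ℝ} (hP : IsEdgeProb P) {ρ : ℝ}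
    (hPρ : ∀ i j, i < j → P i j ≤ ρ) {ι : Type*} (I : Finset ι) (c : ι → ℝ)
    (S : ι → Finset (Pairs n)) {B : ℝ} {L d : ℕ} (hc : ∀ t ∈ I, |c t| ≤ B)
    (hd : ∀ t ∈ I, (S t).card = d)
    (hL : ∀ t ∈ I, (I.filter fun t' => S t = S t').card ≤ L) :
    ∫ A, (∑ t ∈ I, c t * ∏ e ∈ S t, edgeNoise P A e) ^ 2 ∂graphLaw P ≤
      B ^ 2 * L * ρ ^ d * I.card := by
  have := hP.isProbabilityMeasure
  have h1 : ∀ A : Graph n, (∑ t ∈ I, c t * ∏ e ∈ S t, edgeNoise P A e) ^ 2 =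
      ∑ t ∈ I, ∑ t' ∈ I, c t * c t' *
        ((∏ e ∈ S t, edgeNoise P A e) * (∏ e ∈ S t', edgeNoise P A e)) := by
    intro A
    rw [sq, Finset.sum_mul_sum]
    refine Finset.sum_congr rfl fun t _ => Finset.sum_congr rfl fun t' _ => ?_
    ring
  simp_rw [h1]
  rw [integral_finsetSum _ fun _ _ => Integrable.of_finite]
  have h2 : ∀ t ∈ I, ∫ A, ∑ t' ∈ I, c t * c t' *
        ((∏ e ∈ S t, edgeNoise P A e) * (∏ e ∈ S t', edgeNoise P A e)) ∂graphLaw P ≤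
        B ^ 2 * L * ρ ^ d := by
    intro t ht
    rw [integral_finsetSum _ fun _ _ => Integrable.of_finite]
    simp_rw [integral_const_mul, integral_prod_edgeNoise hP]
    have hB : 0 ≤ B := (abs_nonneg _).trans (hc t ht)
    have hv0 : 0 ≤ ∏ e ∈ S t, P e.1.1 e.1.2 * (1 - P e.1.1 e.1.2) :=
      Finset.prod_nonneg fun e _ =>
        mul_nonneg (hP _ _ e.2).1 (by linarith [(hP _ _ e.2).2])
    have hv : ∏ e ∈ S t, P e.1.1 e.1.2 * (1 - P e.1.1 e.1.2) ≤ ρ ^ d := by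
      rw [← hd t ht, ← Finset.prod_const]
      refine Finset.prod_le_prod (fun e _ =>
        mul_nonneg (hP _ _ e.2).1 (by linarith [(hP _ _ e.2).2])) fun e _ => ?_
      have := hP _ _ e.2
      nlinarith [hPρ _ _ e.2, this.1, this.2]
    calc ∑ t' ∈ I, c t * c t' *
          (if S t = S t' then ∏ e ∈ S t, P e.1.1 e.1.2 * (1 - P e.1.1 e.1.2) else 0)
        ≤ ∑ t' ∈ I, if S t = S t' then B ^ 2 * ρ ^ d else 0 := by
          refine Finset.sum_le_sum fun t' ht' => ?_
          split_ifs with h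
          · have : c t * c t' ≤ B ^ 2 := by
              calc c t * c t' ≤ |c t| * |c t'| := by rw [← abs_mul]; exact le_abs_self _
                _ ≤ B * B := mul_le_mul (hc t ht) (hc t' ht') (abs_nonneg _) hB
                _ = B ^ 2 := by ring
            exact mul_le_mul this hv hv0 (by positivity)
          · simp
      _ = ((I.filter fun t' => S t = S t').card : ℝ) * (B ^ 2 * ρ ^ d) := by
          rw [← Finset.sum_filter, Finset.sum_const, nsmul_eq_mul]
      _ ≤ (L : ℝ) * (B ^ 2 * ρ ^ d) := by
          refine mul_le_mul_of_nonneg_right (by exact_mod_cast hL t ht) ?_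
          exact mul_nonneg (sq_nonneg _) (hv0.trans hv)
      _ = B ^ 2 * L * ρ ^ d := by ring
  refine (Finset.sum_le_sum h2).trans ?_
  rw [Finset.sum_const, nsmul_eq_mul, mul_comm]

/-! ### Edges of a triple -/

/-- The edge joining `i` and `j`, as a one-element set when `i ≠ j`. -/
def pairSet {n : ℕ} (i j : Fin n) : Finset (Pairs n) :=
  Finset.univ.filter fun e => e.1 = (i, j) ∨ e.1 = (j, i)

lemma pairSet_eq {n : ℕ} {i j : Fin n} (hij : i ≠ j) :
    ∃ e : Pairs n, pairSet i j = {e} ∧ (e.1 = (i, j) ∨ e.1 = (j, i)) := by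
  rcases lt_or_gt_of_ne hij with h | h
  · refine ⟨⟨(i, j), h⟩, ?_, Or.inl rfl⟩
    ext e
    simp only [pairSet, Finset.mem_filter, Finset.mem_univ, true_and, Finset.mem_singleton,
      Subtype.ext_iff]
    refine ⟨fun h' => h'.resolve_right fun he => ?_, Or.inl⟩
    have := e.2
    rw [he] at this
    exact lt_asymm this h
  · refine ⟨⟨(j, i), h⟩, ?_, Or.inr rfl⟩
    ext e
    simp only [pairSet, Finset.mem_filter, Finset.mem_univ, true_and, Finset.mem_singleton,
      Subtype.ext_iff]
    refine ⟨fun h' => h'.resolve_left fun he => ?_, Or.inr⟩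
    have := e.2
    rw [he] at this
    exact lt_asymm this h

lemma adj_pair {n : ℕ} (A : Graph n) (e : Pairs n) :
    adj A e.1.1 e.1.2 = if A e then 1 else 0 := by
  rw [adj, dif_pos e.2]

lemma prod_pairSet_edgeNoise {n : ℕ} {P : Fin n → Fin n → ℝ} (hs : ∀ i j, P i j = P j i)
    (A : Graph n) {i j : Fin n} (hij : i ≠ j) :
    ∏ e ∈ pairSet i j, edgeNoise P A e = adj A i j - P i j := by
  obtain ⟨e, he, h | h⟩ := pairSet_eq hij
  · rw [he, Finset.prod_singleton, edgeNoise, ← adj_pair, h]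
  · rw [he, Finset.prod_singleton, edgeNoise, ← adj_pair, h, adj_symm, hs]

/-- The three pairs of nodes in a triple. -/
def role {n : ℕ} (i j k : Fin n) : Fin 3 → Fin n × Fin n := ![(i, j), (i, k), (j, k)]

/-- The edges of a triple with roles in `J`. -/
def roleEdges {n : ℕ} (J : Finset (Fin 3)) (t : Σ _ : Fin n, Fin n × Fin n) : Finset (Pairs n) :=
  J.biUnion fun r => pairSet (role t.1 t.2.1 t.2.2 r).1 (role t.1 t.2.1 t.2.2 r).2

lemma role_ne {n : ℕ} {i j k : Fin n} (h1 : i ≠ j) (h2 : i ≠ k) (h3 : j ≠ k) (r : Fin 3) :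
    (role i j k r).1 ≠ (role i j k r).2 := by
  fin_cases r
  · exact h1
  · exact h2
  · exact h3

lemma pairwiseDisjoint_role {n : ℕ} {i j k : Fin n} (h1 : i ≠ j) (h2 : i ≠ k) (h3 : j ≠ k)
    (J : Set (Fin 3)) :
    J.PairwiseDisjoint fun r => pairSet (role i j k r).1 (role i j k r).2 := by
  intro r _ s _ hrs
  rw [Function.onFun, Finset.disjoint_left]
  intro e he he'
  simp only [pairSet, Finset.mem_filter, Finset.mem_univ, true_and] at he he'
  have key : ∀ a b c d : Fin n, (e.1 = (a, b) ∨ e.1 = (b, a)) → (e.1 = (c, d) ∨ e.1 = (d, c)) →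
      (a = c ∧ b = d) ∨ (a = d ∧ b = c) := by
    intro a b c d h h'
    rcases h with h | h <;> rcases h' with h' | h' <;> rw [h, Prod.mk.injEq] at h' <;> tauto
  have hk := key _ _ _ _ he he'
  fin_cases r <;> fin_cases s <;> simp [role] at hk hrs <;> (rcases hk with hk | hk <;>
    simp_all)

lemma card_roleEdges {n : ℕ} (J : Finset (Fin 3)) {M : Finset (Fin n)}
    {t : Σ _ : Fin n, Fin n × Fin n} (ht : t ∈ triples M) : (roleEdges J t).card = J.card := by
  obtain ⟨-, h1, h2, h3⟩ := mem_triples.1 ht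
  rw [roleEdges, Finset.card_biUnion]
  · rw [Finset.card_eq_sum_ones]
    refine Finset.sum_congr rfl fun r _ => ?_
    obtain ⟨e, he, -⟩ := pairSet_eq (role_ne h1 h2 h3 r)
    rw [he, Finset.card_singleton]
  · intro r hr s hs hrs
    exact pairwiseDisjoint_role h1 h2 h3 (J : Set (Fin 3)) hr hs hrs

lemma prod_roleEdges_edgeNoise {n : ℕ} {P : Fin n → Fin n → ℝ} (hs : ∀ i j, P i j = P j i)
    (A : Graph n) (J : Finset (Fin 3)) {M : Finset (Fin n)}
    {t : Σ _ : Fin n, Fin n × Fin n} (ht : t ∈ triples M) :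
    ∏ e ∈ roleEdges J t, edgeNoise P A e =
      ∏ r ∈ J, (adj A (role t.1 t.2.1 t.2.2 r).1 (role t.1 t.2.1 t.2.2 r).2 -
        P (role t.1 t.2.1 t.2.2 r).1 (role t.1 t.2.1 t.2.2 r).2) := by
  obtain ⟨-, h1, h2, h3⟩ := mem_triples.1 ht
  rw [roleEdges, Finset.prod_biUnion]
  · exact Finset.prod_congr rfl fun r _ => prod_pairSet_edgeNoise hs A (role_ne h1 h2 h3 r)
  · exact pairwiseDisjoint_role h1 h2 h3 _

/-- The set of endpoints of a set of edges. -/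
def endpoints {n : ℕ} (S : Finset (Pairs n)) : Finset (Fin n) :=
  S.image (fun e => e.1.1) ∪ S.image (fun e => e.1.2)

lemma endpoints_pairSet {n : ℕ} {i j : Fin n} (hij : i ≠ j) :
    endpoints (pairSet i j) = {i, j} := by
  obtain ⟨e, he, h | h⟩ := pairSet_eq hij
  · rw [he]; ext x; simp [endpoints, h]
  · rw [he]; ext x; simp [endpoints, h]; tauto

/-- Triples with the same edge set have the same covered nodes; this is how coincidences of edge
sets are counted. -/
lemma endpoints_roleEdges {n : ℕ} (J : Finset (Fin 3)) {M : Finset (Fin n)}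
    {t : Σ _ : Fin n, Fin n × Fin n} (ht : t ∈ triples M) :
    endpoints (roleEdges J t) =
      J.biUnion fun r => {(role t.1 t.2.1 t.2.2 r).1, (role t.1 t.2.1 t.2.2 r).2} := by
  obtain ⟨-, h1, h2, h3⟩ := mem_triples.1 ht
  have : endpoints (roleEdges J t) = J.biUnion fun r =>
      endpoints (pairSet (role t.1 t.2.1 t.2.2 r).1 (role t.1 t.2.1 t.2.2 r).2) := by
    unfold endpoints roleEdges
    ext x
    simp only [Finset.mem_union, Finset.mem_image, Finset.mem_biUnion]
    grind
  rw [this]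
  exact Finset.biUnion_congr rfl fun r _ => endpoints_pairSet (role_ne h1 h2 h3 r)

/-- The number of triples in `triples M` sharing a given set of edges is at most this number. -/
def roleMult (n : ℕ) (J : Finset (Fin 3)) : ℕ := if J.card = 1 then 4 * n else 27

/-- A single edge confines two of the nodes to its two endpoints and leaves the third free, whence 2
· 2 · n. Two or three edges already cover the triple, so each node lies in a set of at most three,
whence 3³. -/
lemma card_filter_roleEdges_le {n : ℕ} {J : Finset (Fin 3)} (hJ : J.Nonempty)
    {M : Finset (Fin n)} {t : Σ _ : Fin n, Fin n × Fin n} (ht : t ∈ triples M) :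
    ((triples M).filter fun t' => roleEdges J t = roleEdges J t').card ≤ roleMult n J := by
  have hend : ∀ t' ∈ (triples M).filter (fun t' => roleEdges J t = roleEdges J t'),
      (J.biUnion fun r => {(role t'.1 t'.2.1 t'.2.2 r).1, (role t'.1 t'.2.1 t'.2.2 r).2}) =
      J.biUnion fun r => {(role t.1 t.2.1 t.2.2 r).1, (role t.1 t.2.1 t.2.2 r).2} := by
    intro t' ht'
    rw [Finset.mem_filter] at ht'
    rw [← endpoints_roleEdges J ht, ← endpoints_roleEdges J ht'.1, ht'.2]
  obtain ⟨i, j, k⟩ := t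
  have htwo : ∀ x y : Fin n, ({x, y} : Finset (Fin n)).card ≤ 2 := fun x y => Finset.card_le_two
  have hsing : ∀ r, J = {r} →
      ((triples M).filter fun t' => roleEdges J ⟨i, j, k⟩ = roleEdges J t').card ≤ 4 * n := by
    intro r hr
    rw [hr] at hend ⊢
    simp only [Finset.singleton_biUnion] at hend
    set x := (role i j k r).1 with hx
    set y := (role i j k r).2 with hy
    have hmem : ∀ t' ∈ (triples M).filter
        (fun t' => roleEdges {r} ⟨i, j, k⟩ = roleEdges {r} t'),
        (role t'.1 t'.2.1 t'.2.2 r).1 ∈ ({x, y} : Finset (Fin n)) ∧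
        (role t'.1 t'.2.1 t'.2.2 r).2 ∈ ({x, y} : Finset (Fin n)) := by
      intro t' ht'
      rw [← hend t' ht']
      simp
    have hxy := htwo x y
    have hxy4 : ({x, y} : Finset (Fin n)).card * ({x, y} : Finset (Fin n)).card ≤ 4 := by
      nlinarith
    have hr3 : r = 0 ∨ r = 1 ∨ r = 2 := by fin_cases r <;> simp
    rcases hr3 with h0 | h0 | h0
    · refine (Finset.card_le_card (t := ({x, y} : Finset (Fin n)).sigma fun _ =>
        ({x, y} : Finset (Fin n)) ×ˢ Finset.univ) fun t' ht' => ?_).trans ?_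
      · have := hmem t' ht'
        rw [h0] at this
        rw [Finset.mem_sigma, Finset.mem_product]
        exact ⟨this.1, this.2, Finset.mem_univ _⟩
      · rw [Finset.card_sigma, Finset.sum_const, Finset.card_product, Finset.card_univ,
          Fintype.card_fin, smul_eq_mul, ← mul_assoc]
        exact Nat.mul_le_mul_right _ hxy4
    · refine (Finset.card_le_card (t := ({x, y} : Finset (Fin n)).sigma fun _ =>
        Finset.univ ×ˢ ({x, y} : Finset (Fin n))) fun t' ht' => ?_).trans ?_
      · have := hmem t' ht'
        rw [h0] at this
        rw [Finset.mem_sigma, Finset.mem_product]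
        exact ⟨this.1, Finset.mem_univ _, this.2⟩
      · rw [Finset.card_sigma, Finset.sum_const, Finset.card_product, Finset.card_univ,
          Fintype.card_fin, smul_eq_mul, mul_comm n, ← mul_assoc]
        exact Nat.mul_le_mul_right _ hxy4
    · refine (Finset.card_le_card (t := (Finset.univ : Finset (Fin n)).sigma fun _ =>
        ({x, y} : Finset (Fin n)) ×ˢ ({x, y} : Finset (Fin n))) fun t' ht' => ?_).trans ?_
      · have := hmem t' ht'
        rw [h0] at this
        rw [Finset.mem_sigma, Finset.mem_product]
        exact ⟨Finset.mem_univ _, this.1, this.2⟩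
      · rw [Finset.card_sigma, Finset.sum_const, Finset.card_product, Finset.card_univ,
          Fintype.card_fin, smul_eq_mul, mul_comm]
        exact Nat.mul_le_mul_right _ hxy4
  unfold roleMult
  split_ifs with h1
  · obtain ⟨r, hr⟩ := Finset.card_eq_one.1 h1
    exact hsing r hr
  -- Each node belongs to two of the three roles, so a set of at least two roles covers i, j and k,
  -- in this order of the conjuncts.
  · have hJ2 : (0 ∈ J ∨ 1 ∈ J) ∧ (0 ∈ J ∨ 2 ∈ J) ∧ (1 ∈ J ∨ 2 ∈ J) := by
      revert hJ h1
      clear hend hsing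
      revert J
      decide
    set V : Finset (Fin n) := {i, j, k} with hV
    have hsub : (J.biUnion fun r => {(role i j k r).1, (role i j k r).2}) ⊆ V := by
      intro x hx
      rw [Finset.mem_biUnion] at hx
      obtain ⟨r, -, hx⟩ := hx
      fin_cases r <;> simp [role] at hx <;> simp [hV] <;> tauto
    have hV3 : V.card ≤ 3 := Finset.card_le_three
    refine (Finset.card_le_card (t := V.sigma fun _ => V ×ˢ V) fun t' ht' => ?_).trans ?_
    · have h := hend t' ht'
      simp only at h
      have hm : ∀ x r, r ∈ J → (x = (role t'.1 t'.2.1 t'.2.2 r).1 ∨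
          x = (role t'.1 t'.2.1 t'.2.2 r).2) → x ∈ V := by
        intro x r hr hx
        refine hsub ?_
        rw [← h, Finset.mem_biUnion]
        exact ⟨r, hr, by simpa using hx⟩
      rw [Finset.mem_sigma, Finset.mem_product]
      refine ⟨?_, ?_, ?_⟩
      · exact hJ2.1.elim (fun h => hm _ 0 h (Or.inl rfl)) fun h => hm _ 1 h (Or.inl rfl)
      · exact hJ2.2.1.elim (fun h => hm _ 0 h (Or.inr rfl)) fun h => hm _ 2 h (Or.inl rfl)
      · exact hJ2.2.2.elim (fun h => hm _ 1 h (Or.inr rfl)) fun h => hm _ 2 h (Or.inr rfl)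
    · rw [Finset.card_sigma, Finset.sum_const, Finset.card_product, smul_eq_mul]
      calc V.card * (V.card * V.card) ≤ 3 * (3 * 3) := by gcongr
        _ = 27 := by norm_num

/-- The average over triples of weighted products of centered edges with roles in `J`. -/
noncomputable def noiseMean {n : ℕ} (P : Fin n → Fin n → ℝ) (M : Finset (Fin n))
    (J : Finset (Fin 3)) (c : Fin n → Fin n → Fin n → ℝ) (A : Graph n) : ℝ :=
  tripleMean M fun i j k => c i j k * ∏ r ∈ J, (adj A (role i j k r).1 (role i j k r).2 -
    P (role i j k r).1 (role i j k r).2)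

lemma integral_sq_noiseMean_le {n : ℕ} (hn : 3 ≤ n) {P : Fin n → Fin n → ℝ} (hP : IsEdgeProb P)
    (hs : ∀ i j, P i j = P j i) {ρ : ℝ} (hPρ : ∀ i j, i < j → P i j ≤ ρ) {M : Finset (Fin n)}
    (hM : M.Nonempty) {J : Finset (Fin 3)} (hJ : J.Nonempty) {c : Fin n → Fin n → Fin n → ℝ}
    {B : ℝ} (hc : ∀ i j k, |c i j k| ≤ B) :
    ∫ A, noiseMean P M J c A ^ 2 ∂graphLaw P ≤
      B ^ 2 * roleMult n J * ρ ^ J.card / (triples M).card := by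
  have hZ := card_triples_pos hn hM
  have h1 : ∀ A, noiseMean P M J c A ^ 2 =
      (∑ t ∈ triples M, c t.1 t.2.1 t.2.2 * ∏ e ∈ roleEdges J t, edgeNoise P A e) ^ 2 /
        ((triples M).card : ℝ) ^ 2 := by
    intro A
    rw [noiseMean, tripleMean, div_pow]
    congr 2
    refine Finset.sum_congr rfl fun t ht => ?_
    rw [prod_roleEdges_edgeNoise hs A J ht]
  simp_rw [h1]
  rw [integral_div, div_le_div_iff₀ (by positivity) hZ]
  have := integral_sq_sum_edgeNoise_le hP hPρ (triples M) (fun t => c t.1 t.2.1 t.2.2)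
    (roleEdges J) (B := B) (L := roleMult n J) (d := J.card) (fun t _ => hc _ _ _)
    (fun t ht => card_roleEdges J ht) (fun t ht => card_filter_roleEdges_le hJ ht)
  nlinarith

/-! ### Sampling without replacement -/

/-- The average of `F` over the `m`-element subsets of `[n]`. -/
noncomputable def sampleMean {n : ℕ} (m : ℕ) (F : Finset (Fin n) → ℝ) : ℝ :=
  (∑ M ∈ Finset.powersetCard m (Finset.univ : Finset (Fin n)), F M) / (n.choose m : ℝ)

lemma sampleMean_mono {n m : ℕ} {F G : Finset (Fin n) → ℝ}
    (h : ∀ M : Finset (Fin n), M.card = m → F M ≤ G M) : sampleMean m F ≤ sampleMean m G := by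
  unfold sampleMean
  refine div_le_div_of_nonneg_right (Finset.sum_le_sum fun M hM => h M ?_) (by positivity)
  exact (Finset.mem_powersetCard.1 hM).2

lemma sampleMean_add {n m : ℕ} (F G : Finset (Fin n) → ℝ) :
    sampleMean m (fun M => F M + G M) = sampleMean m F + sampleMean m G := by
  unfold sampleMean
  rw [Finset.sum_add_distrib, add_div]

lemma sampleMean_mul {n m : ℕ} (a : ℝ) (F : Finset (Fin n) → ℝ) :
    sampleMean m (fun M => a * F M) = a * sampleMean m F := by
  unfold sampleMean
  rw [← Finset.mul_sum, mul_div_assoc]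

lemma sampleMean_const {n m : ℕ} (hmn : m ≤ n) (a : ℝ) :
    sampleMean (n := n) m (fun _ => a) = a := by
  have : (0 : ℝ) < n.choose m := by exact_mod_cast Nat.choose_pos hmn
  unfold sampleMean
  rw [Finset.sum_const, Finset.card_powersetCard, Finset.card_univ, Fintype.card_fin,
    nsmul_eq_mul, mul_div_cancel_left₀ _ this.ne']

lemma card_filter_powersetCard_univ {n : ℕ} (m : ℕ) (s : Finset (Fin n)) :
    ((Finset.powersetCard m (Finset.univ : Finset (Fin n))).filter (s ⊆ ·)).card =
      if s.card ≤ m then (n - s.card).choose (m - s.card) else 0 := by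
  split_ifs with h
  · rw [Finset.card_filter_powersetCard_subset _ _ _ (Finset.subset_univ _) h]
    simp
  · rw [Finset.card_eq_zero, Finset.filter_eq_empty_iff]
    intro M hM hs
    rw [← (Finset.mem_powersetCard.1 hM).2] at h
    exact h (Finset.card_le_card hs)

/-- Counting the samples that contain one or two given nodes, the left side is exactly (`a` - `b`) ∑
g², because the off-diagonal part carries the factor (∑ g)² = 0. Sampling without replacement only
reduces the variance, so `b` is discarded. -/
lemma sum_sq_sum_centered_le {n m : ℕ} (hm : 1 ≤ m) (hmn : m ≤ n) (g : Fin n → ℝ)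
    (hg : ∑ i, g i = 0) :
    ∑ M ∈ Finset.powersetCard m (Finset.univ : Finset (Fin n)), (∑ i ∈ M, g i) ^ 2 ≤
      (n.choose m : ℝ) * (m / n) * ∑ i, g i ^ 2 := by
  set 𝒮 := Finset.powersetCard m (Finset.univ : Finset (Fin n))
  -- The case m = 1 must be separated: truncated subtraction would give 1 instead of 0.
  set b : ℕ := if 2 ≤ m then (n - 2).choose (m - 2) else 0 with hb
  set a : ℕ := (n - 1).choose (m - 1) with ha
  have h1 : ∀ M : Finset (Fin n), (∑ i ∈ M, g i) ^ 2 =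
      ∑ i, ∑ j, if {i, j} ⊆ M then g i * g j else 0 := by
    intro M
    rw [sq, Finset.sum_mul_sum, ← Finset.univ_inter M, ← Finset.sum_ite_mem]
    refine Finset.sum_congr rfl fun i _ => ?_
    rw [← Finset.sum_ite_mem]
    by_cases hi : i ∈ M
    · simp [hi, Finset.insert_subset_iff]
    · simp [hi, Finset.insert_subset_iff]
  have hcount : ∀ i j : Fin n, ∑ M ∈ 𝒮, (if {i, j} ⊆ M then g i * g j else 0) =
      (b : ℝ) * (g i * g j) + if i = j then ((a : ℝ) - b) * (g i * g j) else 0 := by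
    intro i j
    rw [← Finset.sum_filter, Finset.sum_const, nsmul_eq_mul, card_filter_powersetCard_univ]
    by_cases hij : i = j
    · subst hij
      simp [hm, ← ha]
      ring
    · rw [Finset.card_pair hij, if_neg hij, add_zero]
  have h2 : ∑ M ∈ 𝒮, (∑ i ∈ M, g i) ^ 2 = ((a : ℝ) - b) * ∑ i, g i ^ 2 := by
    simp_rw [h1]
    rw [Finset.sum_comm]
    have : ∀ i, ∑ M ∈ 𝒮, ∑ j, (if {i, j} ⊆ M then g i * g j else 0) =
        ((a : ℝ) - b) * g i ^ 2 := by
      intro i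
      rw [Finset.sum_comm]
      simp_rw [hcount]
      rw [Finset.sum_add_distrib, ← Finset.mul_sum, ← Finset.mul_sum, hg, mul_zero, mul_zero,
        zero_add, Finset.sum_ite_eq, if_pos (Finset.mem_univ _), sq]
    simp_rw [this]
    rw [← Finset.mul_sum]
  rw [h2]
  refine mul_le_mul_of_nonneg_right ?_ (Finset.sum_nonneg fun i _ => sq_nonneg _)
  have hab : (a : ℝ) = (n.choose m : ℝ) * (m / n) := by
    obtain ⟨m', rfl⟩ := Nat.exists_eq_add_of_le' hm
    obtain ⟨n', rfl⟩ := Nat.exists_eq_add_of_le' (hm.trans hmn)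
    have := Nat.add_one_mul_choose_eq n' m'
    rw [mul_div_assoc', eq_div_iff (by positivity)]
    rw [ha]
    simp only [Nat.add_sub_cancel]
    exact_mod_cast (by rw [mul_comm]; exact this)
  rw [← hab]
  have : (0 : ℝ) ≤ b := by positivity
  linarith

lemma sampleMean_sq_sub_le {n m : ℕ} (hm : 1 ≤ m) (hmn : m ≤ n) (g : Fin n → ℝ) {B : ℝ}
    (hB : ∀ i, |g i| ≤ B) :
    sampleMean m (fun M => ((∑ i ∈ M, g i) / m - (∑ i, g i) / n) ^ 2) ≤ B ^ 2 / m := by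
  have hn0 : (0 : ℝ) < n := by exact_mod_cast (hm.trans hmn)
  have hm0 : (0 : ℝ) < m := by exact_mod_cast hm
  have hC : (0 : ℝ) < n.choose m := by exact_mod_cast Nat.choose_pos hmn
  set μ := (∑ i, g i) / n with hμ
  have hsum : ∑ i, g i = n * μ := by rw [hμ]; field_simp
  have hcent : ∑ i, (g i - μ) = 0 := by
    rw [Finset.sum_sub_distrib, hsum]
    simp
  have hkey := sum_sq_sum_centered_le hm hmn (fun i => g i - μ) hcent
  have hsq : ∑ i, (g i - μ) ^ 2 ≤ n * B ^ 2 := by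
    have e : ∑ i, (g i - μ) ^ 2 = ∑ i, g i ^ 2 - n * μ ^ 2 := by
      have : ∀ i, (g i - μ) ^ 2 = g i ^ 2 - 2 * μ * g i + μ ^ 2 := fun i => by ring
      simp_rw [this]
      rw [Finset.sum_add_distrib, Finset.sum_sub_distrib, ← Finset.mul_sum, hsum]
      simp
      ring
    have e2 : ∑ i, g i ^ 2 ≤ n * B ^ 2 := by
      have : ∑ i : Fin n, g i ^ 2 ≤ ∑ _i : Fin n, B ^ 2 :=
        Finset.sum_le_sum fun i _ => sq_le_sq' (abs_le.1 (hB i)).1 (abs_le.1 (hB i)).2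
      simpa using this
    have : 0 ≤ n * μ ^ 2 := by positivity
    linarith
  unfold sampleMean
  rw [div_le_iff₀ hC]
  have e : ∑ M ∈ Finset.powersetCard m (Finset.univ : Finset (Fin n)),
      ((∑ i ∈ M, g i) / m - μ) ^ 2 =
      (∑ M ∈ Finset.powersetCard m (Finset.univ : Finset (Fin n)),
        (∑ i ∈ M, (g i - μ)) ^ 2) / (m : ℝ) ^ 2 := by
    rw [Finset.sum_div]
    refine Finset.sum_congr rfl fun M hM => ?_
    rw [Finset.sum_sub_distrib, Finset.sum_const, (Finset.mem_powersetCard.1 hM).2, nsmul_eq_mul,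
      ← div_pow, sub_div, mul_div_cancel_left₀ _ hm0.ne']
  rw [e, div_le_iff₀ (by positivity)]
  refine hkey.trans ?_
  calc (n.choose m : ℝ) * (m / n) * ∑ i, (g i - μ) ^ 2
      ≤ (n.choose m : ℝ) * (m / n) * (n * B ^ 2) := mul_le_mul_of_nonneg_left hsq (by positivity)
    _ = B ^ 2 / m * n.choose m * (m : ℝ) ^ 2 := by field_simp

/-- The average of `h` over all triples of nodes. -/
noncomputable def fullMean {n : ℕ} (h : Fin n → Fin n → Fin n → ℝ) : ℝ :=
  (∑ i, ∑ j, ∑ k, h i j k) / (n : ℝ) ^ 3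

/-- Only n² - (n-1)(n-2) ≤ 3n pairs are degenerate. Adding them and changing the normalization
accordingly each move the mean by at most 3B/n. -/
lemma abs_offDiag_mean_sub_le {n : ℕ} (hn : 3 ≤ n) (i : Fin n) (g : Fin n → Fin n → ℝ) {B : ℝ}
    (hg : ∀ j k, |g j k| ≤ B) :
    |(∑ q ∈ ((Finset.univ : Finset (Fin n)).erase i).offDiag, g q.1 q.2) /
        (((n : ℝ) - 1) * ((n : ℝ) - 2)) - (∑ j, ∑ k, g j k) / (n : ℝ) ^ 2| ≤ 6 * B / n := by
  set O := ((Finset.univ : Finset (Fin n)).erase i).offDiag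
  have hcard : (O.card : ℝ) = ((n : ℝ) - 1) * ((n : ℝ) - 2) := card_offDiag_erase (by omega) i
  have hn3 : (3 : ℝ) ≤ n := by exact_mod_cast hn
  have hD : 0 < ((n : ℝ) - 1) * ((n : ℝ) - 2) := mul_pos (by linarith) (by linarith)
  have hB : 0 ≤ B := (abs_nonneg _).trans (hg i i)
  have hall : ∑ j, ∑ k, g j k = ∑ q ∈ O, g q.1 q.2 + ∑ q ∈ Oᶜ, g q.1 q.2 := by
    rw [Finset.sum_add_sum_compl, ← Finset.univ_product_univ, Finset.sum_product]
  have hO : |∑ q ∈ O, g q.1 q.2| ≤ ((n : ℝ) - 1) * ((n : ℝ) - 2) * B := by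
    rw [← hcard, ← nsmul_eq_mul]
    exact (Finset.abs_sum_le_sum_abs _ _).trans (Finset.sum_le_card_nsmul _ _ _ fun q _ => hg _ _)
  have hOc : |∑ q ∈ Oᶜ, g q.1 q.2| ≤ ((n : ℝ) ^ 2 - ((n : ℝ) - 1) * ((n : ℝ) - 2)) * B := by
    have hcc : (Oᶜ.card : ℝ) = (n : ℝ) ^ 2 - ((n : ℝ) - 1) * ((n : ℝ) - 2) := by
      rw [← hcard, Finset.card_compl, Nat.cast_sub (Finset.card_le_univ _)]
      simp
      ring
    rw [← hcc, ← nsmul_eq_mul]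
    exact (Finset.abs_sum_le_sum_abs _ _).trans (Finset.sum_le_card_nsmul _ _ _ fun q _ => hg _ _)
  rw [hall]
  set x := ∑ q ∈ O, g q.1 q.2
  set y := ∑ q ∈ Oᶜ, g q.1 q.2
  set D := ((n : ℝ) - 1) * ((n : ℝ) - 2) with hDd
  have hND : (n : ℝ) ^ 2 - D ≤ 3 * n := by rw [hDd]; nlinarith
  have hND0 : 0 ≤ (n : ℝ) ^ 2 - D := by rw [hDd]; nlinarith
  have e : x / D - (x + y) / (n : ℝ) ^ 2 =
      (x / D * ((n : ℝ) ^ 2 - D) - y) / (n : ℝ) ^ 2 := by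
    field_simp
    ring
  rw [e, abs_div, abs_of_pos (by positivity : (0 : ℝ) < (n : ℝ) ^ 2),
    div_le_div_iff₀ (by positivity) (by positivity)]
  have hx : |x / D| ≤ B := by
    rw [abs_div, abs_of_pos hD, div_le_iff₀ hD, mul_comm]
    exact hO
  have h3 : |x / D * ((n : ℝ) ^ 2 - D) - y| ≤ 2 * B * (3 * n) := by
    calc |x / D * ((n : ℝ) ^ 2 - D) - y| ≤ |x / D * ((n : ℝ) ^ 2 - D)| + |y| := abs_sub _ _
      _ ≤ B * ((n : ℝ) ^ 2 - D) + ((n : ℝ) ^ 2 - D) * B := by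
          rw [abs_mul, abs_of_nonneg hND0]
          exact add_le_add (mul_le_mul_of_nonneg_right hx hND0) hOc
      _ = 2 * B * ((n : ℝ) ^ 2 - D) := by ring
      _ ≤ 2 * B * (3 * n) := mul_le_mul_of_nonneg_left hND (by positivity)
  calc |x / D * ((n : ℝ) ^ 2 - D) - y| * n ≤ 2 * B * (3 * n) * n :=
        mul_le_mul_of_nonneg_right h3 (by positivity)
    _ = 6 * B * (n : ℝ) ^ 2 := by ring

/-- Node by node, the triple mean is a sample mean of the quantities `G i`. Its variance is at most
B²/m, and the squared bias from degenerate triples is at most 36B²/n² ≤ 36B²/m; hence 2 + 2 · 36 =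
74. -/
lemma sampleMean_sq_tripleMean_sub_le {n m : ℕ} (hn : 3 ≤ n) (hm : 1 ≤ m) (hmn : m ≤ n)
    (h : Fin n → Fin n → Fin n → ℝ) {B : ℝ} (hB : ∀ i j k, |h i j k| ≤ B) :
    sampleMean m (fun M => (tripleMean M h - fullMean h) ^ 2) ≤ 74 * B ^ 2 / m := by
  have hn3 : (3 : ℝ) ≤ n := by exact_mod_cast hn
  have hm0 : (0 : ℝ) < m := by exact_mod_cast hm
  have hmn' : (m : ℝ) ≤ n := by exact_mod_cast hmn
  set D := ((n : ℝ) - 1) * ((n : ℝ) - 2) with hDd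
  have hD : 0 < D := mul_pos (by linarith) (by linarith)
  let i₀ : Fin n := ⟨0, by omega⟩
  have hB0 : 0 ≤ B := (abs_nonneg _).trans (hB i₀ i₀ i₀)
  set G : Fin n → ℝ := fun i =>
    (∑ q ∈ ((Finset.univ : Finset (Fin n)).erase i).offDiag, h i q.1 q.2) / D with hG
  have hGB : ∀ i, |G i| ≤ B := by
    intro i
    rw [hG]
    simp only
    rw [abs_div, abs_of_pos hD, div_le_iff₀ hD, mul_comm, hDd, ← card_offDiag_erase (by omega) i,
      ← nsmul_eq_mul]
    exact (Finset.abs_sum_le_sum_abs _ _).trans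
      (Finset.sum_le_card_nsmul _ _ _ fun q _ => hB _ _ _)
  have htm : ∀ M : Finset (Fin n), M.card = m → tripleMean M h = (∑ i ∈ M, G i) / m := by
    intro M hM
    rw [tripleMean, card_triples (by omega), hM, triples, Finset.sum_sigma, hG]
    simp only
    rw [← Finset.sum_div, div_div, mul_comm D, hDd, mul_assoc]
  have hbias : |(∑ i, G i) / n - fullMean h| ≤ 6 * B / n := by
    have e : (∑ i, G i) / n - fullMean h =
        (∑ i, (G i - (∑ j, ∑ k, h i j k) / (n : ℝ) ^ 2)) / n := by
      rw [fullMean, Finset.sum_sub_distrib, sub_div, ← Finset.sum_div, ← Finset.sum_div,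
        div_div (∑ i, ∑ j, ∑ k, h i j k), ← pow_succ]
    rw [e, abs_div, abs_of_pos (by linarith : (0 : ℝ) < n)]
    have : |∑ i, (G i - (∑ j, ∑ k, h i j k) / (n : ℝ) ^ 2)| ≤ n * (6 * B / n) := by
      refine (Finset.abs_sum_le_sum_abs _ _).trans ((Finset.sum_le_card_nsmul _ _ _ fun i _ =>
        abs_offDiag_mean_sub_le hn i (h i) (hB i)).trans ?_)
      simp
    rw [div_le_iff₀ (by linarith), mul_comm]
    exact this
  have hbias2 : ((∑ i, G i) / n - fullMean h) ^ 2 ≤ 36 * B ^ 2 / m := by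
    have h1 : ((∑ i, G i) / n - fullMean h) ^ 2 ≤ (6 * B / n) ^ 2 :=
      sq_le_sq' (abs_le.1 hbias).1 (abs_le.1 hbias).2
    refine h1.trans ?_
    rw [div_pow, div_le_div_iff₀ (by positivity) hm0]
    nlinarith [mul_nonneg (sq_nonneg B) (by nlinarith : (0 : ℝ) ≤ (n : ℝ) ^ 2 - m)]
  calc sampleMean m (fun M => (tripleMean M h - fullMean h) ^ 2)
      ≤ sampleMean (n := n) m (fun M =>
          2 * ((∑ i ∈ M, G i) / m - (∑ i, G i) / n) ^ 2 + 2 * (36 * B ^ 2 / m)) := by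
        refine sampleMean_mono fun M hM => ?_
        rw [htm M hM]
        nlinarith [sq_nonneg (((∑ i ∈ M, G i) / m - (∑ i, G i) / n) -
          ((∑ i, G i) / n - fullMean h))]
    _ ≤ 2 * (B ^ 2 / m) + 2 * (36 * B ^ 2 / m) := by
        rw [sampleMean_add, sampleMean_mul, sampleMean_const hmn]
        linarith [sampleMean_sq_sub_le hm hmn G hGB]
    _ = 74 * B ^ 2 / m := by ring

/-! ### Fluctuations of the sampled frequencies -/

lemma integral_sq_sum_le {n : ℕ} {ι : Type*} (μ : Measure (Graph n)) [IsProbabilityMeasure μ]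
    (I : Finset ι) (X : ι → Graph n → ℝ) :
    ∫ A, (∑ t ∈ I, X t A) ^ 2 ∂μ ≤ I.card * ∑ t ∈ I, ∫ A, X t A ^ 2 ∂μ := by
  rw [← integral_finsetSum _ fun _ _ => Integrable.of_finite, ← integral_const_mul]
  exact integral_mono Integrable.of_finite Integrable.of_finite fun A => sq_sum_le_card_mul_sum_sq

lemma integral_sq_add_le {n : ℕ} (μ : Measure (Graph n)) [IsProbabilityMeasure μ] (a : ℝ)
    {r : ℕ} (X : Fin r → Graph n → ℝ) :
    ∫ A, (a + ∑ t, X t A) ^ 2 ∂μ ≤ (r + 1) * (a ^ 2 + ∑ t, ∫ A, X t A ^ 2 ∂μ) := by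
  -- The constant is the summand with index `none`, which makes r + 1 summands.
  have := integral_sq_sum_le μ Finset.univ (fun (t : Option (Fin r)) A => t.elim a (X · A))
  simpa [Fintype.sum_option] using this

/-- The mean of the edge indicators over a triple. -/
noncomputable def edgeKernel {n : ℕ} (P : Fin n → Fin n → ℝ) (i j k : Fin n) : ℝ :=
  (P i j + P i k + P j k) / 3

/-- The mean of the wedge indicators over a triple. -/
noncomputable def wedgeKernel {n : ℕ} (P : Fin n → Fin n → ℝ) (i j k : Fin n) : ℝ :=
  (P i j * P i k + P i j * P j k + P i k * P j k) / 3

/-- The probability that a triple is a triangle. -/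
noncomputable def triangleKernel {n : ℕ} (P : Fin n → Fin n → ℝ) (i j k : Fin n) : ℝ :=
  P i j * P i k * P j k

/-- This and the two expansions below substitute `adj = P + noise` and sort by the set of roles that
carry noise, which puts each frequency in the form of uncorrelated-product averages. -/
lemma pHat_eq_add_noise {n : ℕ} (hn : 2 ≤ n) (P : Fin n → Fin n → ℝ) (M : Finset (Fin n))
    (A : Graph n) :
    pHat M A = tripleMean M (edgeKernel P) +
      ∑ t, ![noiseMean P M {0} (fun _ _ _ => 1 / 3), noiseMean P M {1} (fun _ _ _ => 1 / 3),
        noiseMean P M {2} (fun _ _ _ => 1 / 3)] t A := by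
  rw [pHat_eq hn]
  simp only [Fin.sum_univ_three, Matrix.cons_val_zero, Matrix.cons_val_one, Matrix.cons_val,
    noiseMean, ← tripleMean_add]
  congr 1
  funext i j k
  simp only [edgeKernel, role, Finset.prod_singleton, Matrix.cons_val_zero, Matrix.cons_val_one,
    Matrix.cons_val]
  ring

lemma wedgeHat_eq_add_noise {n : ℕ} (P : Fin n → Fin n → ℝ) (M : Finset (Fin n))
    (A : Graph n) :
    wedgeHat M A = tripleMean M (wedgeKernel P) +
      ∑ t, ![noiseMean P M {0} (fun i j k => (P i k + P j k) / 3),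
        noiseMean P M {1} (fun i j k => (P i j + P j k) / 3),
        noiseMean P M {2} (fun i j k => (P i j + P i k) / 3),
        noiseMean P M {0, 1} (fun _ _ _ => 1 / 3), noiseMean P M {0, 2} (fun _ _ _ => 1 / 3),
        noiseMean P M {1, 2} (fun _ _ _ => 1 / 3)] t A := by
  rw [wedgeHat]
  simp only [Fin.sum_univ_six, Matrix.cons_val_zero, Matrix.cons_val_one, Matrix.cons_val,
    noiseMean, ← tripleMean_add]
  congr 1
  funext i j k
  rw [Finset.prod_pair (by decide), Finset.prod_pair (by decide), Finset.prod_pair (by decide)]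
  simp only [wedgeKernel, role, Finset.prod_singleton, Matrix.cons_val_zero, Matrix.cons_val_one,
    Matrix.cons_val]
  ring

lemma F3Hat_eq_add_noise {n : ℕ} (hn : 2 ≤ n) (P : Fin n → Fin n → ℝ) (M : Finset (Fin n))
    (A : Graph n) :
    F3Hat M A = tripleMean M (triangleKernel P) +
      ∑ t, ![noiseMean P M {0} (fun i j k => P i k * P j k),
        noiseMean P M {1} (fun i j k => P i j * P j k),
        noiseMean P M {2} (fun i j k => P i j * P i k),
        noiseMean P M {0, 1} (fun _ j k => P j k), noiseMean P M {0, 2} (fun i _ k => P i k),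
        noiseMean P M {1, 2} (fun i j _ => P i j),
        noiseMean P M Finset.univ (fun _ _ _ => 1)] t A := by
  rw [F3Hat_eq hn]
  simp only [Fin.sum_univ_seven, Matrix.cons_val_zero, Matrix.cons_val_one, Matrix.cons_val,
    noiseMean, ← tripleMean_add]
  congr 1
  funext i j k
  rw [Finset.prod_pair (by decide), Finset.prod_pair (by decide), Finset.prod_pair (by decide),
    Fin.prod_univ_three]
  simp only [triangleKernel, role, Finset.prod_singleton, Matrix.cons_val_zero,
    Matrix.cons_val_one, Matrix.cons_val]
  ring

lemma le_card_triples {n : ℕ} (hn : 3 ≤ n) (M : Finset (Fin n)) :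
    2 / 9 * ((M.card : ℝ) * (n : ℝ) ^ 2) ≤ (triples M).card := by
  rw [card_triples (by omega), mul_assoc]
  have h3 : (3 : ℝ) ≤ n := by exact_mod_cast hn
  have : 2 / 9 * (n : ℝ) ^ 2 ≤ ((n : ℝ) - 1) * ((n : ℝ) - 2) := by nlinarith
  nlinarith [mul_le_mul_of_nonneg_left this (Nat.cast_nonneg M.card : (0 : ℝ) ≤ M.card)]

/-- A symmetric matrix of edge probabilities with entries bounded by `ρ`. -/
structure IsKernel {n : ℕ} (P : Fin n → Fin n → ℝ) (ρ : ℝ) : Prop where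
  isEdgeProb : IsEdgeProb P
  symm : ∀ i j, P i j = P j i
  nonneg : ∀ i j, 0 ≤ P i j
  le : ∀ i j, P i j ≤ ρ

/-! ### Second moments of the sampled frequencies for a fixed sample of nodes. -/

section Moments

variable {n : ℕ} {P : Fin n → Fin n → ℝ} {ρ : ℝ} {M : Finset (Fin n)}

/-- The general bound gives 4nB²ρ/Z with Z ≥ (2/9)mn², that is 18B²ρ/(mn). A factor nρ ≥ 1 brings it
to the order of the node-sampling error. -/
lemma integral_sq_noiseMean_single_le (hn : 3 ≤ n) (hP : IsKernel P ρ) (hM : M.Nonempty)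
    (hρ : 1 ≤ n * ρ) {J : Finset (Fin 3)} (hJ : J.card = 1) {c : Fin n → Fin n → Fin n → ℝ}
    {B : ℝ} (hc : ∀ i j k, |c i j k| ≤ B) :
    ∫ A, noiseMean P M J c A ^ 2 ∂graphLaw P ≤ 18 * (B ^ 2 * ρ ^ 2 / M.card) := by
  have h := integral_sq_noiseMean_le hn hP.isEdgeProb hP.symm (fun i j _ => hP.le i j) hM
    (Finset.card_pos.1 (by omega)) hc (J := J)
  refine h.trans ?_
  have hZ := le_card_triples hn M
  have hm : (0 : ℝ) < M.card := by exact_mod_cast hM.card_pos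
  have hn0 : (0 : ℝ) < n := by exact_mod_cast (by omega : 0 < n)
  have hρ0 : 0 < ρ := pos_of_mul_pos_right (by linarith) hn0.le
  rw [hJ, roleMult, if_pos hJ, pow_one]
  calc B ^ 2 * ((4 * n : ℕ) : ℝ) * ρ / (triples M).card
      ≤ B ^ 2 * ((4 * n : ℕ) : ℝ) * ρ / (2 / 9 * ((M.card : ℝ) * (n : ℝ) ^ 2)) := by
        gcongr
    _ = 18 * (B ^ 2 * (ρ * 1) / (M.card * n)) := by push_cast; field_simp; ring
    _ ≤ 18 * (B ^ 2 * (ρ * (n * ρ)) / (M.card * n)) := by gcongr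
    _ = 18 * (B ^ 2 * ρ ^ 2 / M.card) := by field_simp

lemma integral_sq_noiseMean_multi_le (hn : 3 ≤ n) (hP : IsKernel P ρ) (hM : M.Nonempty)
    (hρ : 0 ≤ ρ) {J : Finset (Fin 3)} (hJ : 2 ≤ J.card) {c : Fin n → Fin n → Fin n → ℝ}
    {B : ℝ} (hc : ∀ i j k, |c i j k| ≤ B) :
    ∫ A, noiseMean P M J c A ^ 2 ∂graphLaw P ≤
      122 * (B ^ 2 * ρ ^ J.card / (M.card * (n : ℝ) ^ 2)) := by
  have h := integral_sq_noiseMean_le hn hP.isEdgeProb hP.symm (fun i j _ => hP.le i j) hM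
    (Finset.card_pos.1 (by omega)) hc (J := J)
  refine h.trans ?_
  have hZ := le_card_triples hn M
  have hm : (0 : ℝ) < M.card := by exact_mod_cast hM.card_pos
  have hn0 : (0 : ℝ) < n := by exact_mod_cast (by omega : 0 < n)
  rw [roleMult, if_neg (by omega)]
  calc B ^ 2 * ((27 : ℕ) : ℝ) * ρ ^ J.card / (triples M).card
      ≤ B ^ 2 * ((27 : ℕ) : ℝ) * ρ ^ J.card / (2 / 9 * ((M.card : ℝ) * (n : ℝ) ^ 2)) := by
        gcongr
    _ = 243 / 2 * (B ^ 2 * ρ ^ J.card / (M.card * (n : ℝ) ^ 2)) := by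
        push_cast; field_simp; ring
    _ ≤ _ := by gcongr; norm_num

lemma integral_sq_pHat_sub_le (hn : 3 ≤ n) (hP : IsKernel P ρ) (hM : M.Nonempty)
    (hρ : 1 ≤ n * ρ) (p : ℝ) :
    ∫ A, (pHat M A - p) ^ 2 ∂graphLaw P ≤
      4 * (tripleMean M (edgeKernel P) - p) ^ 2 + 216 * (ρ ^ 2 / M.card) := by
  have := hP.isEdgeProb.isProbabilityMeasure
  simp_rw [pHat_eq_add_noise (by omega : 2 ≤ n) P, add_sub_right_comm]
  refine (integral_sq_add_le _ _ _).trans ?_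
  have hb : ∀ r : Fin 3, ∫ A, noiseMean P M {r} (fun _ _ _ => 1 / 3) A ^ 2 ∂graphLaw P ≤
      18 * (1 ^ 2 * ρ ^ 2 / M.card) := fun r =>
    integral_sq_noiseMean_single_le hn hP hM hρ (Finset.card_singleton _)
      (fun _ _ _ => by norm_num [abs_of_pos])
  simp only [Fin.sum_univ_three, Matrix.cons_val_zero, Matrix.cons_val_one, Matrix.cons_val]
  push_cast
  have h0 := hb 0
  have h1 := hb 1
  have h2 := hb 2
  rw [one_pow, one_mul] at h0 h1 h2
  linarith

/-- One-edge terms have coefficients at most ρ. Two-edge terms have order ρ²/(mn²), which (nρ)² ≥ 1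
raises to ρ⁴/m. The constant is 7(3 · 18 + 3 · 122) = 2940. -/
lemma integral_sq_wedgeHat_sub_le (hn : 3 ≤ n) (hP : IsKernel P ρ) (hM : M.Nonempty)
    (hρ : 1 ≤ n * ρ) (w : ℝ) :
    ∫ A, (wedgeHat M A - w) ^ 2 ∂graphLaw P ≤
      7 * (tripleMean M (wedgeKernel P) - w) ^ 2 + 2940 * (ρ ^ 4 / M.card) := by
  have := hP.isEdgeProb.isProbabilityMeasure
  have hm : (0 : ℝ) < M.card := by exact_mod_cast hM.card_pos
  have hn0 : (0 : ℝ) < n := by exact_mod_cast (by omega : 0 < n)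
  have hρ0 : 0 < ρ := pos_of_mul_pos_right (by linarith) hn0.le
  simp_rw [wedgeHat_eq_add_noise P, add_sub_right_comm]
  refine (integral_sq_add_le _ _ _).trans ?_
  have habs : ∀ x y : ℝ, 0 ≤ x → x ≤ ρ → 0 ≤ y → y ≤ ρ → |(x + y) / 3| ≤ ρ := by
    intro x y h1 h2 h3 h4
    rw [abs_of_nonneg (by positivity)]
    linarith
  have h0 := integral_sq_noiseMean_single_le hn hP hM hρ (J := {0}) (Finset.card_singleton _)
    (c := fun i j k => (P i k + P j k) / 3)
    (fun i j k => habs _ _ (hP.nonneg i k) (hP.le i k) (hP.nonneg j k) (hP.le j k))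
  have h1 := integral_sq_noiseMean_single_le hn hP hM hρ (J := {1}) (Finset.card_singleton _)
    (c := fun i j k => (P i j + P j k) / 3)
    (fun i j k => habs _ _ (hP.nonneg i j) (hP.le i j) (hP.nonneg j k) (hP.le j k))
  have h2 := integral_sq_noiseMean_single_le hn hP hM hρ (J := {2}) (Finset.card_singleton _)
    (c := fun i j k => (P i j + P i k) / 3)
    (fun i j k => habs _ _ (hP.nonneg i j) (hP.le i j) (hP.nonneg i k) (hP.le i k))
  have hb : ∀ J : Finset (Fin 3), J.card = 2 →
      ∫ A, noiseMean P M J (fun _ _ _ => 1 / 3) A ^ 2 ∂graphLaw P ≤ 122 * (ρ ^ 4 / M.card) := by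
    intro J hJ
    have h := integral_sq_noiseMean_multi_le hn hP hM hρ0.le (J := J) hJ.ge
      (c := fun _ _ _ => 1 / 3) (B := 1) (fun _ _ _ => by norm_num [abs_of_pos])
    refine h.trans ?_
    rw [hJ]
    calc 122 * (1 ^ 2 * ρ ^ 2 / (M.card * (n : ℝ) ^ 2))
        = 122 * (1 ^ 2 * ρ ^ 2 / (M.card * (n : ℝ) ^ 2)) := rfl
      _ ≤ 122 * ((n * ρ) ^ 2 * ρ ^ 2 / (M.card * (n : ℝ) ^ 2)) := by gcongr
      _ = 122 * (ρ ^ 4 / M.card) := by field_simp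
  have h3 := hb {0, 1} (by decide)
  have h4 := hb {0, 2} (by decide)
  have h5 := hb {1, 2} (by decide)
  simp only [Fin.sum_univ_six, Matrix.cons_val_zero, Matrix.cons_val_one, Matrix.cons_val]
  push_cast
  rw [← pow_add] at h0 h1 h2
  norm_num at h0 h1 h2 ⊢
  linarith

/-- Terms with one or two noises are absorbed into ρ⁶/m as for wedges. The product of three noises
has no coefficient ρ to spare and produces the separate term ρ³/(mn²), the dominant one for sparse
networks. -/
lemma integral_sq_F3Hat_sub_le (hn : 3 ≤ n) (hP : IsKernel P ρ) (hM : M.Nonempty)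
    (hρ : 1 ≤ n * ρ) (f : ℝ) :
    ∫ A, (F3Hat M A - f) ^ 2 ∂graphLaw P ≤
      8 * (tripleMean M (triangleKernel P) - f) ^ 2 + 3360 * (ρ ^ 6 / M.card) +
        976 * (ρ ^ 3 / (M.card * (n : ℝ) ^ 2)) := by
  have := hP.isEdgeProb.isProbabilityMeasure
  have hm : (0 : ℝ) < M.card := by exact_mod_cast hM.card_pos
  have hn0 : (0 : ℝ) < n := by exact_mod_cast (by omega : 0 < n)
  have hρ0 : 0 < ρ := pos_of_mul_pos_right (by linarith) hn0.le
  simp_rw [F3Hat_eq_add_noise (by omega : 2 ≤ n) P, add_sub_right_comm]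
  refine (integral_sq_add_le _ _ _).trans ?_
  have habs : ∀ x y : ℝ, 0 ≤ x → x ≤ ρ → 0 ≤ y → y ≤ ρ → |x * y| ≤ ρ ^ 2 := by
    intro x y h1 h2 h3 h4
    rw [abs_of_nonneg (by positivity), sq]
    exact mul_le_mul h2 h4 h3 hρ0.le
  have h0 := integral_sq_noiseMean_single_le hn hP hM hρ (J := {0}) (Finset.card_singleton _)
    (c := fun i j k => P i k * P j k)
    (fun i j k => habs _ _ (hP.nonneg i k) (hP.le i k) (hP.nonneg j k) (hP.le j k))
  have h1 := integral_sq_noiseMean_single_le hn hP hM hρ (J := {1}) (Finset.card_singleton _)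
    (c := fun i j k => P i j * P j k)
    (fun i j k => habs _ _ (hP.nonneg i j) (hP.le i j) (hP.nonneg j k) (hP.le j k))
  have h2 := integral_sq_noiseMean_single_le hn hP hM hρ (J := {2}) (Finset.card_singleton _)
    (c := fun i j k => P i j * P i k)
    (fun i j k => habs _ _ (hP.nonneg i j) (hP.le i j) (hP.nonneg i k) (hP.le i k))
  have hb : ∀ (J : Finset (Fin 3)) (c : Fin n → Fin n → Fin n → ℝ), J.card = 2 →
      (∀ i j k, |c i j k| ≤ ρ) →
      ∫ A, noiseMean P M J c A ^ 2 ∂graphLaw P ≤ 122 * (ρ ^ 6 / M.card) := by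
    intro J c hJ hc
    have h := integral_sq_noiseMean_multi_le hn hP hM hρ0.le (J := J) hJ.ge hc
    refine h.trans ?_
    rw [hJ]
    calc 122 * (ρ ^ 2 * ρ ^ 2 / (M.card * (n : ℝ) ^ 2))
        = 122 * (1 ^ 2 * ρ ^ 4 / (M.card * (n : ℝ) ^ 2)) := by ring
      _ ≤ 122 * ((n * ρ) ^ 2 * ρ ^ 4 / (M.card * (n : ℝ) ^ 2)) := by gcongr
      _ = 122 * (ρ ^ 6 / M.card) := by field_simp
  have habs1 : ∀ i j, |P i j| ≤ ρ := fun i j => by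
    rw [abs_of_nonneg (hP.nonneg i j)]; exact hP.le i j
  have h3 := hb {0, 1} (fun _ j k => P j k) (by decide) (fun _ j k => habs1 j k)
  have h4 := hb {0, 2} (fun i _ k => P i k) (by decide) (fun i _ k => habs1 i k)
  have h5 := hb {1, 2} (fun i j _ => P i j) (by decide) (fun i j _ => habs1 i j)
  have h6 := integral_sq_noiseMean_multi_le hn hP hM hρ0.le (J := Finset.univ) (by decide)
      (c := fun _ _ _ => 1) (B := 1) (fun _ _ _ => by norm_num)
  rw [one_pow, one_mul, Finset.card_univ, Fintype.card_fin] at h6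
  simp only [Fin.sum_univ_seven, Matrix.cons_val_zero, Matrix.cons_val_one, Matrix.cons_val]
  push_cast
  rw [← pow_mul, ← pow_add] at h0 h1 h2
  norm_num at h0 h1 h2 ⊢
  linarith

end Moments

/-! ### Population frequencies -/

lemma fullMean_edgeKernel {n : ℕ} (P : Fin n → Fin n → ℝ) :
    fullMean (edgeKernel P) = (∑ i, ∑ j, P i j) / (n : ℝ) ^ 2 := by
  rcases Nat.eq_zero_or_pos n with h | h
  · subst h
    simp [fullMean]
  have hn : (n : ℝ) ≠ 0 := by positivity
  have h1 : ∑ i, ∑ j, ∑ k, edgeKernel P i j k = n * ∑ i, ∑ j, P i j := by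
    unfold edgeKernel
    simp_rw [← Finset.sum_div, Finset.sum_add_distrib, Finset.sum_const, Finset.card_univ,
      Fintype.card_fin, nsmul_eq_mul, ← Finset.mul_sum]
    ring
  rw [fullMean, h1, pow_succ' (n : ℝ) 2, mul_div_mul_left _ _ hn]

lemma fullMean_wedgeKernel {n : ℕ} {P : Fin n → Fin n → ℝ} (hs : ∀ i j, P i j = P j i) :
    fullMean (wedgeKernel P) = (∑ i, (∑ j, P i j) ^ 2) / (n : ℝ) ^ 3 := by
  rw [fullMean]
  congr 1
  have h1 : ∑ i, ∑ j, ∑ k, P i j * P i k = ∑ i, (∑ j, P i j) ^ 2 := by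
    refine Finset.sum_congr rfl fun i _ => ?_
    rw [sq, Finset.sum_mul_sum]
  have h2 : ∑ i, ∑ j, ∑ k, P i j * P j k = ∑ i, (∑ j, P i j) ^ 2 := by
    rw [Finset.sum_comm, ← h1]
    refine Finset.sum_congr rfl fun j _ => Finset.sum_congr rfl fun i _ =>
      Finset.sum_congr rfl fun k _ => ?_
    rw [hs i j]
  have h3 : ∑ i, ∑ j, ∑ k, P i k * P j k = ∑ i, (∑ j, P i j) ^ 2 := by
    have : ∀ i, ∑ j, ∑ k, P i k * P j k = ∑ k, ∑ j, P i k * P k j := by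
      intro i
      rw [Finset.sum_comm]
      refine Finset.sum_congr rfl fun k _ => Finset.sum_congr rfl fun j _ => ?_
      rw [hs j k]
    simp_rw [this]
    exact h2
  unfold wedgeKernel
  simp_rw [← Finset.sum_div, Finset.sum_add_distrib]
  rw [h1, h2, h3]
  ring

lemma abs_edgeKernel_le {n : ℕ} {P : Fin n → Fin n → ℝ} {ρ : ℝ} (hP : IsKernel P ρ)
    (i j k : Fin n) : |edgeKernel P i j k| ≤ ρ := by
  have h1 := hP.nonneg i j
  have h2 := hP.nonneg i k
  have h3 := hP.nonneg j k
  unfold edgeKernel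
  rw [abs_of_nonneg (by positivity)]
  linarith [hP.le i j, hP.le i k, hP.le j k]

lemma abs_wedgeKernel_le {n : ℕ} {P : Fin n → Fin n → ℝ} {ρ : ℝ} (hP : IsKernel P ρ)
    (i j k : Fin n) : |wedgeKernel P i j k| ≤ ρ ^ 2 := by
  have h1 := hP.nonneg i j
  have h2 := hP.nonneg i k
  have h3 := hP.nonneg j k
  have hρ : 0 ≤ ρ := h1.trans (hP.le i j)
  have e1 := mul_le_mul (hP.le i j) (hP.le i k) h2 hρ
  have e2 := mul_le_mul (hP.le i j) (hP.le j k) h3 hρ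
  have e3 := mul_le_mul (hP.le i k) (hP.le j k) h3 hρ
  unfold wedgeKernel
  rw [abs_of_nonneg (by positivity)]
  linarith

lemma triangleKernel_nonneg {n : ℕ} {P : Fin n → Fin n → ℝ} {ρ : ℝ} (hP : IsKernel P ρ)
    (i j k : Fin n) : 0 ≤ triangleKernel P i j k :=
  mul_nonneg (mul_nonneg (hP.nonneg _ _) (hP.nonneg _ _)) (hP.nonneg _ _)

lemma abs_triangleKernel_le {n : ℕ} {P : Fin n → Fin n → ℝ} {ρ : ℝ} (hP : IsKernel P ρ)
    (i j k : Fin n) : |triangleKernel P i j k| ≤ ρ ^ 3 := by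
  have h2 := hP.nonneg i k
  have h3 := hP.nonneg j k
  have hρ : 0 ≤ ρ := h2.trans (hP.le i k)
  rw [abs_of_nonneg (triangleKernel_nonneg hP i j k), pow_succ, sq]
  exact mul_le_mul (mul_le_mul (hP.le i j) (hP.le i k) h2 hρ) (hP.le j k) h3 (by positivity)

/-! ### A lower bound for the power -/

/-- The order of the variance of `F̂₃ - p̂³`. -/
noncomputable def noiseLevel (n m : ℕ) (ρ : ℝ) : ℝ :=
  ρ ^ 3 / ((m : ℝ) * (n : ℝ) ^ 2) + ρ ^ 6 / (m : ℝ)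

/-- The deviations of the sampled frequencies from the population frequencies, in units of
their order of magnitude. -/
noncomputable def deviation {n : ℕ} (P : Fin n → Fin n → ℝ) (ρ : ℝ) (M : Finset (Fin n))
    (A : Graph n) : ℝ :=
  (pHat M A - fullMean (edgeKernel P)) ^ 2 / (ρ ^ 2 / M.card) +
    (wedgeHat M A - fullMean (wedgeKernel P)) ^ 2 / (ρ ^ 4 / M.card) +
    (F3Hat M A - fullMean (triangleKernel P)) ^ 2 / noiseLevel n M.card ρ

/-- Edge noise contributes 216 + 2940 + 3360 uniformly in the sample, and averaging over the sample
contributes 74 · (4 + 7 + 8), since the three kernels are bounded by ρ, ρ² and ρ³. -/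
lemma sampleMean_integral_deviation_le {n m : ℕ} (hn : 3 ≤ n) (hm : 1 ≤ m) (hmn : m ≤ n)
    {P : Fin n → Fin n → ℝ} {ρ : ℝ} (hP : IsKernel P ρ) (hρ : 1 ≤ n * ρ) :
    sampleMean m (fun M => ∫ A, deviation P ρ M A ∂graphLaw P) ≤ 10000 := by
  have := hP.isEdgeProb.isProbabilityMeasure
  have hn0 : (0 : ℝ) < n := by exact_mod_cast (by omega : 0 < n)
  have hm0 : (0 : ℝ) < m := by exact_mod_cast hm
  have hρ0 : 0 < ρ := pos_of_mul_pos_right (by linarith) hn0.le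
  have hN : 0 < noiseLevel n m ρ := by unfold noiseLevel; positivity
  have hN6 : ρ ^ 6 / m ≤ noiseLevel n m ρ := by
    unfold noiseLevel
    have : 0 ≤ ρ ^ 3 / ((m : ℝ) * (n : ℝ) ^ 2) := by positivity
    linarith
  have hN' : 3360 * (ρ ^ 6 / m) + 976 * (ρ ^ 3 / ((m : ℝ) * (n : ℝ) ^ 2)) ≤
      3360 * noiseLevel n m ρ := by
    unfold noiseLevel
    have : 0 ≤ ρ ^ 3 / ((m : ℝ) * (n : ℝ) ^ 2) := by positivity
    linarith
  have hdec : ∀ M : Finset (Fin n), M.card = m → ∫ A, deviation P ρ M A ∂graphLaw P ≤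
      4 / (ρ ^ 2 / m) * (tripleMean M (edgeKernel P) - fullMean (edgeKernel P)) ^ 2 +
      7 / (ρ ^ 4 / m) * (tripleMean M (wedgeKernel P) - fullMean (wedgeKernel P)) ^ 2 +
      8 / noiseLevel n m ρ *
        (tripleMean M (triangleKernel P) - fullMean (triangleKernel P)) ^ 2 + 6516 := by
    intro M hM
    have hMn : M.Nonempty := Finset.card_pos.1 (by omega)
    have e1 := integral_sq_pHat_sub_le hn hP hMn hρ (fullMean (edgeKernel P))
    have e2 := integral_sq_wedgeHat_sub_le hn hP hMn hρ (fullMean (wedgeKernel P))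
    have e3 := integral_sq_F3Hat_sub_le hn hP hMn hρ (fullMean (triangleKernel P))
    unfold deviation
    rw [integral_add Integrable.of_finite Integrable.of_finite,
      integral_add Integrable.of_finite Integrable.of_finite, integral_div, integral_div,
      integral_div]
    rw [hM] at e1 e2 e3 ⊢
    have f1 : (∫ A, (pHat M A - fullMean (edgeKernel P)) ^ 2 ∂graphLaw P) / (ρ ^ 2 / m) ≤
        4 / (ρ ^ 2 / m) * (tripleMean M (edgeKernel P) - fullMean (edgeKernel P)) ^ 2 + 216 := by
      rw [div_le_iff₀ (by positivity), add_mul, mul_right_comm,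
        div_mul_cancel₀ _ (by positivity)]
      exact e1
    have f2 : (∫ A, (wedgeHat M A - fullMean (wedgeKernel P)) ^ 2 ∂graphLaw P) / (ρ ^ 4 / m) ≤
        7 / (ρ ^ 4 / m) * (tripleMean M (wedgeKernel P) - fullMean (wedgeKernel P)) ^ 2 +
          2940 := by
      rw [div_le_iff₀ (by positivity), add_mul, mul_right_comm,
        div_mul_cancel₀ _ (by positivity)]
      exact e2
    have f3 : (∫ A, (F3Hat M A - fullMean (triangleKernel P)) ^ 2 ∂graphLaw P) /
        noiseLevel n m ρ ≤ 8 / noiseLevel n m ρ *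
          (tripleMean M (triangleKernel P) - fullMean (triangleKernel P)) ^ 2 + 3360 := by
      rw [div_le_iff₀ (by positivity), add_mul, mul_right_comm,
        div_mul_cancel₀ _ (by positivity)]
      linarith
    linarith
  refine (sampleMean_mono hdec).trans ?_
  rw [sampleMean_add, sampleMean_add, sampleMean_add, sampleMean_mul, sampleMean_mul,
    sampleMean_mul, sampleMean_const hmn]
  have g1 := sampleMean_sq_tripleMean_sub_le hn hm hmn (edgeKernel P) (abs_edgeKernel_le hP)
  have g2 := sampleMean_sq_tripleMean_sub_le hn hm hmn (wedgeKernel P) (abs_wedgeKernel_le hP)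
  have g3 := sampleMean_sq_tripleMean_sub_le hn hm hmn (triangleKernel P)
    (abs_triangleKernel_le hP)
  have k1 : 4 / (ρ ^ 2 / m) * sampleMean m (fun M =>
      (tripleMean M (edgeKernel P) - fullMean (edgeKernel P)) ^ 2) ≤ 296 := by
    refine (mul_le_mul_of_nonneg_left g1 (by positivity)).trans_eq ?_
    field_simp
    norm_num
  have k2 : 7 / (ρ ^ 4 / m) * sampleMean m (fun M =>
      (tripleMean M (wedgeKernel P) - fullMean (wedgeKernel P)) ^ 2) ≤ 518 := by
    refine (mul_le_mul_of_nonneg_left g2 (by positivity)).trans_eq ?_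
    field_simp
    norm_num
  have k3 : 8 / noiseLevel n m ρ * sampleMean m (fun M =>
      (tripleMean M (triangleKernel P) - fullMean (triangleKernel P)) ^ 2) ≤ 592 := by
    refine (mul_le_mul_of_nonneg_left g3 (by positivity)).trans ?_
    rw [div_mul_eq_mul_div, div_le_iff₀ hN]
    calc 8 * (74 * (ρ ^ 3) ^ 2 / m) = 592 * (ρ ^ 6 / m) := by ring
      _ ≤ _ := by linarith
  linarith

lemma rejectProb_eq_sampleMean {n : ℕ} (m : ℕ) (c : ℝ) (μ : Measure (Graph n)) :
    rejectProb m c μ = sampleMean m fun M => μ.real {A | c < chiSq M A} := rfl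

lemma real_reject_eq {n : ℕ} (μ : Measure (Graph n)) [IsProbabilityMeasure μ]
    (M : Finset (Fin n)) (c : ℝ) :
    μ.real {A | c < chiSq M A} = 1 - μ.real {A | chiSq M A ≤ c} := by
  rw [← probReal_compl_eq_one_sub (Set.toFinite _).measurableSet]
  congr 1
  ext A
  simp

/-- The contrast of the population frequencies that governs the power. -/
noncomputable def contrast {n : ℕ} (P : Fin n → Fin n → ℝ) (s : ℝ) : ℝ :=
  fullMean (triangleKernel P) - fullMean (edgeKernel P) ^ 3 -
    3 * s * (fullMean (wedgeKernel P) - fullMean (edgeKernel P) ^ 2)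

lemma sq_sum_six_le (a b c d e f : ℝ) :
    (a + b + c + d + e + f) ^ 2 ≤ 6 * (a ^ 2 + b ^ 2 + c ^ 2 + d ^ 2 + e ^ 2 + f ^ 2) := by
  have := sq_sum_le_card_mul_sum_sq (s := Finset.univ) (f := ![a, b, c, d, e, f])
  simpa [Fin.sum_univ_six] using this

set_option maxHeartbeats 1000000 in
/-- The deterministic estimate behind the power bound: if the test accepts, then the contrast is
at most of the order of the noise level. -/
lemma sq_contrast_le_aux {n m c L ρ s p q w W f F Z : ℝ} (hm : 1 ≤ m) (hn : 0 < n)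
    (hρ : 1 ≤ n * ρ) (hρ0 : 0 < ρ) (hs : |s| ≤ ρ) (hc : 0 ≤ c) (hL : 1 ≤ L)
    (hp0 : 0 ≤ p) (hpρ : p ≤ ρ) (hq0 : 0 ≤ q) (hZ : 2 / 9 * (m * n ^ 2) ≤ Z)
    (h1 : (q - p) ^ 2 ≤ L * (ρ ^ 2 / m)) (h2 : (W - w) ^ 2 ≤ L * (ρ ^ 4 / m))
    (h3 : (F - f) ^ 2 ≤ L * (ρ ^ 3 / (m * n ^ 2) + ρ ^ 6 / m))
    (hu : Z * (F - q ^ 3) ^ 2 ≤ 24 * c * q ^ 3) (hv : Z * (W - q ^ 2) ^ 2 ≤ 76 * c * q ^ 2) :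
    (f - p ^ 3 - 3 * s * (w - p ^ 2)) ^ 2 ≤
      80000 * (1 + c) * L ^ 5 * (ρ ^ 3 / (m * n ^ 2) + ρ ^ 6 / m) := by
  have hm0 : 0 < m := by linarith
  set N := ρ ^ 3 / (m * n ^ 2) + ρ ^ 6 / m with hN
  have hN0 : 0 < N := by positivity
  have hN3 : ρ ^ 3 / (m * n ^ 2) ≤ N := by
    have : 0 ≤ ρ ^ 6 / m := by positivity
    linarith
  have hN6 : ρ ^ 6 / m ≤ N := by
    have : 0 ≤ ρ ^ 3 / (m * n ^ 2) := by positivity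
    linarith
  -- This is the order of the wedge deviation that acceptance allows, after multiplication by s² ≤
  -- ρ².
  have hN4 : ρ ^ 4 / (m * n ^ 2) ≤ N := by
    refine le_trans ?_ hN6
    calc ρ ^ 4 / (m * n ^ 2) = 1 ^ 2 * ρ ^ 4 / (m * n ^ 2) := by ring
      _ ≤ (n * ρ) ^ 2 * ρ ^ 4 / (m * n ^ 2) := by gcongr
      _ = ρ ^ 6 / m := by field_simp
  have hZ0 : 0 < Z := lt_of_lt_of_le (by positivity) hZ
  -- From |q - p| ≤ Lρ, using m ≥ 1 and L ≥ 1. Powers of this bound are the source of L⁵.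
  have hq : q ≤ 2 * L * ρ := by
    have e1 : (q - p) ^ 2 ≤ (L * ρ) ^ 2 := by
      refine h1.trans ?_
      calc L * (ρ ^ 2 / m) ≤ L * (ρ ^ 2 / 1) := by gcongr
        _ = L * 1 * ρ ^ 2 := by ring
        _ ≤ L * L * ρ ^ 2 := by gcongr
        _ = (L * ρ) ^ 2 := by ring
    have e2 := abs_le_of_sq_le_sq e1 (by positivity)
    nlinarith [(le_abs_self (q - p)).trans e2]
  have hp : p ≤ 2 * L * ρ := by nlinarith
  set κ := 2 * L with hκ
  have hκ1 : 1 ≤ κ := by linarith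
  have b1 : (F - q ^ 3) ^ 2 ≤ 864 * (c * L ^ 3) * N := by
    have e : (F - q ^ 3) ^ 2 ≤ 24 * c * q ^ 3 / Z := by
      rw [le_div_iff₀ hZ0]; linarith
    refine e.trans ?_
    calc 24 * c * q ^ 3 / Z ≤ 24 * c * (κ * ρ) ^ 3 / (2 / 9 * (m * n ^ 2)) := by gcongr
      _ = 864 * (c * L ^ 3) * (ρ ^ 3 / (m * n ^ 2)) := by rw [hκ]; field_simp; ring
      _ ≤ _ := by gcongr
  have hs2 : s ^ 2 ≤ ρ ^ 2 := sq_le_sq' (abs_le.1 hs).1 (abs_le.1 hs).2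
  have b2 : (-3 * s * (W - q ^ 2)) ^ 2 ≤ 12312 * (c * L ^ 2) * N := by
    have e : (W - q ^ 2) ^ 2 ≤ 76 * c * q ^ 2 / Z := by
      rw [le_div_iff₀ hZ0]; linarith
    calc (-3 * s * (W - q ^ 2)) ^ 2 = 9 * s ^ 2 * (W - q ^ 2) ^ 2 := by ring
      _ ≤ 9 * ρ ^ 2 * (76 * c * q ^ 2 / Z) := by gcongr
      _ ≤ 9 * ρ ^ 2 * (76 * c * (κ * ρ) ^ 2 / (2 / 9 * (m * n ^ 2))) := by gcongr
      _ = 12312 * (c * L ^ 2) * (ρ ^ 4 / (m * n ^ 2)) := by rw [hκ]; field_simp; ring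
      _ ≤ _ := by gcongr
  have b3 : (-(F - f)) ^ 2 ≤ L * N := by rw [neg_sq]; exact h3
  have b4 : (q ^ 3 - p ^ 3) ^ 2 ≤ 144 * L ^ 5 * N := by
    have e : q ^ 2 + q * p + p ^ 2 ≤ 3 * (κ * ρ) ^ 2 := by
      have a1 : q ^ 2 ≤ (κ * ρ) ^ 2 := by gcongr
      have a2 : p ^ 2 ≤ (κ * ρ) ^ 2 := by gcongr
      have a3 : q * p ≤ (κ * ρ) * (κ * ρ) := by gcongr
      nlinarith
    calc (q ^ 3 - p ^ 3) ^ 2 = (q - p) ^ 2 * (q ^ 2 + q * p + p ^ 2) ^ 2 := by ring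
      _ ≤ L * (ρ ^ 2 / m) * (3 * (κ * ρ) ^ 2) ^ 2 := by gcongr
      _ = 144 * L ^ 5 * (ρ ^ 6 / m) := by rw [hκ]; ring
      _ ≤ _ := by gcongr
  have b5 : (3 * s * (W - w)) ^ 2 ≤ 9 * L * N := by
    calc (3 * s * (W - w)) ^ 2 = 9 * s ^ 2 * (W - w) ^ 2 := by ring
      _ ≤ 9 * ρ ^ 2 * (L * (ρ ^ 4 / m)) := by gcongr
      _ = 9 * L * (ρ ^ 6 / m) := by ring
      _ ≤ _ := by gcongr
  have b6 : (-3 * s * (q ^ 2 - p ^ 2)) ^ 2 ≤ 144 * L ^ 3 * N := by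
    have e : q + p ≤ 2 * (κ * ρ) := by linarith
    calc (-3 * s * (q ^ 2 - p ^ 2)) ^ 2 = 9 * s ^ 2 * ((q - p) ^ 2 * (q + p) ^ 2) := by ring
      _ ≤ 9 * ρ ^ 2 * (L * (ρ ^ 2 / m) * (2 * (κ * ρ)) ^ 2) := by gcongr
      _ = 144 * L ^ 3 * (ρ ^ 6 / m) := by rw [hκ]; ring
      _ ≤ _ := by gcongr
  -- The population contrast is reached from the empirical deviations: two terms are small by
  -- acceptance, the other four by concentration of F, W and q. The total constant is 6(864 +
  -- 12312)c + 6(1 + 144 + 9 + 144).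
  have hsum : f - p ^ 3 - 3 * s * (w - p ^ 2) =
      (F - q ^ 3) + (-3 * s * (W - q ^ 2)) + (-(F - f)) + (q ^ 3 - p ^ 3) + (3 * s * (W - w)) +
        (-3 * s * (q ^ 2 - p ^ 2)) := by ring
  rw [hsum]
  refine (sq_sum_six_le _ _ _ _ _ _).trans ?_
  have hLp : ∀ k ≤ 5, L ^ k ≤ L ^ 5 := fun k hk => pow_le_pow_right₀ hL hk
  have l1 : L * N ≤ L ^ 5 * N := by
    have := hLp 1 (by norm_num)
    rw [pow_one] at this
    gcongr
  have l3 : L ^ 3 * N ≤ L ^ 5 * N := by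
    have := hLp 3 (by norm_num)
    gcongr
  have c3 : c * L ^ 3 * N ≤ c * L ^ 5 * N := by
    have := hLp 3 (by norm_num)
    gcongr
  have c2 : c * L ^ 2 * N ≤ c * L ^ 5 * N := by
    have := hLp 2 (by norm_num)
    gcongr
  have c5 : 0 ≤ c * L ^ 5 * N := by positivity
  have l5 : 0 ≤ L ^ 5 * N := by positivity
  linarith

lemma fullMean_edgeKernel_mem {n : ℕ} (hn : 1 ≤ n) {P : Fin n → Fin n → ℝ} {ρ : ℝ}
    (hP : IsKernel P ρ) :
    0 ≤ fullMean (edgeKernel P) ∧ fullMean (edgeKernel P) ≤ ρ := by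
  have hn0 : (0 : ℝ) < n := by exact_mod_cast hn
  rw [fullMean_edgeKernel]
  refine ⟨div_nonneg (Finset.sum_nonneg fun i _ => Finset.sum_nonneg fun j _ => hP.nonneg i j)
    (by positivity), ?_⟩
  rw [div_le_iff₀ (by positivity)]
  calc ∑ i, ∑ j, P i j ≤ ∑ _i : Fin n, ∑ _j : Fin n, ρ :=
        Finset.sum_le_sum fun i _ => Finset.sum_le_sum fun j _ => hP.le i j
    _ = ρ * (n : ℝ) ^ 2 := by simp; ring

/-- The probability of accepting is at most `K / L` as soon as the squared contrast exceeds the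
noise level by a factor of the order of `(1 + c) L ^ 5`. -/
theorem le_rejectProb_graphLaw {n m : ℕ} (hn : 3 ≤ n) (hm : 1 ≤ m) (hmn : m ≤ n)
    {P : Fin n → Fin n → ℝ} {ρ : ℝ} (hP : IsKernel P ρ) (hρ : 1 ≤ n * ρ) {s c L : ℝ}
    (hs : |s| ≤ ρ) (hc : 0 ≤ c) (hL : 1 ≤ L)
    (h : 80000 * (1 + c) * L ^ 5 * noiseLevel n m ρ < contrast P s ^ 2) :
    1 - 10000 / L ≤ rejectProb m c (graphLaw P) := by
  have := hP.isEdgeProb.isProbabilityMeasure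
  have hn0 : (0 : ℝ) < n := by exact_mod_cast (by omega : 0 < n)
  have hm1 : (1 : ℝ) ≤ m := by exact_mod_cast hm
  have hm0 : (0 : ℝ) < m := by linarith
  have hρ0 : 0 < ρ := pos_of_mul_pos_right (by linarith) hn0.le
  have hN : 0 < noiseLevel n m ρ := by unfold noiseLevel; positivity
  have hL0 : 0 < L := by linarith
  rw [rejectProb_eq_sampleMean]
  have key : ∀ M : Finset (Fin n), M.card = m →
      1 + (-1 / L) * ∫ A, deviation P ρ M A ∂graphLaw P ≤
        (graphLaw P).real {A | c < chiSq M A} := by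
    intro M hM
    have hMn : M.Nonempty := Finset.card_pos.1 (by omega)
    rw [real_reject_eq]
    have hdev : ∀ A, 0 ≤ deviation P ρ M A := by
      intro A
      unfold deviation
      rw [hM]
      positivity
    -- Acceptance together with a deviation below `L` would bound the contrast and contradict `h`.
    have hsub : {A | chiSq M A ≤ c} ⊆ {A | L ≤ deviation P ρ M A} := by
      intro A hA
      by_contra hlt
      simp only [Set.mem_ofPred_eq, not_le] at hlt hA
      refine absurd h (not_lt.2 ?_)
      obtain ⟨hu, hv⟩ := sq_le_of_chiSq_le hn hMn hc hA
      obtain ⟨hp0, hpρ⟩ := fullMean_edgeKernel_mem (by omega) hP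
      have hZ := le_card_triples hn M
      unfold deviation at hlt
      rw [hM] at hlt hZ
      have d1 : 0 ≤ (pHat M A - fullMean (edgeKernel P)) ^ 2 / (ρ ^ 2 / m) := by positivity
      have d2 : 0 ≤ (wedgeHat M A - fullMean (wedgeKernel P)) ^ 2 / (ρ ^ 4 / m) := by positivity
      have d3 : 0 ≤ (F3Hat M A - fullMean (triangleKernel P)) ^ 2 / noiseLevel n m ρ := by
        positivity
      refine sq_contrast_le_aux hm1 hn0 hρ hρ0 hs hc hL hp0 hpρ (pHat_nonneg (by omega) M A) hZ
        ?_ ?_ ?_ hu hv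
      · rw [← div_le_iff₀ (by positivity)]; linarith
      · rw [← div_le_iff₀ (by positivity)]; linarith
      · exact (div_le_iff₀ hN).1 (by linarith)
    have hmarkov := mul_meas_ge_le_integral_of_nonneg (μ := graphLaw P)
      (ae_of_all _ hdev) Integrable.of_finite L
    have hmono : (graphLaw P).real {A | chiSq M A ≤ c} ≤
        (graphLaw P).real {A | L ≤ deviation P ρ M A} := measureReal_mono hsub
    have : (graphLaw P).real {A | chiSq M A ≤ c} ≤ (∫ A, deviation P ρ M A ∂graphLaw P) / L := by
      rw [le_div_iff₀ hL0, mul_comm]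
      exact (mul_le_mul_of_nonneg_left hmono hL0.le).trans hmarkov
    rw [neg_div, neg_mul, one_div, inv_mul_eq_div]
    linarith
  refine le_trans ?_ (sampleMean_mono key)
  rw [sampleMean_add, sampleMean_const hmn, sampleMean_mul, neg_div, neg_mul, one_div,
    inv_mul_eq_div]
  have := div_le_div_of_nonneg_right (sampleMean_integral_deviation_le hn hm hmn hP hρ) hL0.le
  linarith

/-! ### The type-I error -/

lemma sq_sub_le_two_mul (x y : ℝ) : (x - y) ^ 2 ≤ 2 * x ^ 2 + 2 * y ^ 2 := by
  nlinarith [sq_nonneg (x + y)]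

set_option maxHeartbeats 1000000 in
-- Taylor expansion at p gives W - q² = (W - p² - 2p(q-p)) - (q-p)² and F - q³ = (F - p³ - 3p²(q-p))
-- - (q-p)²(q+2p). The brackets are small by hypothesis, and (q-p)⁴ is at most of order p²/Z because
-- n²/Z is bounded. The restriction p ≤ 1/9 keeps q ≤ 1/6, away from the zero of 1 - 3q.
lemma chiSq_le_aux {n p q W F Z N L : ℝ} (hp : 0 < p) (hp9 : p ≤ 1 / 9) (hL : 1 ≤ L)
    (hn : 0 < n) (hpn : 72 * L ≤ p * n) (hZ : 2 / 9 * n ^ 2 ≤ Z) (hN0 : 0 ≤ N) (hN : N ≤ Z / 2)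
    (hx : (q - p) ^ 2 ≤ L * (4 * n * p / Z))
    (hy : (W - p ^ 2 - 2 * p * (q - p)) ^ 2 ≤ L * (27 * p ^ 2 / Z))
    (hz : (F - p ^ 3 - 3 * p ^ 2 * (q - p)) ^ 2 ≤ L * (216 * p ^ 3 / Z)) :
    N * ((-3 * (W - q ^ 2) + 3 * (F - q ^ 3)) ^ 2 /
        (3 * q ^ 2 * (1 - q) ^ 2 * (1 - 3 * q) ^ 2 + 9 * q ^ 3 * (1 - q) ^ 3) +
      (q ^ 3 - F) ^ 2 / (q ^ 3 * (1 - q) ^ 3 + 3 * q ^ 4 * (1 - q) ^ 2)) ≤ 50000 * L ^ 2 := by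
  have hZ0 : 0 < Z := lt_of_lt_of_le (by positivity) hZ
  have hnZ : n ^ 2 / Z ≤ 9 / 2 := by rw [div_le_iff₀ hZ0]; linarith
  -- This is the role of pn ≥ 72L: q stays within p/2 of p, so the denominators have the orders p²
  -- and p³.
  have hx2 : (q - p) ^ 2 ≤ (p / 2) ^ 2 := by
    refine hx.trans ?_
    calc L * (4 * n * p / Z) = 4 * L * (n ^ 2 / Z) * (p / n) := by field_simp
      _ ≤ 4 * L * (9 / 2) * (p / n) := by gcongr
      _ = (72 * L) * (p / (4 * n)) := by ring
      _ ≤ (p * n) * (p / (4 * n)) := by gcongr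
      _ = (p / 2) ^ 2 := by field_simp; norm_num
  have habs := abs_le.1 (abs_le_of_sq_le_sq hx2 (by positivity))
  have hq1 : p / 2 ≤ q := by linarith [habs.1]
  have hq2 : q ≤ 1 / 6 := by linarith [habs.2]
  have hq3 : q ≤ 3 / 2 * p := by linarith [habs.2]
  have hq0 : 0 < q := by linarith
  have hx4 : ((q - p) ^ 2) ^ 2 ≤ 72 * L ^ 2 * (p ^ 2 / Z) := by
    calc ((q - p) ^ 2) ^ 2 ≤ (L * (4 * n * p / Z)) ^ 2 := by gcongr
      _ = 16 * L ^ 2 * (n ^ 2 / Z) * (p ^ 2 / Z) := by field_simp; norm_num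
      _ ≤ 16 * L ^ 2 * (9 / 2) * (p ^ 2 / Z) := by gcongr
      _ = _ := by ring
  have hLL : L ≤ L ^ 2 := le_self_pow₀ hL (by norm_num)
  have hF : (F - q ^ 3) ^ 2 ≤ 2200 * L ^ 2 * (p ^ 3 / Z) := by
    have e1 : (F - q ^ 3) ^ 2 ≤ 2 * (F - p ^ 3 - 3 * p ^ 2 * (q - p)) ^ 2 +
        2 * (((q - p) ^ 2) ^ 2 * (q + 2 * p) ^ 2) := by
      have : F - q ^ 3 = (F - p ^ 3 - 3 * p ^ 2 * (q - p)) - (q - p) ^ 2 * (q + 2 * p) := by ring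
      rw [this, ← mul_pow]
      exact sq_sub_le_two_mul _ _
    have e2 : ((q - p) ^ 2) ^ 2 * (q + 2 * p) ^ 2 ≤ 882 * L ^ 2 * (p ^ 3 / Z) := by
      calc ((q - p) ^ 2) ^ 2 * (q + 2 * p) ^ 2
          ≤ (72 * L ^ 2 * (p ^ 2 / Z)) * (7 / 2 * p) ^ 2 := by gcongr; linarith
        _ = 882 * L ^ 2 * (p ^ 3 / Z) * p := by ring
        _ ≤ 882 * L ^ 2 * (p ^ 3 / Z) * 1 := by gcongr; linarith
        _ = _ := by ring
    have e3 : L * (216 * p ^ 3 / Z) ≤ 216 * L ^ 2 * (p ^ 3 / Z) := by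
      calc L * (216 * p ^ 3 / Z) = 216 * L * (p ^ 3 / Z) := by ring
        _ ≤ _ := by gcongr
    have e4 : 0 ≤ L ^ 2 * (p ^ 3 / Z) := by positivity
    linarith
  have hW : (W - q ^ 2) ^ 2 ≤ 198 * L ^ 2 * (p ^ 2 / Z) := by
    have e1 : (W - q ^ 2) ^ 2 ≤ 2 * (W - p ^ 2 - 2 * p * (q - p)) ^ 2 +
        2 * ((q - p) ^ 2) ^ 2 := by
      have : W - q ^ 2 = (W - p ^ 2 - 2 * p * (q - p)) - (q - p) ^ 2 := by ring
      rw [this]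
      exact sq_sub_le_two_mul _ _
    have e3 : L * (27 * p ^ 2 / Z) ≤ 27 * L ^ 2 * (p ^ 2 / Z) := by
      calc L * (27 * p ^ 2 / Z) = 27 * L * (p ^ 2 / Z) := by ring
        _ ≤ _ := by gcongr
    linarith
  have hT2 : (-3 * (W - q ^ 2) + 3 * (F - q ^ 3)) ^ 2 ≤ 8000 * L ^ 2 * (p ^ 2 / Z) := by
    have e1 : (-3 * (W - q ^ 2) + 3 * (F - q ^ 3)) ^ 2 ≤
        18 * (W - q ^ 2) ^ 2 + 18 * (F - q ^ 3) ^ 2 := by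
      have : -3 * (W - q ^ 2) + 3 * (F - q ^ 3) = 3 * (F - q ^ 3) - 3 * (W - q ^ 2) := by ring
      rw [this]
      linarith [sq_sub_le_two_mul (3 * (F - q ^ 3)) (3 * (W - q ^ 2))]
    have e2 : L ^ 2 * (p ^ 3 / Z) ≤ 1 / 9 * (L ^ 2 * (p ^ 2 / Z)) := by
      calc L ^ 2 * (p ^ 3 / Z) = p * (L ^ 2 * (p ^ 2 / Z)) := by ring
        _ ≤ _ := by gcongr
    have e4 : 0 ≤ L ^ 2 * (p ^ 2 / Z) := by positivity
    linarith
  have hq5 : 5 / 6 ≤ 1 - q := by linarith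
  have hq6 : 1 / 2 ≤ 1 - 3 * q := by linarith
  have hd2 : p ^ 2 / 8 ≤
      3 * q ^ 2 * (1 - q) ^ 2 * (1 - 3 * q) ^ 2 + 9 * q ^ 3 * (1 - q) ^ 3 := by
    have e1 : 3 * (p / 2) ^ 2 * (5 / 6) ^ 2 * (1 / 2) ^ 2 ≤
        3 * q ^ 2 * (1 - q) ^ 2 * (1 - 3 * q) ^ 2 := by gcongr
    have e2 : 0 ≤ 9 * q ^ 3 * (1 - q) ^ 3 := by
      have : 0 ≤ 1 - q := by linarith
      positivity
    linarith [sq_nonneg p]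
  have hd3 : p ^ 3 / 16 ≤ q ^ 3 * (1 - q) ^ 3 + 3 * q ^ 4 * (1 - q) ^ 2 := by
    have e1 : (p / 2) ^ 3 * (5 / 6) ^ 3 ≤ q ^ 3 * (1 - q) ^ 3 := by gcongr
    have e2 : 0 ≤ 3 * q ^ 4 * (1 - q) ^ 2 := by positivity
    have e3 : 0 < p ^ 3 := by positivity
    linarith
  have r2 : (-3 * (W - q ^ 2) + 3 * (F - q ^ 3)) ^ 2 /
        (3 * q ^ 2 * (1 - q) ^ 2 * (1 - 3 * q) ^ 2 + 9 * q ^ 3 * (1 - q) ^ 3) ≤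
      64000 * L ^ 2 / Z := by
    calc _ ≤ 8000 * L ^ 2 * (p ^ 2 / Z) / (p ^ 2 / 8) := by gcongr
      _ = _ := by field_simp; norm_num
  have r3 : (q ^ 3 - F) ^ 2 / (q ^ 3 * (1 - q) ^ 3 + 3 * q ^ 4 * (1 - q) ^ 2) ≤
      35200 * L ^ 2 / Z := by
    rw [← neg_sub, neg_sq]
    calc _ ≤ 2200 * L ^ 2 * (p ^ 3 / Z) / (p ^ 3 / 16) := by gcongr
      _ = _ := by field_simp; norm_num
  calc _ ≤ N * (64000 * L ^ 2 / Z + 35200 * L ^ 2 / Z) := by gcongr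
    _ ≤ Z / 2 * (64000 * L ^ 2 / Z + 35200 * L ^ 2 / Z) := by gcongr
    _ = 49600 * L ^ 2 := by field_simp; norm_num
    _ ≤ _ := by linarith [sq_nonneg L]

/-! ### Centered monomials under the Erdős–Rényi model. -/

section Null

variable {n : ℕ} {M : Finset (Fin n)}

/-- The centered monomials of the edge indicators in the Erdős–Rényi model. -/
noncomputable abbrev nullNoise (p : ℝ) (M : Finset (Fin n)) (J : Finset (Fin 3)) (A : Graph n) :
    ℝ :=
  noiseMean (fun _ _ => p) M J (fun _ _ _ => 1) A

lemma pHat_sub_eq_nullNoise (hn : 3 ≤ n) (hM : M.Nonempty) (p : ℝ) (A : Graph n) :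
    pHat M A - p = 1 / 3 * (nullNoise p M {0} A + nullNoise p M {1} A + nullNoise p M {2} A) := by
  rw [pHat_eq (by omega), sub_eq_add_neg, ← tripleMean_const hn hM (-p), ← tripleMean_add]
  simp only [nullNoise, noiseMean, ← tripleMean_add, ← tripleMean_mul]
  congr 1
  funext i j k
  simp only [role, Finset.prod_singleton, Matrix.cons_val_zero, Matrix.cons_val_one,
    Matrix.cons_val]
  ring

/-- With constant edge probability the one-edge part of the wedge frequency is exactly 2p times the
error of `pHat`, so only two-edge monomials remain. The same happens for triangles with 3p². -/
lemma wedgeHat_sub_eq_nullNoise (hn : 3 ≤ n) (hM : M.Nonempty) (p : ℝ) (A : Graph n) :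
    wedgeHat M A - p ^ 2 - 2 * p * (pHat M A - p) =
      1 / 3 * (nullNoise p M {0, 1} A + nullNoise p M {0, 2} A + nullNoise p M {1, 2} A) := by
  have e : wedgeHat M A - p ^ 2 - 2 * p * (pHat M A - p) =
      wedgeHat M A + (-(2 * p)) * pHat M A + p ^ 2 := by ring
  rw [e, pHat_eq (by omega), wedgeHat, ← tripleMean_const hn hM (p ^ 2)]
  simp only [nullNoise, noiseMean, ← tripleMean_add, ← tripleMean_mul]
  congr 1
  funext i j k
  rw [Finset.prod_pair (by decide), Finset.prod_pair (by decide), Finset.prod_pair (by decide)]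
  simp only [role, Matrix.cons_val_zero, Matrix.cons_val_one, Matrix.cons_val]
  ring

lemma F3Hat_sub_eq_nullNoise (hn : 3 ≤ n) (hM : M.Nonempty) (p : ℝ) (A : Graph n) :
    F3Hat M A - p ^ 3 - 3 * p ^ 2 * (pHat M A - p) =
      p * (nullNoise p M {0, 1} A + nullNoise p M {0, 2} A + nullNoise p M {1, 2} A) +
        nullNoise p M Finset.univ A := by
  have e : F3Hat M A - p ^ 3 - 3 * p ^ 2 * (pHat M A - p) =
      F3Hat M A + (-(3 * p ^ 2)) * pHat M A + 2 * p ^ 3 := by ring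
  rw [e, pHat_eq (by omega), F3Hat_eq (by omega), ← tripleMean_const hn hM (2 * p ^ 3)]
  simp only [nullNoise, noiseMean, ← tripleMean_add, ← tripleMean_mul]
  congr 1
  funext i j k
  rw [Finset.prod_pair (by decide), Finset.prod_pair (by decide), Finset.prod_pair (by decide),
    Fin.prod_univ_three]
  simp only [role, Matrix.cons_val_zero, Matrix.cons_val_one, Matrix.cons_val]
  ring

/-- The squared centered monomials in units of their order of magnitude. -/
noncomputable def nullDeviation (p : ℝ) (M : Finset (Fin n)) (A : Graph n) : ℝ :=
  ∑ J ∈ (Finset.univ : Finset (Finset (Fin 3))).filter (fun J => J.Nonempty),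
    nullNoise p M J A ^ 2 / (roleMult n J * p ^ J.card / (triples M).card)

/-- There are seven nonempty sets of roles, and each normalized square has mean at most 1. -/
lemma integral_nullDeviation_le (hn : 3 ≤ n) (hM : M.Nonempty) {p : ℝ} (hp0 : 0 < p)
    (hp1 : p ≤ 1) : ∫ A, nullDeviation p M A ∂erdosRenyi n p ≤ 7 := by
  have hP : IsEdgeProb (n := n) (fun _ _ => p) := fun _ _ _ => ⟨hp0.le, hp1⟩
  have := hP.isProbabilityMeasure
  unfold nullDeviation erdosRenyi
  rw [integral_finsetSum _ fun _ _ => Integrable.of_finite]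
  have hcard : ((Finset.univ : Finset (Finset (Fin 3))).filter (fun J => J.Nonempty)).card = 7 := by
    decide
  have : (7 : ℝ) = ∑ J ∈ (Finset.univ : Finset (Finset (Fin 3))).filter (fun J => J.Nonempty),
      (1 : ℝ) := by
    rw [Finset.sum_const, hcard]; norm_num
  rw [this]
  refine Finset.sum_le_sum fun J hJ => ?_
  have hJ' : J.Nonempty := (Finset.mem_filter.1 hJ).2
  have hZ := card_triples_pos hn hM
  have hr : (0 : ℝ) < roleMult n J := by
    unfold roleMult
    split_ifs
    · exact_mod_cast (by omega : 0 < 4 * n)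
    · norm_num
  rw [integral_div, div_le_one (by positivity)]
  have h := integral_sq_noiseMean_le hn hP (fun _ _ => rfl) (ρ := p) (fun _ _ _ => le_rfl) hM hJ'
    (c := fun _ _ _ => 1) (B := 1) (fun _ _ _ => by norm_num)
  rwa [one_pow, one_mul] at h

lemma chiSq_le_of_nullDeviation_lt (hn : 3 ≤ n) (hM : M.Nonempty) {p L : ℝ} (hp : 0 < p)
    (hp9 : p ≤ 1 / 9) (hL : 1 ≤ L) (hpn : 72 * L ≤ p * n) {A : Graph n}
    (hA : nullDeviation p M A < L) : chiSq M A ≤ 50000 * L ^ 2 := by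
  have hZ := card_triples_pos hn hM
  have hn0 : (0 : ℝ) < n := by exact_mod_cast (by omega : 0 < n)
  have hm1 : (1 : ℝ) ≤ M.card := by exact_mod_cast hM.card_pos
  have hr : ∀ J, (0 : ℝ) < roleMult n J := by
    intro J
    unfold roleMult
    split_ifs
    · exact_mod_cast (by omega : 0 < 4 * n)
    · norm_num
  have hbound : ∀ J : Finset (Fin 3), J.Nonempty →
      nullNoise p M J A ^ 2 ≤ L * (roleMult n J * p ^ J.card / (triples M).card) := by
    intro J hJ
    rw [← div_le_iff₀ (by have := hr J; positivity)]
    refine le_trans ?_ hA.le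
    unfold nullDeviation
    refine Finset.single_le_sum (f := fun J => nullNoise p M J A ^ 2 /
      (roleMult n J * p ^ J.card / (triples M).card)) (fun J _ => ?_) (by simpa using hJ)
    have := hr J
    positivity
  have hr1 : ∀ J : Finset (Fin 3), J.card = 1 → (roleMult n J : ℝ) = 4 * n := by
    intro J hJ
    rw [roleMult, if_pos hJ]
    push_cast
    ring
  have hr2 : ∀ J : Finset (Fin 3), J.card ≠ 1 → (roleMult n J : ℝ) = 27 := by
    intro J hJ
    rw [roleMult, if_neg hJ]
    norm_num
  have h3sq : ∀ a b c : ℝ, (a + b + c) ^ 2 ≤ 3 * (a ^ 2 + b ^ 2 + c ^ 2) := fun a b c => by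
    nlinarith [sq_nonneg (a - b), sq_nonneg (a - c), sq_nonneg (b - c)]
  have x0 := hbound {0} (by decide)
  have x1 := hbound {1} (by decide)
  have x2 := hbound {2} (by decide)
  have y0 := hbound {0, 1} (by decide)
  have y1 := hbound {0, 2} (by decide)
  have y2 := hbound {1, 2} (by decide)
  have z0 := hbound Finset.univ (by decide)
  rw [hr1 _ (by decide), show Finset.card _ = 1 by decide, pow_one] at x0 x1 x2
  rw [hr2 _ (by decide), show Finset.card _ = 2 by decide] at y0 y1 y2
  rw [hr2 _ (by decide), show Finset.card _ = 3 by decide] at z0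
  have hT3 : T3 M A = pHat M A ^ 3 - F3Hat M A := rfl
  have hnf0 : 0 ≤ normFactor n M.card :=
    le_trans (by positivity) (card_triples_div_six_le_normFactor hn hM)
  have hZn : 2 / 9 * (n : ℝ) ^ 2 ≤ (triples M).card := by
    refine le_trans ?_ (le_card_triples hn M)
    nlinarith [sq_nonneg (n : ℝ)]
  unfold chiSq
  rw [T2_eq (by omega), hT3]
  refine chiSq_le_aux hp hp9 hL hn0 hpn hZn hnf0 (normFactor_le_card_triples_div_two hn hM)
    ?_ ?_ ?_
  · rw [pHat_sub_eq_nullNoise hn hM, mul_pow]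
    have := h3sq (nullNoise p M {0} A) (nullNoise p M {1} A) (nullNoise p M {2} A)
    linarith
  · rw [wedgeHat_sub_eq_nullNoise hn hM, mul_pow]
    have := h3sq (nullNoise p M {0, 1} A) (nullNoise p M {0, 2} A) (nullNoise p M {1, 2} A)
    linarith
  · rw [F3Hat_sub_eq_nullNoise hn hM]
    have h3 := h3sq (nullNoise p M {0, 1} A) (nullNoise p M {0, 2} A) (nullNoise p M {1, 2} A)
    set y := nullNoise p M {0, 1} A + nullNoise p M {0, 2} A + nullNoise p M {1, 2} A
    set z := nullNoise p M Finset.univ A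
    set Z := ((triples M).card : ℝ)
    have e1 : y ^ 2 ≤ 9 * (L * (27 * p ^ 2 / Z)) := by linarith
    have e2 : p ^ 2 * y ^ 2 ≤ 27 * (L * (p ^ 3 / Z)) := by
      calc p ^ 2 * y ^ 2 ≤ p ^ 2 * (9 * (L * (27 * p ^ 2 / Z))) := by gcongr
        _ = 243 * (L * (p ^ 3 / Z)) * p := by ring
        _ ≤ 243 * (L * (p ^ 3 / Z)) * (1 / 9) := by gcongr
        _ = _ := by ring
    have e3 : (p * y + z) ^ 2 ≤ 2 * (p ^ 2 * y ^ 2) + 2 * z ^ 2 := by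
      nlinarith [sq_nonneg (p * y - z)]
    have e4 : 0 ≤ L * (p ^ 3 / Z) := by positivity
    have e5 : L * (27 * p ^ 3 / Z) = 27 * (L * (p ^ 3 / Z)) := by ring
    have e6 : L * (216 * p ^ 3 / Z) = 216 * (L * (p ^ 3 / Z)) := by ring
    linarith

end Null

/-- Markov's inequality for `nullDeviation`, valid for each fixed sample; the randomness of the
sample plays no role. -/
lemma rejectProb_erdosRenyi_le {n m : ℕ} (hn : 3 ≤ n) (hm : 1 ≤ m) (hmn : m ≤ n) {p L c : ℝ}
    (hp : 0 < p) (hp9 : p ≤ 1 / 9) (hL : 1 ≤ L) (hpn : 72 * L ≤ p * n) (hc : 50000 * L ^ 2 ≤ c) :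
    rejectProb m c (erdosRenyi n p) ≤ 7 / L := by
  have hP : IsEdgeProb (n := n) (fun _ _ => p) := fun _ _ _ => ⟨hp.le, by linarith⟩
  have : IsProbabilityMeasure (erdosRenyi n p) := hP.isProbabilityMeasure
  have hL0 : 0 < L := by linarith
  rw [rejectProb_eq_sampleMean, ← sampleMean_const (n := n) hmn (7 / L)]
  refine sampleMean_mono fun M hM => ?_
  have hMn : M.Nonempty := Finset.card_pos.1 (by omega)
  have hsub : {A | c < chiSq M A} ⊆ {A | L ≤ nullDeviation p M A} := by
    intro A hA
    by_contra hlt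
    simp only [Set.mem_ofPred_eq, not_le] at hlt hA
    linarith [chiSq_le_of_nullDeviation_lt hn hMn hp hp9 hL hpn hlt]
  have hdev : ∀ A, 0 ≤ nullDeviation p M A := fun A => by
    unfold nullDeviation
    positivity
  have hmarkov := mul_meas_ge_le_integral_of_nonneg (μ := erdosRenyi n p)
    (ae_of_all _ hdev) Integrable.of_finite L
  have hmono : (erdosRenyi n p).real {A | c < chiSq M A} ≤
      (erdosRenyi n p).real {A | L ≤ nullDeviation p M A} := measureReal_mono hsub
  rw [le_div_iff₀ hL0, mul_comm]
  exact ((mul_le_mul_of_nonneg_left hmono hL0.le).trans hmarkov).trans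
    (integral_nullDeviation_le hn hMn hp (by linarith))

lemma rejectProb_nonneg {n : ℕ} (m : ℕ) (c : ℝ) (μ : Measure (Graph n)) :
    0 ≤ rejectProb m c μ := by
  unfold rejectProb
  positivity

theorem tendsto_rejectProb_erdosRenyi {m : ℕ → ℕ} (hm : ∀ n, 1 ≤ n → 1 ≤ m n ∧ m n ≤ n)
    {p : ℕ → ℝ} (hp : ∀ n, p n ∈ Set.Icc (0 : ℝ) 1) (hp0 : Tendsto p atTop (𝓝 0))
    (hpm : Tendsto (fun n : ℕ => p n ^ 3 * (m n : ℝ) * (n : ℝ) ^ 2) atTop atTop)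
    {C : ℕ → ℝ} (hC : Tendsto C atTop atTop) :
    Tendsto (fun n : ℕ => rejectProb (m n) (C n) (erdosRenyi n (p n))) atTop (𝓝 0) := by
  rw [Metric.tendsto_atTop']
  intro ε hε
  set L := 1 + 8 / ε with hLd
  have hL1 : 1 ≤ L := by
    have : 0 < 8 / ε := by positivity
    linarith
  have hLε : 7 / L < ε := by
    rw [div_lt_iff₀ (by linarith), hLd, mul_add, mul_div_cancel₀ _ hε.ne']
    linarith
  have h1 := hpm.eventually_ge_atTop ((72 * L) ^ 3)
  have h2 : ∀ᶠ n in atTop, p n < 1 / 9 := hp0.eventually_lt_const (by norm_num)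
  have h3 := hC.eventually_ge_atTop (50000 * L ^ 2)
  obtain ⟨N, hN⟩ := eventually_atTop.1 (h1.and (h2.and (h3.and (eventually_ge_atTop 3))))
  refine ⟨N, fun n hn => ?_⟩
  obtain ⟨k1, k2, k3, k4⟩ := hN n hn.le
  obtain ⟨hm1, hm2⟩ := hm n (by omega)
  have hn0 : (0 : ℝ) < n := by exact_mod_cast (by omega : 0 < n)
  have hmn : (m n : ℝ) ≤ n := by exact_mod_cast hm2
  -- Since m ≤ n, the assumption on p³mn² controls (pn)³ from below.
  have hpn : 72 * L ≤ p n * n := by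
    have h0 := (hp n).1
    refine le_of_pow_le_pow_left₀ (n := 3) (by norm_num) (by positivity) (k1.trans ?_)
    calc p n ^ 3 * (m n : ℝ) * (n : ℝ) ^ 2 ≤ p n ^ 3 * (n : ℝ) * (n : ℝ) ^ 2 := by gcongr
      _ = (p n * n) ^ 3 := by ring
  have hppos : 0 < p n := pos_of_mul_pos_left (by linarith) hn0.le
  have := rejectProb_erdosRenyi_le k4 hm1 hm2 hppos k2.le hL1 hpn k3
  rw [Real.dist_eq, sub_zero, abs_of_nonneg (rejectProb_nonneg _ _ _)]
  linarith

/-! ### Consistency for slowly diverging thresholds -/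

/-- The required signal-to-noise ratio is linear in the threshold, so any threshold below the square
root of the actual ratio is eventually admissible, whatever `K` is. The ceiling `D` must not depend
on ε, and this choice does not. -/
lemma consistentForSlowThresholds_of_forall {m : ℕ → ℕ} {H : (n : ℕ) → Set (Measure (Graph n))}
    {δ ν : ℕ → ℝ} (hν : ∀ᶠ n in atTop, 0 < ν n)
    (hR : Tendsto (fun n => δ n ^ 2 / ν n) atTop atTop)
    (hH : ∀ ε : ℝ, 0 < ε → ∃ K : ℝ, 0 ≤ K ∧ ∀ᶠ n in atTop, ∀ c : ℝ, 0 ≤ c →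
      K * (1 + c) * ν n < δ n ^ 2 → ∀ μ ∈ H n, 1 - ε ≤ rejectProb (m n) c μ) :
    ConsistentForSlowThresholds m H := by
  have hD : Tendsto (fun n => √(δ n ^ 2 / ν n)) atTop atTop := Real.tendsto_sqrt_atTop.comp hR
  refine ⟨_, hD, fun C hC hCD ε hε => ?_⟩
  obtain ⟨K, hK, h⟩ := hH ε hε
  filter_upwards [h, hν, hCD, hC.eventually_ge_atTop 0, hD.eventually_ge_atTop (2 * K + 1)] with
    n hn hνn hCn hC0 hDn
  refine hn (C n) hC0 ?_
  set x := √(δ n ^ 2 / ν n)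
  have hx : x ^ 2 = δ n ^ 2 / ν n := Real.sq_sqrt (by positivity)
  rw [← lt_div_iff₀ hνn, ← hx]
  have : K * (1 + C n) ≤ K * (1 + x) := by gcongr
  -- K(1 + x) < x² as soon as x ≥ 2K + 1 and K ≥ 0.
  nlinarith

lemma eventually_noiseLevel_pos {m : ℕ → ℕ} (hm : ∀ n, 1 ≤ n → 1 ≤ m n ∧ m n ≤ n) {ρ : ℕ → ℝ}
    (hρ : Tendsto (fun n : ℕ => (n : ℝ) * ρ n) atTop atTop) :
    ∀ᶠ n in atTop, 0 < noiseLevel n (m n) (ρ n) := by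
  filter_upwards [hρ.eventually_ge_atTop 1, eventually_ge_atTop 1] with n h1 h2
  have hn0 : (0 : ℝ) < n := by exact_mod_cast h2
  have hm0 : (0 : ℝ) < m n := by exact_mod_cast (hm n h2).1
  have hρ0 : 0 < ρ n := pos_of_mul_pos_right (by linarith) hn0.le
  unfold noiseLevel
  positivity

lemma exists_threshold_factor {ε : ℝ} (hε : 0 < ε) : ∃ L : ℝ, 1 ≤ L ∧ 10000 / L ≤ ε := by
  refine ⟨1 + 10000 / ε, ?_, ?_⟩
  · have : 0 < 10000 / ε := by positivity
    linarith
  · rw [div_le_iff₀ (by positivity), mul_add, mul_div_cancel₀ _ hε.ne']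
    linarith

theorem consistentForSlowThresholds_of_contrast {m : ℕ → ℕ}
    (hm : ∀ n, 1 ≤ n → 1 ≤ m n ∧ m n ≤ n) {H : (n : ℕ) → Set (Measure (Graph n))} {ρ δ : ℕ → ℝ}
    (hρ : Tendsto (fun n : ℕ => (n : ℝ) * ρ n) atTop atTop)
    (hR : Tendsto (fun n => δ n ^ 2 / noiseLevel n (m n) (ρ n)) atTop atTop)
    (hH : ∀ᶠ n in atTop, ∀ μ ∈ H n, ∃ P s, IsKernel P (ρ n) ∧ |s| ≤ ρ n ∧
      δ n ^ 2 ≤ contrast P s ^ 2 ∧ μ = graphLaw P) :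
    ConsistentForSlowThresholds m H := by
  refine consistentForSlowThresholds_of_forall (eventually_noiseLevel_pos hm hρ) hR
    fun ε hε => ?_
  obtain ⟨L, hL1, hL⟩ := exists_threshold_factor hε
  refine ⟨80000 * L ^ 5, by positivity, ?_⟩
  filter_upwards [hH, hρ.eventually_ge_atTop 1, eventually_ge_atTop 3] with n h1 h2 h3 c hc hlt μ hμ
  obtain ⟨P, s, hP, hs, hδ, rfl⟩ := h1 μ hμ
  obtain ⟨hm1, hm2⟩ := hm n (by omega)
  have := le_rejectProb_graphLaw h3 hm1 hm2 hP h2 hs hc hL1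
    (lt_of_le_of_lt (by rw [mul_right_comm 80000]) (hlt.trans_le hδ))
  linarith

/-! ### Stochastic block models -/

section BlockModel

variable {n k : ℕ}

/-- The fraction of nodes in the community of `i`. -/
noncomputable def ownFraction (z : Fin n → Fin k) (i : Fin n) : ℝ :=
  (communitySize z (z i) : ℝ) / n

lemma sum_same_community (z : Fin n → Fin k) (i : Fin n) :
    ∑ j, (if z i = z j then (1 : ℝ) else 0) = communitySize z (z i) := by
  rw [communitySize, Finset.sum_boole]
  simp_rw [eq_comm]

lemma sbmProb_eq (a b : ℝ) (z : Fin n → Fin k) (i j : Fin n) :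
    sbmProb a b z i j = b + (a - b) * (if z i = z j then 1 else 0) := by
  unfold sbmProb
  split_ifs <;> ring

lemma sum_sbmProb (a b : ℝ) (z : Fin n → Fin k) (i : Fin n) :
    ∑ j, sbmProb a b z i j = n * b + (a - b) * communitySize z (z i) := by
  simp_rw [sbmProb_eq]
  rw [Finset.sum_add_distrib, ← Finset.mul_sum, sum_same_community]
  simp

/-- Being in the same community is an equivalence relation, so the product of three indicators in a
triangle equals the product of two of them. Hence every sum reduces to community sizes. -/
lemma sum_sum_triangle_sbmProb (a b : ℝ) (z : Fin n → Fin k) (i : Fin n) :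
    ∑ j, ∑ l, triangleKernel (sbmProb a b z) i j l =
      (n : ℝ) ^ 2 * b ^ 3 + 2 * n * b ^ 2 * (a - b) * communitySize z (z i) +
        b ^ 2 * (a - b) * ∑ j, (communitySize z (z j) : ℝ) +
        b * (a - b) ^ 2 * communitySize z (z i) ^ 2 +
        2 * b * (a - b) ^ 2 * communitySize z (z i) ^ 2 +
        (a - b) ^ 3 * communitySize z (z i) ^ 2 := by
  set e : Fin n → Fin n → ℝ := fun i j => if z i = z j then 1 else 0 with he
  set N : Fin n → ℝ := fun i => communitySize z (z i) with hN
  have hrow : ∀ i, ∑ j, e i j = N i := sum_same_community z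
  have hsymm : ∀ i j, e i j = e j i := fun i j => by simp only [he, eq_comm]
  have htrans : ∀ i j l, e i j * e i l * e j l = e i j * e i l := by
    intro i j l
    simp only [he]
    split_ifs with h1 h2 h3 <;> simp_all
  have heN : ∀ i j, e i j * N j = e i j * N i := by
    intro i j
    simp only [he, hN]
    split_ifs with h
    · rw [h]
    · simp
  have hsbm : ∀ i j, sbmProb a b z i j = b + (a - b) * e i j := sbmProb_eq a b z
  have hexp : ∀ j l, triangleKernel (sbmProb a b z) i j l =
      b ^ 3 + b ^ 2 * (a - b) * e i j + b ^ 2 * (a - b) * e i l + b ^ 2 * (a - b) * e j l +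
        b * (a - b) ^ 2 * (e i j * e i l) + b * (a - b) ^ 2 * (e i j * e j l) +
        b * (a - b) ^ 2 * (e i l * e j l) + (a - b) ^ 3 * (e i j * e i l) := by
    intro j l
    rw [triangleKernel, hsbm, hsbm, hsbm]
    linear_combination (a - b) ^ 3 * htrans i j l
  have s1 : ∑ j, ∑ l, e i j * e i l = N i ^ 2 := by
    simp_rw [← Finset.mul_sum, ← Finset.sum_mul, hrow, sq]
  have s2 : ∑ j, ∑ l, e i j * e j l = N i ^ 2 := by
    simp_rw [← Finset.mul_sum, hrow, heN, ← Finset.sum_mul, hrow]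
    rw [sq]
  have s3 : ∑ j, ∑ l, e i l * e j l = N i ^ 2 := by
    rw [Finset.sum_comm, ← s2]
    exact Finset.sum_congr rfl fun l _ => Finset.sum_congr rfl fun j _ => by rw [hsymm j l]
  have s4 : ∑ j, ∑ l, e j l = ∑ j, N j := Finset.sum_congr rfl fun j _ => hrow j
  have s5 : ∑ j, ∑ _l : Fin n, e i j = n * N i := by
    simp_rw [Finset.sum_const, Finset.card_univ, Fintype.card_fin, nsmul_eq_mul,
      ← Finset.mul_sum, hrow]
  have s6 : ∑ _j : Fin n, ∑ l, e i l = n * N i := by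
    rw [Finset.sum_comm, s5]
  have hmul : ∀ (c : ℝ) (g : Fin n → Fin n → ℝ),
      ∑ j, ∑ l, c * g j l = c * ∑ j, ∑ l, g j l := fun c g => by
    simp_rw [← Finset.mul_sum]
  simp only [hexp, Finset.sum_add_distrib, hmul, s1, s2, s3, s4, s5, s6]
  simp only [Finset.sum_const, Finset.card_univ, Fintype.card_fin, nsmul_eq_mul]
  ring

/-- Let S₂ and S₃ be the averages of `ownFraction` and of its square. Then f - p³ = (a-b)³(S₃ - S₂³)
+ 3b(a-b)²(S₃ - S₂²) and w - p² = (a-b)²(S₃ - S₂²), so s = b cancels the second term exactly. -/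
lemma contrast_sbmProb (hn : 1 ≤ n) (a b : ℝ) (z : Fin n → Fin k) :
    contrast (sbmProb a b z) b =
      (a - b) ^ 3 * ((∑ i, ownFraction z i ^ 2) / n - ((∑ i, ownFraction z i) / n) ^ 3) := by
  have hs : ∀ i j, sbmProb a b z i j = sbmProb a b z j i := fun i j => by
    simp only [sbmProb, eq_comm]
  have hn0 : (n : ℝ) ≠ 0 := by
    have : (0 : ℝ) < n := by exact_mod_cast hn
    exact this.ne'
  set N : Fin n → ℝ := fun i => communitySize z (z i) with hN
  have hown1 : ∑ i, ownFraction z i = (∑ i, N i) / n := by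
    rw [Finset.sum_div]; rfl
  have hown2 : ∑ i, ownFraction z i ^ 2 = (∑ i, N i ^ 2) / (n : ℝ) ^ 2 := by
    rw [Finset.sum_div]
    exact Finset.sum_congr rfl fun i _ => div_pow _ _ _
  have hE : fullMean (edgeKernel (sbmProb a b z)) = b + (a - b) * (∑ i, N i) / (n : ℝ) ^ 2 := by
    rw [fullMean_edgeKernel]
    simp_rw [sum_sbmProb]
    rw [Finset.sum_add_distrib, ← Finset.mul_sum Finset.univ _ (a - b)]
    simp only [Finset.sum_const, Finset.card_univ, Fintype.card_fin, nsmul_eq_mul]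
    field_simp
    rfl
  have hW : fullMean (wedgeKernel (sbmProb a b z)) = b ^ 2 +
      2 * b * (a - b) * (∑ i, N i) / (n : ℝ) ^ 2 + (a - b) ^ 2 * (∑ i, N i ^ 2) / (n : ℝ) ^ 3 := by
    rw [fullMean_wedgeKernel hs]
    simp_rw [sum_sbmProb]
    have : ∀ i : Fin n, (n * b + (a - b) * (communitySize z (z i) : ℝ)) ^ 2 =
        (n : ℝ) ^ 2 * b ^ 2 + 2 * n * b * (a - b) * N i + (a - b) ^ 2 * N i ^ 2 := fun i => by
      simp only [hN]; ring
    simp_rw [this]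
    rw [Finset.sum_add_distrib, Finset.sum_add_distrib,
      ← Finset.mul_sum Finset.univ _ (2 * n * b * (a - b)),
      ← Finset.mul_sum Finset.univ _ ((a - b) ^ 2)]
    simp only [Finset.sum_const, Finset.card_univ, Fintype.card_fin, nsmul_eq_mul]
    field_simp
  have hF : fullMean (triangleKernel (sbmProb a b z)) = b ^ 3 +
      3 * b ^ 2 * (a - b) * (∑ i, N i) / (n : ℝ) ^ 2 +
      (3 * b * (a - b) ^ 2 + (a - b) ^ 3) * (∑ i, N i ^ 2) / (n : ℝ) ^ 3 := by
    rw [fullMean]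
    simp_rw [sum_sum_triangle_sbmProb, Finset.sum_add_distrib, ← Finset.mul_sum]
    simp only [Finset.sum_const, Finset.card_univ, Fintype.card_fin, nsmul_eq_mul]
    rw [show ∑ i, (communitySize z (z i) : ℝ) = ∑ i, N i from rfl,
      show ∑ i, (communitySize z (z i) : ℝ) ^ 2 = ∑ i, N i ^ 2 from rfl]
    field_simp
    ring
  rw [contrast, hE, hW, hF, hown1, hown2]
  field_simp
  ring

lemma sum_communitySize (z : Fin n → Fin k) : ∑ j, (communitySize z j : ℝ) = n := by
  have := Finset.card_eq_sum_card_fiberwise (f := z) (s := Finset.univ) (t := Finset.univ)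
    (fun _ _ => Finset.mem_coe.2 (Finset.mem_univ _))
  rw [Finset.card_univ, Fintype.card_fin] at this
  unfold communitySize
  exact_mod_cast this.symm

lemma sum_ownFraction (z : Fin n → Fin k) :
    ∑ i, ownFraction z i = (∑ j, (communitySize z j : ℝ) ^ 2) / n := by
  unfold ownFraction
  rw [← Finset.sum_div]
  congr 1
  rw [← Finset.sum_fiberwise (s := Finset.univ) (g := z)]
  refine Finset.sum_congr rfl fun j _ => ?_
  rw [Finset.sum_congr rfl (g := fun _ => (communitySize z j : ℝ))]
  · rw [Finset.sum_const, nsmul_eq_mul, sq]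
    rfl
  · intro i hi
    rw [(Finset.mem_filter.1 hi).2]

/-- Cauchy–Schwarz gives S₃ ≥ S₂² and S₂ ≥ 1/k, and no community exceeding the fraction 1 - τ gives
S₂ ≤ 1 - τ. Therefore S₃ - S₂³ ≥ S₂²(1 - S₂) ≥ τ/k². -/
lemma sq_contrast_sbmProb_ge (hn : 1 ≤ n) (hk : 1 ≤ k) (a b : ℝ) (z : Fin n → Fin k) {τ : ℝ}
    (hτ : 0 ≤ τ) (hz : ∀ j, (communitySize z j : ℝ) ≤ n * (1 - τ)) :
    (τ * (|a - b| ^ 3 / (k : ℝ) ^ 2)) ^ 2 ≤ contrast (sbmProb a b z) b ^ 2 := by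
  have hn0 : (0 : ℝ) < n := by exact_mod_cast hn
  have hk0 : (0 : ℝ) < k := by exact_mod_cast hk
  rw [contrast_sbmProb hn]
  set S2 := (∑ i, ownFraction z i) / n with hS2
  set S3 := (∑ i, ownFraction z i ^ 2) / n with hS3
  have h32 : S2 ^ 2 ≤ S3 := by
    have := sq_sum_le_card_mul_sum_sq (s := Finset.univ) (f := ownFraction z)
    rw [Finset.card_univ, Fintype.card_fin] at this
    rw [hS2, hS3, div_pow, div_le_div_iff₀ (by positivity) hn0]
    nlinarith
  have h2k : 1 / (k : ℝ) ≤ S2 := by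
    rw [hS2, sum_ownFraction, div_div, div_le_div_iff₀ hk0 (by positivity), one_mul, mul_comm]
    have := sq_sum_le_card_mul_sum_sq (s := Finset.univ)
      (f := fun j => (communitySize z j : ℝ))
    rw [Finset.card_univ, Fintype.card_fin, sum_communitySize] at this
    nlinarith
  have h2τ : S2 ≤ 1 - τ := by
    rw [hS2, div_le_iff₀ hn0]
    have : ∀ i ∈ (Finset.univ : Finset (Fin n)), ownFraction z i ≤ 1 - τ := by
      intro i _
      rw [ownFraction, div_le_iff₀ hn0, mul_comm]
      exact hz _
    have := Finset.sum_le_card_nsmul _ _ _ this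
    rw [Finset.card_univ, Fintype.card_fin, nsmul_eq_mul] at this
    linarith
  have hS20 : 0 ≤ S2 := le_trans (by positivity) h2k
  have hge : τ / (k : ℝ) ^ 2 ≤ S3 - S2 ^ 3 := by
    have e1 : (1 / (k : ℝ)) ^ 2 * τ ≤ S2 ^ 2 * (1 - S2) := by
      have : τ ≤ 1 - S2 := by linarith
      gcongr
    have e2 : τ / (k : ℝ) ^ 2 = (1 / (k : ℝ)) ^ 2 * τ := by field_simp
    rw [e2]
    nlinarith
  calc (τ * (|a - b| ^ 3 / (k : ℝ) ^ 2)) ^ 2 = (|a - b| ^ 2) ^ 3 * (τ / (k : ℝ) ^ 2) ^ 2 := by ring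
    _ ≤ (|a - b| ^ 2) ^ 3 * (S3 - S2 ^ 3) ^ 2 := by gcongr
    _ = ((a - b) ^ 3 * (S3 - S2 ^ 3)) ^ 2 := by rw [sq_abs]; ring

lemma isKernel_sbmProb {a b : ℝ} (ha : a ∈ Set.Icc (0 : ℝ) 1) (hb : b ∈ Set.Icc (0 : ℝ) 1)
    (z : Fin n → Fin k) : IsKernel (sbmProb a b z) (a + b) where
  isEdgeProb i j _ := by
    unfold sbmProb
    split_ifs
    exacts [ha, hb]
  symm i j := by simp only [sbmProb, eq_comm]
  nonneg i j := by
    unfold sbmProb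
    split_ifs
    exacts [ha.1, hb.1]
  le i j := by
    unfold sbmProb
    split_ifs
    · linarith [hb.1]
    · linarith [ha.1]

end BlockModel

/-- The sparse and the dense conditions on a signal `q` both ensure that it dominates the noise
level. -/
lemma tendsto_div_noiseLevel {m : ℕ → ℕ} (hm : ∀ n, 1 ≤ n → 1 ≤ m n ∧ m n ≤ n) {ρ q : ℕ → ℝ}
    (hρ : Tendsto (fun n : ℕ => (n : ℝ) * ρ n) atTop atTop) (hq : ∀ n, 0 ≤ q n)
    (h : ((fun n : ℕ => ρ n) =O[atTop] (fun n : ℕ => (n : ℝ) ^ (-(2 / 3) : ℝ)) ∧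
        Tendsto (fun n : ℕ => (m n : ℝ) * (n : ℝ) ^ 2 * q n / ρ n ^ 3) atTop atTop) ∨
      ((fun n : ℕ => (n : ℝ) ^ (-(2 / 3) : ℝ)) =O[atTop] (fun n : ℕ => ρ n) ∧
        Tendsto (fun n : ℕ => (m n : ℝ) * q n / ρ n ^ 6) atTop atTop)) :
    Tendsto (fun n => q n / noiseLevel n (m n) (ρ n)) atTop atTop := by
  have hcube : ∀ n : ℕ, 1 ≤ n → ((n : ℝ) ^ (-(2 / 3) : ℝ)) ^ 3 = 1 / (n : ℝ) ^ 2 := by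
    intro n hn
    have hn0 : (0 : ℝ) < n := by exact_mod_cast hn
    rw [← Real.rpow_natCast, ← Real.rpow_mul hn0.le, one_div, ← Real.rpow_natCast (n : ℝ) 2,
      ← Real.rpow_neg hn0.le]
    norm_num
  have hpos : ∀ᶠ n : ℕ in atTop, 1 ≤ n ∧ 0 < ρ n := by
    filter_upwards [hρ.eventually_ge_atTop 1, eventually_ge_atTop 1] with n h1 h2
    have hn0 : (0 : ℝ) < n := by exact_mod_cast h2
    exact ⟨h2, pos_of_mul_pos_right (by linarith) hn0.le⟩
  -- The signal has to dominate each of the two terms of the noise level.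
  suffices hXY : Tendsto (fun n : ℕ => (m n : ℝ) * (n : ℝ) ^ 2 * q n / ρ n ^ 3) atTop atTop ∧
      Tendsto (fun n : ℕ => (m n : ℝ) * q n / ρ n ^ 6) atTop atTop by
    rw [tendsto_atTop]
    intro B
    have hB : 0 < 2 * |B| + 1 := by positivity
    filter_upwards [hpos, hXY.1.eventually_ge_atTop (2 * |B| + 1),
      hXY.2.eventually_ge_atTop (2 * |B| + 1)] with n ⟨hn, hρn⟩ hX hY
    have hn0 : (0 : ℝ) < n := by exact_mod_cast hn
    have hm0 : (0 : ℝ) < m n := by exact_mod_cast (hm n hn).1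
    unfold noiseLevel
    rw [le_div_iff₀ (by positivity)]
    have e1 : (2 * |B| + 1) * (ρ n ^ 3 / ((m n : ℝ) * (n : ℝ) ^ 2)) ≤ q n := by
      rw [le_div_iff₀ (by positivity)] at hX
      rw [mul_div_assoc', div_le_iff₀ (by positivity)]
      linarith
    have e2 : (2 * |B| + 1) * (ρ n ^ 6 / (m n : ℝ)) ≤ q n := by
      rw [le_div_iff₀ (by positivity)] at hY
      rw [mul_div_assoc', div_le_iff₀ (by positivity)]
      linarith
    have e3 : 0 ≤ ρ n ^ 3 / ((m n : ℝ) * (n : ℝ) ^ 2) + ρ n ^ 6 / (m n : ℝ) := by positivity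
    have e4 := mul_le_mul_of_nonneg_right (le_abs_self B) e3
    linarith
  rcases h with ⟨hO, hX⟩ | ⟨hO, hY⟩
  -- In the sparse regime ρ³n² ≤ K³, so the second ratio is at least the first divided by K³.
  · refine ⟨hX, ?_⟩
    obtain ⟨K, hK, hO⟩ := hO.exists_pos
    rw [Asymptotics.isBigOWith_iff] at hO
    refine tendsto_atTop_mono' _ ?_ (hX.const_mul_atTop (by positivity : (0 : ℝ) < 1 / K ^ 3))
    filter_upwards [hpos, hO] with n ⟨hn, hρn⟩ hOn
    have hn0 : (0 : ℝ) < n := by exact_mod_cast hn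
    have hqn := hq n
    rw [Real.norm_of_nonneg hρn.le, Real.norm_of_nonneg (by positivity)] at hOn
    have h3 : ρ n ^ 3 * (n : ℝ) ^ 2 ≤ K ^ 3 := by
      have := pow_le_pow_left₀ hρn.le hOn 3
      rw [mul_pow, hcube n hn, mul_one_div, le_div_iff₀ (by positivity)] at this
      exact this
    calc 1 / K ^ 3 * ((m n : ℝ) * (n : ℝ) ^ 2 * q n / ρ n ^ 3)
        = (m n : ℝ) * q n / ρ n ^ 6 * (ρ n ^ 3 * (n : ℝ) ^ 2) / K ^ 3 := by field_simp
      _ ≤ (m n : ℝ) * q n / ρ n ^ 6 * K ^ 3 / K ^ 3 := by gcongr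
      _ = (m n : ℝ) * q n / ρ n ^ 6 := by field_simp
  -- In the dense regime ρ³n² ≥ 1/K³, and the comparison is reversed.
  · refine ⟨?_, hY⟩
    obtain ⟨K, hK, hO⟩ := hO.exists_pos
    rw [Asymptotics.isBigOWith_iff] at hO
    refine tendsto_atTop_mono' _ ?_ (hY.const_mul_atTop (by positivity : (0 : ℝ) < 1 / K ^ 3))
    filter_upwards [hpos, hO] with n ⟨hn, hρn⟩ hOn
    have hn0 : (0 : ℝ) < n := by exact_mod_cast hn
    have hqn := hq n
    rw [Real.norm_of_nonneg hρn.le, Real.norm_of_nonneg (by positivity)] at hOn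
    have h3 : 1 ≤ K ^ 3 * (ρ n ^ 3 * (n : ℝ) ^ 2) := by
      have := pow_le_pow_left₀ (by positivity) hOn 3
      rw [mul_pow, hcube n hn, div_le_iff₀ (by positivity)] at this
      linarith
    calc 1 / K ^ 3 * ((m n : ℝ) * q n / ρ n ^ 6)
        = 1 / K ^ 3 * ((m n : ℝ) * q n / ρ n ^ 6) * 1 := by ring
      _ ≤ 1 / K ^ 3 * ((m n : ℝ) * q n / ρ n ^ 6) * (K ^ 3 * (ρ n ^ 3 * (n : ℝ) ^ 2)) := by
          gcongr
      _ = (m n : ℝ) * (n : ℝ) ^ 2 * q n / ρ n ^ 3 := by field_simp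

/-- The sparse condition is the cube root of the ratio of signal to ρ³/(mn²). -/
lemma tendsto_cube_signal {m : ℕ → ℕ} {k d ρ : ℕ → ℝ} (hk : ∀ n, 0 ≤ k n)
    (h : Tendsto (fun n : ℕ => ((m n : ℝ) * (n : ℝ) ^ 2) ^ (1 / 3 : ℝ) * d n ^ 2 /
      (k n ^ (4 / 3 : ℝ) * ρ n)) atTop atTop) :
    Tendsto (fun n : ℕ => (m n : ℝ) * (n : ℝ) ^ 2 * (d n ^ 6 / k n ^ 4) / ρ n ^ 3)
      atTop atTop := by
  have h3 := (tendsto_pow_atTop (α := ℝ) (n := 3) (by norm_num)).comp h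
  refine h3.congr fun n => ?_
  simp only [Function.comp]
  have e1 : (((m n : ℝ) * (n : ℝ) ^ 2) ^ (1 / 3 : ℝ)) ^ 3 = (m n : ℝ) * (n : ℝ) ^ 2 := by
    rw [← Real.rpow_natCast, ← Real.rpow_mul (by positivity)]
    norm_num
  have e2 : (k n ^ (4 / 3 : ℝ)) ^ 3 = k n ^ 4 := by
    rw [← Real.rpow_natCast, ← Real.rpow_mul (hk n), ← Real.rpow_natCast (k n) 4]
    norm_num
  rw [div_pow, mul_pow, mul_pow, e1, e2, ← pow_mul, mul_div_assoc', div_div]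

theorem consistentForSlowThresholds_blockModel {m : ℕ → ℕ}
    (hm : ∀ n, 1 ≤ n → 1 ≤ m n ∧ m n ≤ n) {H : (n : ℕ) → Set (Measure (Graph n))}
    {k : ℕ → ℕ} {a b : ℕ → ℝ} {τ : ℝ} (hτ : 0 < τ) (hk : ∀ n, 1 ≤ k n)
    (ha : ∀ n, a n ∈ Set.Icc (0 : ℝ) 1) (hb : ∀ n, b n ∈ Set.Icc (0 : ℝ) 1)
    (hab : Tendsto (fun n : ℕ => (n : ℝ) * (a n + b n)) atTop atTop)
    (h : ((fun n : ℕ => a n + b n) =O[atTop] (fun n : ℕ => (n : ℝ) ^ (-(2 / 3) : ℝ)) ∧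
          Tendsto (fun n : ℕ => ((m n : ℝ) * (n : ℝ) ^ 2) ^ (1 / 3 : ℝ) * (a n - b n) ^ 2 /
            ((k n : ℝ) ^ (4 / 3 : ℝ) * (a n + b n))) atTop atTop) ∨
        ((fun n : ℕ => (n : ℝ) ^ (-(2 / 3) : ℝ)) =O[atTop] (fun n : ℕ => a n + b n) ∧
          Tendsto (fun n : ℕ => (m n : ℝ) * (a n - b n) ^ 6 /
            ((k n : ℝ) ^ 4 * (a n + b n) ^ 6)) atTop atTop))
    (hH : ∀ᶠ n in atTop, ∀ μ ∈ H n, ∃ z : Fin n → Fin (k n),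
      (∀ j, (communitySize z j : ℝ) ≤ n * (1 - τ)) ∧ μ = graphLaw (sbmProb (a n) (b n) z)) :
    ConsistentForSlowThresholds m H := by
  refine consistentForSlowThresholds_of_contrast hm hab
    (δ := fun n => τ * (|a n - b n| ^ 3 / (k n : ℝ) ^ 2)) ?_ ?_
  · have hq : Tendsto (fun n => ((a n - b n) ^ 6 / (k n : ℝ) ^ 4) /
        noiseLevel n (m n) (a n + b n)) atTop atTop := by
      refine tendsto_div_noiseLevel hm hab
        (fun n => div_nonneg (Even.pow_nonneg (by decide) _) (by positivity)) (h.imp ?_ ?_)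
      · exact fun ⟨h1, h2⟩ => ⟨h1, tendsto_cube_signal (fun n => by positivity) h2⟩
      · refine fun ⟨h1, h2⟩ => ⟨h1, h2.congr fun n => ?_⟩
        rw [mul_div_assoc', div_div]
    refine (hq.const_mul_atTop (by positivity : 0 < τ ^ 2)).congr fun n => ?_
    rw [mul_div_assoc', mul_pow, div_pow, ← pow_mul, ← pow_mul,
      show |a n - b n| ^ (3 * 2) = (a n - b n) ^ 6 from Even.pow_abs (by decide) _]
  · filter_upwards [hH, eventually_ge_atTop 1] with n hn h1 μ hμ
    obtain ⟨z, hz, rfl⟩ := hn μ hμ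
    refine ⟨_, b n, isKernel_sbmProb (ha n) (hb n) z, ?_,
      sq_contrast_sbmProb_ge h1 (hk n) _ _ z hτ.le hz, rfl⟩
    rw [abs_of_nonneg (hb n).1]
    linarith [(ha n).1]

theorem consistentForSlowThresholds_sbmTwo {m : ℕ → ℕ} (hm : ∀ n, 1 ≤ n → 1 ≤ m n ∧ m n ≤ n)
    {π : ℝ} {a b : ℕ → ℝ} (hπ : 0 < π)
    (ha : ∀ n, a n ∈ Set.Icc (0 : ℝ) 1) (hb : ∀ n, b n ∈ Set.Icc (0 : ℝ) 1)
    (hab : Tendsto (fun n : ℕ => (n : ℝ) * (a n + b n)) atTop atTop)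
    (h : ((fun n : ℕ => a n + b n) =O[atTop] (fun n : ℕ => (n : ℝ) ^ (-(2 / 3) : ℝ)) ∧
          Tendsto (fun n : ℕ => ((m n : ℝ) * (n : ℝ) ^ 2) ^ (1 / 3 : ℝ) * (a n - b n) ^ 2 /
            (a n + b n)) atTop atTop) ∨
        ((fun n : ℕ => (n : ℝ) ^ (-(2 / 3) : ℝ)) =O[atTop] (fun n : ℕ => a n + b n) ∧
          Tendsto (fun n : ℕ => (m n : ℝ) * (a n - b n) ^ 6 / (a n + b n) ^ 6) atTop atTop)) :
    ConsistentForSlowThresholds m (fun n => sbmTwo n π (a n) (b n)) := by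
  refine consistentForSlowThresholds_blockModel hm (k := fun _ => 2) hπ (fun _ => by norm_num)
    ha hb hab (h.imp ?_ ?_) (Eventually.of_forall fun n μ hμ => ?_)
  · refine fun ⟨h1, h2⟩ => ⟨h1, ?_⟩
    refine (h2.const_mul_atTop
      (by positivity : (0 : ℝ) < 1 / ((2 : ℕ) : ℝ) ^ (4 / 3 : ℝ))).congr fun n => ?_
    rw [div_mul_div_comm, one_mul]
  · refine fun ⟨h1, h2⟩ => ⟨h1, ?_⟩
    refine (h2.const_mul_atTop
      (by positivity : (0 : ℝ) < 1 / ((2 : ℕ) : ℝ) ^ 4)).congr fun n => ?_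
    rw [div_mul_div_comm, one_mul]
  · obtain ⟨z, h1, h2, rfl⟩ := hμ
    refine ⟨z, fun j => ?_, rfl⟩
    have hsum := sum_communitySize z
    rw [Fin.sum_univ_two] at hsum
    have hj : j = 0 ∨ j = 1 := by fin_cases j <;> simp
    rcases hj with rfl | rfl
    · exact h2
    -- The sizes add up to n, so the lower bound on one community is the upper bound on the other.
    · linarith

theorem consistentForSlowThresholds_sbmBalanced {m : ℕ → ℕ}
    (hm : ∀ n, 1 ≤ n → 1 ≤ m n ∧ m n ≤ n) {k : ℕ → ℕ} {a b : ℕ → ℝ} (hk : ∀ n, 2 ≤ k n)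
    (ha : ∀ n, a n ∈ Set.Icc (0 : ℝ) 1) (hb : ∀ n, b n ∈ Set.Icc (0 : ℝ) 1)
    (hab : Tendsto (fun n : ℕ => (n : ℝ) * (a n + b n)) atTop atTop)
    (h : ((fun n : ℕ => a n + b n) =O[atTop] (fun n : ℕ => (n : ℝ) ^ (-(2 / 3) : ℝ)) ∧
          Tendsto (fun n : ℕ => ((m n : ℝ) * (n : ℝ) ^ 2) ^ (1 / 3 : ℝ) * (a n - b n) ^ 2 /
            ((k n : ℝ) ^ (4 / 3 : ℝ) * (a n + b n))) atTop atTop) ∨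
        ((fun n : ℕ => (n : ℝ) ^ (-(2 / 3) : ℝ)) =O[atTop] (fun n : ℕ => a n + b n) ∧
          Tendsto (fun n : ℕ => (m n : ℝ) * (a n - b n) ^ 6 /
            ((k n : ℝ) ^ 4 * (a n + b n) ^ 6)) atTop atTop)) :
    ConsistentForSlowThresholds m (fun n => sbmBalanced n (k n) (a n) (b n)) := by
  -- A community has at most n/k + 1 ≤ n/2 + 1 nodes, which is at most 3n/4 once n ≥ 4.
  refine consistentForSlowThresholds_blockModel hm (τ := 1 / 4) (by norm_num)
    (fun n => (by norm_num : 1 ≤ 2).trans (hk n)) ha hb hab h ?_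
  filter_upwards [eventually_ge_atTop 4] with n hn μ hμ
  obtain ⟨z, hz, rfl⟩ := hμ
  refine ⟨z, fun j => (hz j).2.trans ?_, rfl⟩
  have hn4 : (4 : ℝ) ≤ n := by exact_mod_cast hn
  have hk2 : (2 : ℝ) ≤ k n := by exact_mod_cast hk n
  have : (n : ℝ) / k n ≤ n / 2 := by gcongr
  linarith

/-! ### Configuration models -/

lemma contrast_configuration {n : ℕ} (θ : Fin n → ℝ) :
    contrast (fun i j => θ i * θ j) 0 = configV θ := by
  have h1 : fullMean (edgeKernel fun i j => θ i * θ j) = ((∑ i, θ i) / n) ^ 2 := by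
    rw [fullMean_edgeKernel, div_pow, sq (∑ i, θ i), Finset.sum_mul_sum]
  have h2 : fullMean (triangleKernel fun i j => θ i * θ j) = ((∑ i, θ i ^ 2) / n) ^ 3 := by
    rw [fullMean, div_pow]
    congr 1
    have : ∀ i j k, triangleKernel (fun i j => θ i * θ j) i j k =
        θ i ^ 2 * (θ j ^ 2 * θ k ^ 2) := fun i j k => by
      unfold triangleKernel
      ring
    simp_rw [this, ← Finset.mul_sum, ← Finset.sum_mul]
    ring
  rw [contrast, h1, h2, configV]
  ring

/-- The diagonal entries θᵢ² can exceed 1. They enter the population frequencies but not the law, so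
`IsKernel` asks them only to lie in [0, ρ]. -/
lemma isKernel_configuration {n : ℕ} {θ : Fin n → ℝ} {ρ : ℝ}
    (hθ : ∀ i j, i < j → θ i * θ j ∈ Set.Icc (0 : ℝ) 1) (hρ : ‖θ‖ ^ 2 ≤ ρ) :
    IsKernel (fun i j => θ i * θ j) ρ where
  isEdgeProb := hθ
  symm i j := mul_comm _ _
  nonneg i j := by
    rcases lt_trichotomy i j with h | h | h
    · exact (hθ i j h).1
    · rw [h]; exact mul_self_nonneg _
    · rw [mul_comm]; exact (hθ j i h).1
  le i j := by
    refine le_trans ?_ hρ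
    calc θ i * θ j ≤ |θ i * θ j| := le_abs_self _
      _ = ‖θ i‖ * ‖θ j‖ := abs_mul _ _
      _ ≤ ‖θ‖ * ‖θ‖ := mul_le_mul (norm_le_pi_norm θ i) (norm_le_pi_norm θ j) (norm_nonneg _)
          (norm_nonneg _)
      _ = ‖θ‖ ^ 2 := (sq _).symm

theorem consistentForSlowThresholds_configModels {m : ℕ → ℕ}
    (hm : ∀ n, 1 ≤ n → 1 ≤ m n ∧ m n ≤ n) {ρ δ : ℕ → ℝ} (hδ : ∀ n, 0 ≤ δ n)
    (hρ : Tendsto (fun n : ℕ => (n : ℝ) * ρ n) atTop atTop)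
    (hR : Tendsto (fun n => δ n ^ 2 / noiseLevel n (m n) (ρ n)) atTop atTop) :
    ConsistentForSlowThresholds m (fun n => configModels n (ρ n) (δ n)) := by
  refine consistentForSlowThresholds_of_contrast hm hρ hR ?_
  filter_upwards [hρ.eventually_ge_atTop 0, eventually_ge_atTop 1] with n h0 h1 μ hμ
  obtain ⟨θ, hθ, hθρ, hV, rfl⟩ := hμ
  refine ⟨_, 0, isKernel_configuration hθ hθρ, ?_, ?_, rfl⟩
  · rw [abs_zero]
    exact (sq_nonneg _).trans hθρ
  · rw [contrast_configuration]
    have := hδ n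
    gcongr

/-! ### Matrices and the Frobenius norm -/

section Frobenius

variable {r : ℕ}

/-- The squared Frobenius norm. -/
def frobSq (A : Matrix (Fin r) (Fin r) ℝ) : ℝ := ∑ s, ∑ t, A s t ^ 2

lemma frobSq_nonneg (A : Matrix (Fin r) (Fin r) ℝ) : 0 ≤ frobSq A :=
  Finset.sum_nonneg fun _ _ => Finset.sum_nonneg fun _ _ => sq_nonneg _

lemma frobSq_mul_le (A B : Matrix (Fin r) (Fin r) ℝ) : frobSq (A * B) ≤ frobSq A * frobSq B := by
  have h : ∀ s t, (A * B) s t ^ 2 ≤ (∑ u, A s u ^ 2) * ∑ u, B u t ^ 2 := fun s t => by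
    rw [Matrix.mul_apply]
    exact Finset.sum_mul_sq_le_sq_mul_sq _ _ _
  calc frobSq (A * B) ≤ ∑ s, ∑ t, (∑ u, A s u ^ 2) * ∑ u, B u t ^ 2 :=
        Finset.sum_le_sum fun s _ => Finset.sum_le_sum fun t _ => h s t
    _ = frobSq A * ∑ t, ∑ u, B u t ^ 2 := by rw [← Finset.sum_mul_sum]; rfl
    _ = frobSq A * frobSq B := by rw [Finset.sum_comm]; rfl

lemma sq_trace_mul_le (A B : Matrix (Fin r) (Fin r) ℝ) :
    (A * B).trace ^ 2 ≤ frobSq A * frobSq B := by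
  have h1 : (A * B).trace = ∑ q : Fin r × Fin r, A q.1 q.2 * B q.2 q.1 := by
    rw [← Finset.univ_product_univ, Finset.sum_product]
    rfl
  have h2 : frobSq A = ∑ q : Fin r × Fin r, A q.1 q.2 ^ 2 := by
    rw [← Finset.univ_product_univ, Finset.sum_product]
    rfl
  have h3 : frobSq B = ∑ q : Fin r × Fin r, B q.2 q.1 ^ 2 := by
    rw [← Finset.univ_product_univ, Finset.sum_product, Finset.sum_comm]
    rfl
  rw [h1, h2, h3]
  exact Finset.sum_mul_sq_le_sq_mul_sq _ _ _

lemma frobSq_add_le (A B C : Matrix (Fin r) (Fin r) ℝ) :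
    frobSq (A + B + C) ≤ 3 * (frobSq A + frobSq B + frobSq C) := by
  unfold frobSq
  rw [← Finset.sum_add_distrib, ← Finset.sum_add_distrib, Finset.mul_sum]
  refine Finset.sum_le_sum fun s _ => ?_
  rw [← Finset.sum_add_distrib, ← Finset.sum_add_distrib, Finset.mul_sum]
  refine Finset.sum_le_sum fun t _ => ?_
  rw [Matrix.add_apply, Matrix.add_apply]
  nlinarith [sq_nonneg (A s t - B s t), sq_nonneg (A s t - C s t), sq_nonneg (B s t - C s t)]

/-- Cyclicity of the trace allows the factorization tr A³ - tr S³ = tr((A - S)(A² + AS + S²))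
without commutativity; Cauchy–Schwarz and submultiplicativity of the Frobenius norm do the rest. -/
lemma sq_trace_cube_sub_le {A S : Matrix (Fin r) (Fin r) ℝ} {ρ : ℝ} (hA : frobSq A ≤ ρ ^ 2)
    (hS : frobSq S ≤ ρ ^ 2) :
    ((A ^ 3).trace - (S ^ 3).trace) ^ 2 ≤ 9 * ρ ^ 4 * frobSq (A - S) := by
  have h1 : (A ^ 3).trace - (S ^ 3).trace =
      ((A - S) * (A * A + A * S + S * S)).trace := by
    have c1 : (S * (A * A)).trace = (A * (A * S)).trace := by
      rw [Matrix.trace_mul_comm, Matrix.mul_assoc]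
    have c2 : (S * (A * S)).trace = (A * (S * S)).trace := by
      rw [Matrix.trace_mul_comm, Matrix.mul_assoc]
    simp only [pow_three, sub_mul, mul_add, Matrix.trace_sub, Matrix.trace_add]
    rw [c1, c2]
    ring
  have e : ∀ X Y : Matrix (Fin r) (Fin r) ℝ, frobSq X ≤ ρ ^ 2 → frobSq Y ≤ ρ ^ 2 →
      frobSq (X * Y) ≤ ρ ^ 4 := by
    intro X Y hX hY
    calc frobSq (X * Y) ≤ frobSq X * frobSq Y := frobSq_mul_le X Y
      _ ≤ ρ ^ 2 * ρ ^ 2 := mul_le_mul hX hY (frobSq_nonneg Y) (sq_nonneg ρ)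
      _ = ρ ^ 4 := by ring
  rw [h1]
  refine (sq_trace_mul_le _ _).trans ?_
  have h2 := frobSq_add_le (A * A) (A * S) (S * S)
  have h3 : frobSq (A * A + A * S + S * S) ≤ 9 * ρ ^ 4 := by
    linarith [e A A hA hA, e A S hA hS, e S S hS hS]
  rw [mul_comm]
  exact mul_le_mul_of_nonneg_right h3 (frobSq_nonneg _)

/-- The map x ↦ x³ is 3ρ²-Lipschitz on [0, ρ], and the difference of the squared norms is the inner
product of u - v and u + v; hence 9 · 4 = 36. -/
lemma sq_cube_sub_le {u v : Fin r → ℝ} {ρ : ℝ} (hu : ∑ l, u l ^ 2 ≤ ρ) (hv : ∑ l, v l ^ 2 ≤ ρ) :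
    ((∑ l, u l ^ 2) ^ 3 - (∑ l, v l ^ 2) ^ 3) ^ 2 ≤ 36 * ρ ^ 5 * ∑ l, (u l - v l) ^ 2 := by
  have hx0 : 0 ≤ ∑ l, u l ^ 2 := Finset.sum_nonneg fun _ _ => sq_nonneg _
  have hy0 : 0 ≤ ∑ l, v l ^ 2 := Finset.sum_nonneg fun _ _ => sq_nonneg _
  have hd0 : 0 ≤ ∑ l, (u l - v l) ^ 2 := Finset.sum_nonneg fun _ _ => sq_nonneg _
  have hsub : (∑ l, u l ^ 2 - ∑ l, v l ^ 2) ^ 2 ≤ 4 * ρ * ∑ l, (u l - v l) ^ 2 := by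
    have e1 : ∑ l, u l ^ 2 - ∑ l, v l ^ 2 = ∑ l, (u l - v l) * (u l + v l) := by
      rw [← Finset.sum_sub_distrib]
      exact Finset.sum_congr rfl fun l _ => by ring
    have e2 : ∑ l, (u l + v l) ^ 2 ≤ 4 * ρ := by
      have : ∑ l, (u l + v l) ^ 2 ≤ ∑ l, (2 * u l ^ 2 + 2 * v l ^ 2) :=
        Finset.sum_le_sum fun l _ => by nlinarith [sq_nonneg (u l - v l)]
      rw [Finset.sum_add_distrib, ← Finset.mul_sum, ← Finset.mul_sum] at this
      linarith
    rw [e1, mul_comm (4 * ρ)]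
    exact (Finset.sum_mul_sq_le_sq_mul_sq _ _ _).trans (mul_le_mul_of_nonneg_left e2 hd0)
  set x := ∑ l, u l ^ 2
  set y := ∑ l, v l ^ 2
  have hρ0 : 0 ≤ ρ := hx0.trans hu
  have h3 : x ^ 2 + x * y + y ^ 2 ≤ 3 * ρ ^ 2 := by
    have a1 : x ^ 2 ≤ ρ ^ 2 := by gcongr
    have a2 : y ^ 2 ≤ ρ ^ 2 := by gcongr
    have a3 : x * y ≤ ρ * ρ := by gcongr
    nlinarith
  calc (x ^ 3 - y ^ 3) ^ 2 = (x ^ 2 + x * y + y ^ 2) ^ 2 * (x - y) ^ 2 := by ring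
    _ ≤ (3 * ρ ^ 2) ^ 2 * (4 * ρ * ∑ l, (u l - v l) ^ 2) := by gcongr
    _ = 36 * ρ ^ 5 * ∑ l, (u l - v l) ^ 2 := by ring

end Frobenius

/-! ### Contrasts of Gram matrices -/

section Gram

variable {n r : ℕ}

/-- The empirical second moment matrix of the rows of `φ`. -/
noncomputable def empSecondMoment (φ : Fin n → Fin r → ℝ) : Matrix (Fin r) (Fin r) ℝ :=
  Matrix.of fun s t => (∑ i, φ i s * φ i t) / n

/-- The empirical mean of the rows of `φ`. -/
noncomputable def empMean (φ : Fin n → Fin r → ℝ) (l : Fin r) : ℝ := (∑ i, φ i l) / n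

/-- The kernel is ΦΦᵀ, and tr((ΦΦᵀ)³) = tr((ΦᵀΦ)³) moves the triangle frequency from nodes to
features, where it becomes a function of an empirical mean. -/
lemma contrast_gram (φ : Fin n → Fin r → ℝ) :
    contrast (fun i j => ∑ l, φ i l * φ j l) 0 =
      (empSecondMoment φ ^ 3).trace - (∑ l, empMean φ l ^ 2) ^ 3 := by
  set Φ : Matrix (Fin n) (Fin r) ℝ := Matrix.of φ with hΦ
  have hP : ∀ i j, ∑ l, φ i l * φ j l = (Φ * Φ.transpose) i j := fun i j => rfl
  have hE : empSecondMoment φ = (n : ℝ)⁻¹ • (Φ.transpose * Φ) := by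
    ext s t
    rw [Matrix.smul_apply, Matrix.mul_apply, smul_eq_mul, inv_mul_eq_div]
    rfl
  have h1 : fullMean (edgeKernel fun i j => ∑ l, φ i l * φ j l) = ∑ l, empMean φ l ^ 2 := by
    rw [fullMean_edgeKernel]
    have : ∑ i, ∑ j, ∑ l, φ i l * φ j l = ∑ l, (∑ i, φ i l) ^ 2 := by
      rw [Finset.sum_congr rfl fun i _ => Finset.sum_comm, Finset.sum_comm]
      refine Finset.sum_congr rfl fun l _ => ?_
      rw [sq, Finset.sum_mul_sum]
    rw [this, Finset.sum_div]
    exact Finset.sum_congr rfl fun l _ => (div_pow _ _ _).symm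
  have h2 : fullMean (triangleKernel fun i j => ∑ l, φ i l * φ j l) =
      (empSecondMoment φ ^ 3).trace := by
    have e1 : ∑ i, ∑ j, ∑ k, triangleKernel (fun i j => ∑ l, φ i l * φ j l) i j k =
        ((Φ * Φ.transpose) * ((Φ * Φ.transpose) * (Φ * Φ.transpose))).trace := by
      have hsymm : ∀ i k, (Φ * Φ.transpose) i k = (Φ * Φ.transpose) k i := fun i k => by
        rw [← Matrix.transpose_apply (Φ * Φ.transpose), Matrix.transpose_mul,
          Matrix.transpose_transpose]
      simp only [Matrix.trace, Matrix.diag, Matrix.mul_apply (M := Φ * Φ.transpose),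
        Finset.mul_sum]
      refine Finset.sum_congr rfl fun i _ => Finset.sum_congr rfl fun j _ =>
        Finset.sum_congr rfl fun k _ => ?_
      rw [triangleKernel, hP, hP, hP, hsymm i k]
      ring
    have e2 : ((Φ * Φ.transpose) * ((Φ * Φ.transpose) * (Φ * Φ.transpose))).trace =
        ((Φ.transpose * Φ) ^ 3).trace := by
      rw [Matrix.mul_assoc, Matrix.trace_mul_comm, pow_three]
      simp only [Matrix.mul_assoc]
    rw [fullMean, e1, e2, hE, smul_pow, Matrix.trace_smul, smul_eq_mul, inv_pow, inv_mul_eq_div]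
  rw [contrast, h1, h2]
  ring

/-- The product form of the entrywise bound keeps the estimate independent of the rank r. -/
lemma frobSq_le_of_abs_le {A : Matrix (Fin r) (Fin r) ℝ} {b : Fin r → ℝ} {ρ : ℝ}
    (hb : ∑ l, b l ^ 2 ≤ ρ) (hA : ∀ s t, |A s t| ≤ b s * b t) : frobSq A ≤ ρ ^ 2 := by
  have h0 : 0 ≤ ∑ l, b l ^ 2 := Finset.sum_nonneg fun _ _ => sq_nonneg _
  calc frobSq A ≤ ∑ s, ∑ t, b s ^ 2 * b t ^ 2 := by
        refine Finset.sum_le_sum fun s _ => Finset.sum_le_sum fun t _ => ?_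
        rw [← mul_pow]
        exact sq_le_sq' (abs_le.1 (hA s t)).1 (abs_le.1 (hA s t)).2
    _ = (∑ l, b l ^ 2) ^ 2 := by rw [← Finset.sum_mul_sum, sq]
    _ ≤ ρ ^ 2 := by gcongr

lemma abs_mean_le (hn : 1 ≤ n) {f : Fin n → ℝ} {B : ℝ} (hf : ∀ i, |f i| ≤ B) :
    |(∑ i, f i) / n| ≤ B := by
  have hn0 : (0 : ℝ) < n := by exact_mod_cast hn
  rw [abs_div, abs_of_pos hn0, div_le_iff₀ hn0]
  have := (Finset.abs_sum_le_sum_abs f Finset.univ).trans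
    (Finset.sum_le_card_nsmul _ _ _ fun i _ => hf i)
  rw [Finset.card_univ, Fintype.card_fin, nsmul_eq_mul] at this
  linarith

end Gram

/-! ### Means of independent and identically distributed variables -/

lemma integral_sq_mean_sub_le {X : Type*} [MeasureSpace X]
    [IsProbabilityMeasure (volume : Measure X)] {n : ℕ} (hn : 1 ≤ n) {h : X → ℝ}
    (hh : Measurable h) {B : ℝ} (hB : ∀ x, |h x| ≤ B) :
    Integrable (fun ξ : Fin n → X => ((∑ i, h (ξ i)) / n - ∫ x, h x) ^ 2) ∧
      ∫ ξ : Fin n → X, ((∑ i, h (ξ i)) / n - ∫ x, h x) ^ 2 ≤ B ^ 2 / n := by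
  have hn0 : (0 : ℝ) < n := by exact_mod_cast hn
  have hmem : MemLp h 2 (volume : Measure X) :=
    MemLp.of_bound hh.aestronglyMeasurable B (ae_of_all _ hB)
  have hsm : Measurable fun ξ : Fin n → X => (∑ i, h (ξ i)) / n := by
    have : ∀ i, Measurable fun ξ : Fin n → X => h (ξ i) := fun i =>
      hh.comp (measurable_pi_apply i)
    fun_prop
  have hmemS : MemLp (fun ξ : Fin n → X => (∑ i, h (ξ i)) / n) 2 volume :=
    MemLp.of_bound hsm.aestronglyMeasurable B (ae_of_all _ fun ξ => abs_mean_le hn fun i => hB _)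
  refine ⟨(hmemS.sub (memLp_const _)).integrable_sq, ?_⟩
  have hcoord : ∀ i : Fin n, Integrable fun ξ : Fin n → X => h (ξ i) := fun i =>
    (MemLp.of_bound (p := 1) (hh.comp (measurable_pi_apply i)).aestronglyMeasurable B
      (ae_of_all _ fun ξ => hB _)).integrable le_rfl
  have hmean : ∫ ξ : Fin n → X, (∑ i, h (ξ i)) / n = ∫ x, h x := by
    rw [integral_div, integral_finsetSum _ fun i _ => hcoord i]
    have : ∀ i : Fin n, ∫ ξ : Fin n → X, h (ξ i) = ∫ x, h x := fun i => by
      rw [volume_pi]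
      exact integral_comp_eval hh.aestronglyMeasurable
    simp_rw [this]
    simp only [Finset.sum_const, Finset.card_univ, Fintype.card_fin, nsmul_eq_mul]
    field_simp
  have hvar := ProbabilityTheory.variance_eq_integral
    (μ := (volume : Measure (Fin n → X))) hsm.aemeasurable
  rw [hmean] at hvar
  rw [← hvar]
  have e1 : (fun ξ : Fin n → X => (∑ i, h (ξ i)) / n) =
      fun ξ => (n : ℝ)⁻¹ * (∑ i : Fin n, fun ξ : Fin n → X => h (ξ i)) ξ := by
    funext ξ
    rw [Finset.sum_apply, inv_mul_eq_div]
  rw [e1, ProbabilityTheory.variance_const_mul, volume_pi,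
    ProbabilityTheory.variance_sum_pi (X := fun _ => h) fun _ => hmem]
  have hv : ProbabilityTheory.variance h (volume : Measure X) ≤ B ^ 2 := by
    refine (ProbabilityTheory.variance_le_expectation_sq hh.aestronglyMeasurable).trans ?_
    have : ∫ x, (h ^ 2) x ≤ ∫ _x : X, B ^ 2 := by
      refine integral_mono hmem.integrable_sq (integrable_const _) fun x => ?_
      exact sq_le_sq' (abs_le.1 (hB x)).1 (abs_le.1 (hB x)).2
    simpa using this
  simp only [Finset.sum_const, Finset.card_univ, Fintype.card_fin, nsmul_eq_mul]
  calc (n : ℝ)⁻¹ ^ 2 * (n * ProbabilityTheory.variance h volume)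
      ≤ (n : ℝ)⁻¹ ^ 2 * (n * B ^ 2) := by gcongr
    _ = B ^ 2 / n := by field_simp

/-! ### Latent variable models -/

lemma bernoulliLaw_singleton (p : ℝ) (x : Bool) :
    bernoulliLaw p {x} = if x then ENNReal.ofReal p else ENNReal.ofReal (1 - p) := by
  cases x <;> simp [bernoulliLaw]

/-- On the finite space of networks, probabilities are finite sums of products of edge
probabilities. Measurability is what gives the mixture `Measure.bind` its meaning. -/
lemma measurable_graphLaw {Ω : Type*} [MeasurableSpace Ω] {n : ℕ}
    {P : Ω → Fin n → Fin n → ℝ} (hP : ∀ ω, IsEdgeProb (P ω))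
    (hm : ∀ i j, Measurable fun ω => P ω i j) : Measurable fun ω => graphLaw (P ω) := by
  refine Measure.measurable_of_measurable_coe _ fun s _ => ?_
  have h1 : ∀ ω, graphLaw (P ω) s = ∑ A ∈ s.toFinite.toFinset, ∏ e : Pairs n,
      (if A e then ENNReal.ofReal (P ω e.1.1 e.1.2) else ENNReal.ofReal (1 - P ω e.1.1 e.1.2)) := by
    intro ω
    have hpr : ∀ e : Pairs n, IsProbabilityMeasure (bernoulliLaw (P ω e.1.1 e.1.2)) := fun e =>
      isProbabilityMeasure_bernoulliLaw (hP ω _ _ e.2)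
    have hs : s = (s.toFinite.toFinset : Set (Graph n)) := by simp
    conv_lhs => rw [hs]
    rw [← sum_measure_singleton]
    refine Finset.sum_congr rfl fun A _ => ?_
    rw [graphLaw, Measure.pi_singleton]
    exact Finset.prod_congr rfl fun e _ => bernoulliLaw_singleton _ _
  simp_rw [h1]
  refine Finset.measurable_sum _ fun A _ => Finset.measurable_prod _ fun e _ => ?_
  split_ifs
  · exact (hm _ _).ennreal_ofReal
  · exact ((hm _ _).const_sub 1).ennreal_ofReal

lemma integrable_real_graphLaw {Ω : Type*} [MeasurableSpace Ω] {ν : Measure Ω}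
    [IsProbabilityMeasure ν] {n : ℕ} {P : Ω → Fin n → Fin n → ℝ} (hP : ∀ ω, IsEdgeProb (P ω))
    (hm : ∀ i j, Measurable fun ω => P ω i j) (s : Set (Graph n)) :
    Integrable (fun ω => (graphLaw (P ω)).real s) ν := by
  have hmeas : Measurable fun ω => (graphLaw (P ω)).real s :=
    ((Measure.measurable_coe (Set.toFinite s).measurableSet).comp
      (measurable_graphLaw hP hm)).ennreal_toReal
  refine (MemLp.of_bound (p := 1) hmeas.aestronglyMeasurable 1
    (ae_of_all _ fun ω => ?_)).integrable le_rfl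
  have := (hP ω).isProbabilityMeasure
  rw [Real.norm_of_nonneg measureReal_nonneg]
  exact measureReal_le_one

/-- The rejection probability is linear in the law, so for a mixture it suffices to bound it
conditionally on the latent variables and integrate. -/
lemma rejectProb_bind {Ω : Type*} [MeasurableSpace Ω] {ν : Measure Ω}
    [IsProbabilityMeasure ν] {n : ℕ} {P : Ω → Fin n → Fin n → ℝ} (hP : ∀ ω, IsEdgeProb (P ω))
    (hm : ∀ i j, Measurable fun ω => P ω i j) (m : ℕ) (c : ℝ) :
    Integrable (fun ω => rejectProb m c (graphLaw (P ω))) ν ∧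
      rejectProb m c (ν.bind fun ω => graphLaw (P ω)) =
        ∫ ω, rejectProb m c (graphLaw (P ω)) ∂ν := by
  have hint := fun s : Set (Graph n) => integrable_real_graphLaw (ν := ν) hP hm s
  have hreal : ∀ s : Set (Graph n), (ν.bind fun ω => graphLaw (P ω)).real s =
      ∫ ω, (graphLaw (P ω)).real s ∂ν := by
    intro s
    have hs := (Set.toFinite s).measurableSet
    rw [Measure.real, Measure.bind_apply hs (measurable_graphLaw hP hm).aemeasurable]
    refine (integral_toReal ?_ (ae_of_all _ fun ω => ?_)).symm
    · exact ((Measure.measurable_coe hs).comp (measurable_graphLaw hP hm)).aemeasurable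
    · have := (hP ω).isProbabilityMeasure
      exact measure_lt_top _ _
  unfold rejectProb
  refine ⟨(integrable_finsetSum _ fun M _ => hint _).div_const _, ?_⟩
  rw [integral_div, integral_finsetSum _ fun M _ => hint _]
  simp_rw [hreal]

section Latent

variable {n r : ℕ} {g : Fin r → unitInterval → ℝ} {ρ : ℝ}

lemma exists_bound_of_sum_iSup_le (hρ : 0 ≤ ρ)
    (hg : ∑ l, (⨆ t, ‖g l t‖ₑ) ^ 2 ≤ ENNReal.ofReal ρ) :
    ∃ b : Fin r → ℝ, (∀ l t, |g l t| ≤ b l) ∧ ∑ l, b l ^ 2 ≤ ρ := by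
  have hfin : ∀ l, (⨆ t, ‖g l t‖ₑ) ≠ ⊤ := by
    intro l h
    have h1 : (⨆ t, ‖g l t‖ₑ) ^ 2 ≤ ENNReal.ofReal ρ :=
      (Finset.single_le_sum (f := fun l => (⨆ t, ‖g l t‖ₑ) ^ 2) (fun _ _ => zero_le)
        (Finset.mem_univ l)).trans hg
    rw [h] at h1
    simp at h1
  refine ⟨fun l => (⨆ t, ‖g l t‖ₑ).toReal, fun l t => ?_, ?_⟩
  · rw [← Real.norm_eq_abs, ← toReal_enorm]
    exact ENNReal.toReal_mono (hfin l) (le_iSup (fun t => ‖g l t‖ₑ) t)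
  · have := ENNReal.toReal_mono ENNReal.ofReal_ne_top hg
    rw [ENNReal.toReal_ofReal hρ, ENNReal.toReal_sum fun l _ => ENNReal.pow_ne_top (hfin l)] at this
    simpa [ENNReal.toReal_pow] using this

lemma isKernel_latentGraphon {b : Fin r → ℝ}
    (hf : ∀ x y, latentGraphon g x y ∈ Set.Icc (0 : ℝ) 1) (hb : ∀ l t, |g l t| ≤ b l)
    (hbρ : ∑ l, b l ^ 2 ≤ ρ) (ξ : Fin n → Fin r → unitInterval) :
    IsKernel (fun i j => latentGraphon g (ξ i) (ξ j)) ρ where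
  isEdgeProb i j _ := hf _ _
  symm i j := Finset.sum_congr rfl fun l _ => mul_comm _ _
  nonneg i j := (hf _ _).1
  le i j := by
    refine le_trans (Finset.sum_le_sum fun l _ => ?_) hbρ
    calc g l (ξ i l) * g l (ξ j l) ≤ |g l (ξ i l) * g l (ξ j l)| := le_abs_self _
      _ = |g l (ξ i l)| * |g l (ξ j l)| := abs_mul _ _
      _ ≤ b l * b l := mul_le_mul (hb _ _) (hb _ _) (abs_nonneg _)
          ((abs_nonneg _).trans (hb l (ξ i l)))
      _ = b l ^ 2 := (sq _).symm

/-- The values of the latent features at the nodes. -/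
def latentFeatures (g : Fin r → unitInterval → ℝ) (ξ : Fin n → Fin r → unitInterval)
    (i : Fin n) (l : Fin r) : ℝ := g l (ξ i l)

/-- The means of the latent features. -/
noncomputable def latentMean (g : Fin r → unitInterval → ℝ) (l : Fin r) : ℝ :=
  ∫ x : Fin r → unitInterval, g l (x l)

/-- An upper bound for the squared difference between the contrast of the sampled kernel and its
population value. -/
noncomputable def latentError (g : Fin r → unitInterval → ℝ) (ρ : ℝ)
    (ξ : Fin n → Fin r → unitInterval) : ℝ :=
  18 * ρ ^ 4 * frobSq (empSecondMoment (latentFeatures g ξ) - latentSecondMoment g) +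
    72 * ρ ^ 5 * ∑ l, (empMean (latentFeatures g ξ) l - latentMean g l) ^ 2

/-- Empirical and population moments obey the same bounds in terms of ρ, so the two Lipschitz
estimates apply; squaring a difference doubles 9 and 36. -/
lemma sq_contrast_sub_latentV_le (hn : 1 ≤ n) {b : Fin r → ℝ} (hb : ∀ l t, |g l t| ≤ b l)
    (hbρ : ∑ l, b l ^ 2 ≤ ρ) (ξ : Fin n → Fin r → unitInterval) :
    (contrast (fun i j => latentGraphon g (ξ i) (ξ j)) 0 - latentV g) ^ 2 ≤ latentError g ρ ξ := by
  have hc := contrast_gram (latentFeatures g ξ)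
  have e : (fun i j => latentGraphon g (ξ i) (ξ j)) =
      fun i j => ∑ l, latentFeatures g ξ i l * latentFeatures g ξ j l := rfl
  rw [e, hc]
  have hprod : ∀ s t (x y : unitInterval), |g s x * g t y| ≤ b s * b t := fun s t x y => by
    rw [abs_mul]
    exact mul_le_mul (hb s x) (hb t y) (abs_nonneg _) ((abs_nonneg _).trans (hb s x))
  have h1 : frobSq (empSecondMoment (latentFeatures g ξ)) ≤ ρ ^ 2 :=
    frobSq_le_of_abs_le hbρ fun s t => abs_mean_le hn fun i => hprod s t _ _
  have h2 : frobSq (latentSecondMoment g) ≤ ρ ^ 2 := by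
    refine frobSq_le_of_abs_le hbρ fun s t => ?_
    have := norm_integral_le_of_norm_le_const
      (μ := (volume : Measure (Fin r → unitInterval))) (f := fun x => g s (x s) * g t (x t))
      (ae_of_all _ fun x => hprod s t _ _)
    rw [probReal_univ, mul_one] at this
    exact this
  have sqle : ∀ {x y : ℝ}, |x| ≤ y → x ^ 2 ≤ y ^ 2 := fun h =>
    sq_le_sq' (abs_le.1 h).1 (abs_le.1 h).2
  have h3 : ∑ l, empMean (latentFeatures g ξ) l ^ 2 ≤ ρ :=
    (Finset.sum_le_sum fun l _ => sqle (abs_mean_le hn fun i => hb l _)).trans hbρ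
  have h4 : ∑ l, latentMean g l ^ 2 ≤ ρ := by
    refine (Finset.sum_le_sum fun l _ => sqle ?_).trans hbρ
    have := norm_integral_le_of_norm_le_const
      (μ := (volume : Measure (Fin r → unitInterval))) (f := fun x => g l (x l))
      (ae_of_all _ fun x => hb l _)
    rw [probReal_univ, mul_one] at this
    exact this
  have k1 := sq_trace_cube_sub_le h1 h2
  have k2 := sq_cube_sub_le h3 h4
  have hV : latentV g = (latentSecondMoment g ^ 3).trace - (∑ l, latentMean g l ^ 2) ^ 3 := rfl
  rw [hV, latentError]
  nlinarith [sq_nonneg (((empSecondMoment (latentFeatures g ξ) ^ 3).trace -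
      (latentSecondMoment g ^ 3).trace) + ((∑ l, empMean (latentFeatures g ξ) l ^ 2) ^ 3 -
      (∑ l, latentMean g l ^ 2) ^ 3))]

/-- Each entry is an i.i.d. mean with variance at most (b_s b_t)²/n or b_l²/n, and these sum to at
most ρ²/n and ρ/n. -/
lemma integral_latentError_le (hn : 1 ≤ n) (hgm : ∀ l, Measurable (g l)) {b : Fin r → ℝ}
    (hb : ∀ l t, |g l t| ≤ b l) (hbρ : ∑ l, b l ^ 2 ≤ ρ) :
    Integrable (fun ξ : Fin n → Fin r → unitInterval => latentError g ρ ξ) ∧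
      ∫ ξ : Fin n → Fin r → unitInterval, latentError g ρ ξ ≤ 90 * (ρ ^ 6 / n) := by
  have hn0 : (0 : ℝ) < n := by exact_mod_cast hn
  have hρ : 0 ≤ ρ := (Finset.sum_nonneg fun l _ => sq_nonneg (b l)).trans hbρ
  have hprod : ∀ s t (x y : unitInterval), |g s x * g t y| ≤ b s * b t := fun s t x y => by
    rw [abs_mul]
    exact mul_le_mul (hb s x) (hb t y) (abs_nonneg _) ((abs_nonneg _).trans (hb s x))
  have hgm' : ∀ l, Measurable fun x : Fin r → unitInterval => g l (x l) := fun l =>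
    (hgm l).comp (measurable_pi_apply l)
  have hS : ∀ s t, Integrable (fun ξ : Fin n → Fin r → unitInterval =>
      (empSecondMoment (latentFeatures g ξ) - latentSecondMoment g) s t ^ 2) ∧
      ∫ ξ : Fin n → Fin r → unitInterval,
        (empSecondMoment (latentFeatures g ξ) - latentSecondMoment g) s t ^ 2 ≤
          (b s * b t) ^ 2 / n := fun s t => integral_sq_mean_sub_le hn ((hgm' s).mul (hgm' t)) (B := b s * b t)
    fun x => hprod s t _ _
  have hE : ∀ l, Integrable (fun ξ : Fin n → Fin r → unitInterval =>
      (empMean (latentFeatures g ξ) l - latentMean g l) ^ 2) ∧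
      ∫ ξ : Fin n → Fin r → unitInterval,
        (empMean (latentFeatures g ξ) l - latentMean g l) ^ 2 ≤ b l ^ 2 / n := fun l => integral_sq_mean_sub_le hn (hgm' l) (B := b l) fun x => hb l _
  have i1 : Integrable (fun ξ : Fin n → Fin r → unitInterval =>
      frobSq (empSecondMoment (latentFeatures g ξ) - latentSecondMoment g)) :=
    integrable_finsetSum _ fun s _ => integrable_finsetSum _ fun t _ => (hS s t).1
  have i2 : Integrable (fun ξ : Fin n → Fin r → unitInterval =>
      ∑ l, (empMean (latentFeatures g ξ) l - latentMean g l) ^ 2) :=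
    integrable_finsetSum _ fun l _ => (hE l).1
  have hsumb : 0 ≤ ∑ l, b l ^ 2 := Finset.sum_nonneg fun l _ => sq_nonneg (b l)
  have j1 : ∫ ξ : Fin n → Fin r → unitInterval,
      frobSq (empSecondMoment (latentFeatures g ξ) - latentSecondMoment g) ≤ ρ ^ 2 / n := by
    calc _ = ∑ s, ∑ t, ∫ ξ : Fin n → Fin r → unitInterval,
            (empSecondMoment (latentFeatures g ξ) - latentSecondMoment g) s t ^ 2 := by
          unfold frobSq
          rw [integral_finsetSum _ fun s _ => integrable_finsetSum _ fun t _ => (hS s t).1]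
          exact Finset.sum_congr rfl fun s _ => integral_finsetSum _ fun t _ => (hS s t).1
      _ ≤ ∑ s, ∑ t, (b s * b t) ^ 2 / n :=
          Finset.sum_le_sum fun s _ => Finset.sum_le_sum fun t _ => (hS s t).2
      _ = (∑ l, b l ^ 2) ^ 2 / n := by
          simp_rw [← Finset.sum_div, mul_pow]
          rw [← Finset.sum_mul_sum, sq]
      _ ≤ ρ ^ 2 / n := by gcongr
  have j2 : ∫ ξ : Fin n → Fin r → unitInterval,
      ∑ l, (empMean (latentFeatures g ξ) l - latentMean g l) ^ 2 ≤ ρ / n := by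
    calc _ = ∑ l, ∫ ξ : Fin n → Fin r → unitInterval,
            (empMean (latentFeatures g ξ) l - latentMean g l) ^ 2 :=
          integral_finsetSum _ fun l _ => (hE l).1
      _ ≤ ∑ l, b l ^ 2 / n := Finset.sum_le_sum fun l _ => (hE l).2
      _ = (∑ l, b l ^ 2) / n := by rw [Finset.sum_div]
      _ ≤ ρ / n := by gcongr
  unfold latentError
  refine ⟨(i1.const_mul _).add (i2.const_mul _), ?_⟩
  rw [integral_add (i1.const_mul _) (i2.const_mul _), integral_const_mul, integral_const_mul]
  calc _ ≤ 18 * ρ ^ 4 * (ρ ^ 2 / n) + 72 * ρ ^ 5 * (ρ / n) := by gcongr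
    _ = 90 * (ρ ^ 6 / n) := by ring

lemma latentError_nonneg (hρ : 0 ≤ ρ) (ξ : Fin n → Fin r → unitInterval) :
    0 ≤ latentError g ρ ξ := by
  have h1 := frobSq_nonneg (empSecondMoment (latentFeatures g ξ) - latentSecondMoment g)
  have h2 : 0 ≤ ∑ l, (empMean (latentFeatures g ξ) l - latentMean g l) ^ 2 :=
    Finset.sum_nonneg fun _ _ => sq_nonneg _
  unfold latentError
  positivity

lemma le_rejectProb_latentLaw {m : ℕ} (hn : 3 ≤ n) (hm : 1 ≤ m) (hmn : m ≤ n)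
    (hρ : 1 ≤ n * ρ) (hgm : ∀ l, Measurable (g l))
    (hf : ∀ x y, latentGraphon g x y ∈ Set.Icc (0 : ℝ) 1)
    (hg : ∑ l, (⨆ t, ‖g l t‖ₑ) ^ 2 ≤ ENNReal.ofReal ρ) {δ c L : ℝ} (hδ : 0 ≤ δ)
    (hV : δ ≤ latentV g) (hc : 0 ≤ c) (hL : 1 ≤ L)
    (h : 320000 * L ^ 5 * (1 + c) * noiseLevel n m ρ < δ ^ 2) :
    1 - 10001 / L ≤ rejectProb m c (latentLaw n g) := by
  have hn0 : (0 : ℝ) < n := by exact_mod_cast (by omega : 0 < n)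
  have hm0 : (0 : ℝ) < m := by exact_mod_cast hm
  have hmn' : (m : ℝ) ≤ n := by exact_mod_cast hmn
  have hρ0 : 0 < ρ := pos_of_mul_pos_right (by linarith) hn0.le
  have hL0 : 0 < L := by linarith
  have hN : 0 < noiseLevel n m ρ := by unfold noiseLevel; positivity
  have hδ2 : 0 < δ ^ 2 := lt_of_le_of_lt (by positivity) h
  obtain ⟨b, hb, hbρ⟩ := exists_bound_of_sum_iSup_le hρ0.le hg
  have hker := fun ξ : Fin n → Fin r → unitInterval => isKernel_latentGraphon hf hb hbρ ξ
  have hmeas : ∀ i j : Fin n, Measurable fun ξ : Fin n → Fin r → unitInterval =>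
      latentGraphon g (ξ i) (ξ j) := by
    intro i j
    refine Finset.measurable_sum _ fun l _ => ?_
    have : ∀ i : Fin n, Measurable fun ξ : Fin n → Fin r → unitInterval => g l (ξ i l) :=
      fun i => (hgm l).comp ((measurable_pi_apply l).comp (measurable_pi_apply i))
    exact (this i).mul (this j)
  obtain ⟨hint, heq⟩ := rejectProb_bind
    (ν := (volume : Measure (Fin n → Fin r → unitInterval))) (fun ξ => (hker ξ).isEdgeProb)
    hmeas m c
  obtain ⟨hUint, hU⟩ := integral_latentError_le (n := n) (by omega) hgm hb hbρ
  -- If the latent error is below (δ/2)², the contrast exceeds δ/2 and the conditional bound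
  -- applies, at the cost of a factor 4. Otherwise the subtracted term is at least 1 and the
  -- inequality is trivial.
  have hpt : ∀ ξ : Fin n → Fin r → unitInterval,
      (1 - 10000 / L) - 4 / δ ^ 2 * latentError g ρ ξ ≤
        rejectProb m c (graphLaw fun i j => latentGraphon g (ξ i) (ξ j)) := by
    intro ξ
    have hU0 := latentError_nonneg (g := g) hρ0.le ξ
    have hsq := sq_contrast_sub_latentV_le (by omega) hb hbρ ξ
    by_cases hbad : latentError g ρ ξ < (δ / 2) ^ 2
    · have habs := abs_lt_of_sq_lt_sq' (hsq.trans_lt hbad) (by positivity)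
      have hcon : δ / 2 ≤ contrast (fun i j => latentGraphon g (ξ i) (ξ j)) 0 := by
        linarith [habs.1]
      have hcon2 : (δ / 2) ^ 2 ≤ contrast (fun i j => latentGraphon g (ξ i) (ξ j)) 0 ^ 2 := by
        gcongr
      have := le_rejectProb_graphLaw hn hm hmn (hker ξ) hρ (s := 0) (by simpa using hρ0.le) hc hL
        (lt_of_lt_of_le (by linarith) hcon2)
      have h4 : 0 ≤ 4 / δ ^ 2 * latentError g ρ ξ := by positivity
      linarith
    · have h4 : 1 ≤ 4 / δ ^ 2 * latentError g ρ ξ := by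
        rw [div_mul_eq_mul_div, one_le_div₀ hδ2]
        linarith
      have h5 : 0 ≤ 10000 / L := by positivity
      have := rejectProb_nonneg m c (graphLaw fun i j => latentGraphon g (ξ i) (ξ j))
      linarith
  have hmono : ∫ ξ : Fin n → Fin r → unitInterval,
      ((1 - 10000 / L) - 4 / δ ^ 2 * latentError g ρ ξ) ≤ _ := integral_mono ((integrable_const _).sub (hUint.const_mul _)) hint hpt
  rw [integral_sub (integrable_const _) (hUint.const_mul _), integral_const_mul, ← heq] at hmono
  have hconst : ∫ _ξ : Fin n → Fin r → unitInterval, (1 - 10000 / L) = 1 - 10000 / L := by simp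
  rw [hconst] at hmono
  -- Since m ≤ n, the error ρ⁶/n of the latent variables is within the noise level.
  have hsmall : 4 / δ ^ 2 * ∫ ξ : Fin n → Fin r → unitInterval, latentError g ρ ξ ≤ 1 / L := by
    have e1 : ρ ^ 6 / n ≤ noiseLevel n m ρ := by
      have : ρ ^ 6 / n ≤ ρ ^ 6 / m := by gcongr
      have h0 : 0 ≤ ρ ^ 3 / ((m : ℝ) * (n : ℝ) ^ 2) := by positivity
      unfold noiseLevel
      linarith
    have e2 : L * noiseLevel n m ρ ≤ L ^ 5 * (1 + c) * noiseLevel n m ρ := by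
      have : L ≤ L ^ 5 := le_self_pow₀ hL (by norm_num)
      have : L * 1 ≤ L ^ 5 * (1 + c) := by gcongr; linarith
      rw [mul_one] at this
      gcongr
    rw [div_mul_eq_mul_div, div_le_div_iff₀ hδ2 hL0, one_mul]
    calc 4 * (∫ ξ : Fin n → Fin r → unitInterval, latentError g ρ ξ) * L
        ≤ 4 * (90 * (ρ ^ 6 / n)) * L := by gcongr
      _ ≤ 4 * (90 * noiseLevel n m ρ) * L := by gcongr
      _ ≤ δ ^ 2 := by nlinarith
  have : 10001 / L = 10000 / L + 1 / L := by ring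
  rw [this]
  unfold latentLaw
  linarith

end Latent

theorem consistentForSlowThresholds_latentModels {m : ℕ → ℕ}
    (hm : ∀ n, 1 ≤ n → 1 ≤ m n ∧ m n ≤ n) {ρ δ : ℕ → ℝ} (hδ : ∀ n, 0 ≤ δ n)
    (hρ : Tendsto (fun n : ℕ => (n : ℝ) * ρ n) atTop atTop)
    (hR : Tendsto (fun n => δ n ^ 2 / noiseLevel n (m n) (ρ n)) atTop atTop) :
    ConsistentForSlowThresholds m (fun n => latentModels n (ρ n) (δ n)) := by
  refine consistentForSlowThresholds_of_forall (eventually_noiseLevel_pos hm hρ) hR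
    fun ε hε => ?_
  -- Halving ε leaves room for 10001 in place of 10000.
  obtain ⟨L, hL1, hL⟩ := exists_threshold_factor (half_pos hε)
  refine ⟨320000 * L ^ 5, by positivity, ?_⟩
  filter_upwards [hρ.eventually_ge_atTop 1, eventually_ge_atTop 3] with n h2 h3 c hc hlt μ hμ
  obtain ⟨r, g, hgm, hf, hg, hV, rfl⟩ := hμ
  obtain ⟨hm1, hm2⟩ := hm n (by omega)
  have := le_rejectProb_latentLaw h3 hm1 hm2 h2 hgm hf hg (hδ n) hV hc hL1 hlt
  have h1 : 10001 / L ≤ 2 * (10000 / L) := by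
    rw [mul_div_assoc']
    gcongr
    norm_num
  linarith

end NodeSampling

theorem theorem11 (m : ℕ → ℕ) (hm : ∀ n, 1 ≤ n → 1 ≤ m n ∧ m n ≤ n) :
    -- Type-I error
    (∀ p : ℕ → ℝ, (∀ n, p n ∈ Set.Icc (0 : ℝ) 1) →
      Tendsto p atTop (𝓝 0) →
      Tendsto (fun n : ℕ => p n ^ 3 * (m n : ℝ) * (n : ℝ) ^ 2) atTop atTop →
      ∀ C : ℕ → ℝ, Tendsto C atTop atTop →
        Tendsto (fun n : ℕ => rejectProb (m n) (C n) (erdosRenyi n (p n))) atTop (𝓝 0)) ∧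
    -- two communities
    (∀ (π : ℝ) (a b : ℕ → ℝ), 0 < π → π < 1 / 2 →
      (∀ n, a n ∈ Set.Icc (0 : ℝ) 1) → (∀ n, b n ∈ Set.Icc (0 : ℝ) 1) →
      Tendsto (fun n : ℕ => (n : ℝ) * (a n + b n)) atTop atTop →
      (((fun n : ℕ => a n + b n) =O[atTop] (fun n : ℕ => (n : ℝ) ^ (-(2 / 3) : ℝ)) ∧
          Tendsto (fun n : ℕ => ((m n : ℝ) * (n : ℝ) ^ 2) ^ (1 / 3 : ℝ) * (a n - b n) ^ 2 /
            (a n + b n)) atTop atTop) ∨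
        ((fun n : ℕ => (n : ℝ) ^ (-(2 / 3) : ℝ)) =O[atTop] (fun n : ℕ => a n + b n) ∧
          Tendsto (fun n : ℕ => (m n : ℝ) * (a n - b n) ^ 6 / (a n + b n) ^ 6) atTop atTop)) →
      ConsistentForSlowThresholds m (fun n => sbmTwo n π (a n) (b n))) ∧
    -- balanced communities
    (∀ (k : ℕ → ℕ) (a b : ℕ → ℝ), (∀ n, 2 ≤ k n) →
      (∀ n, a n ∈ Set.Icc (0 : ℝ) 1) → (∀ n, b n ∈ Set.Icc (0 : ℝ) 1) →
      Tendsto (fun n : ℕ => (n : ℝ) * (a n + b n)) atTop atTop →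
      (((fun n : ℕ => a n + b n) =O[atTop] (fun n : ℕ => (n : ℝ) ^ (-(2 / 3) : ℝ)) ∧
          Tendsto (fun n : ℕ => ((m n : ℝ) * (n : ℝ) ^ 2) ^ (1 / 3 : ℝ) * (a n - b n) ^ 2 /
            ((k n : ℝ) ^ (4 / 3 : ℝ) * (a n + b n))) atTop atTop) ∨
        ((fun n : ℕ => (n : ℝ) ^ (-(2 / 3) : ℝ)) =O[atTop] (fun n : ℕ => a n + b n) ∧
          Tendsto (fun n : ℕ => (m n : ℝ) * (a n - b n) ^ 6 /
            ((k n : ℝ) ^ 4 * (a n + b n) ^ 6)) atTop atTop)) →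
      ConsistentForSlowThresholds m (fun n => sbmBalanced n (k n) (a n) (b n))) ∧
    -- configuration models
    (∀ ρ δ : ℕ → ℝ, (∀ n, 0 ≤ δ n) →
      Tendsto (fun n : ℕ => (n : ℝ) * ρ n) atTop atTop →
      Tendsto (fun n : ℕ => δ n ^ 2 /
        (ρ n ^ 3 / ((m n : ℝ) * (n : ℝ) ^ 2) + ρ n ^ 6 / (m n : ℝ))) atTop atTop →
      ConsistentForSlowThresholds m (fun n => configModels n (ρ n) (δ n))) ∧
    -- low-rank latent variable models
    (∀ ρ δ : ℕ → ℝ, (∀ n, 0 ≤ δ n) →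
      Tendsto (fun n : ℕ => (n : ℝ) * ρ n) atTop atTop →
      Tendsto (fun n : ℕ => δ n ^ 2 /
        (ρ n ^ 3 / ((m n : ℝ) * (n : ℝ) ^ 2) + ρ n ^ 6 / (m n : ℝ))) atTop atTop →
      ConsistentForSlowThresholds m (fun n => latentModels n (ρ n) (δ n))) := by
  refine ⟨fun p hp hp0 hpm C hC => tendsto_rejectProb_erdosRenyi hm hp hp0 hpm hC,
    fun π a b hπ _ ha hb hab h => consistentForSlowThresholds_sbmTwo hm hπ ha hb hab h,
    fun k a b hk ha hb hab h => consistentForSlowThresholds_sbmBalanced hm hk ha hb hab h,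
    fun ρ δ hδ hρ hR => consistentForSlowThresholds_configModels hm hδ hρ hR,
    fun ρ δ hδ hρ hR => consistentForSlowThresholds_latentModels hm hδ hρ hR⟩
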